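/- **Theorem 1.2.** Let $\Omega\subset\mathbb R^d$ be open, let $T\in\mathbb R$, and let $u:\Omega\times(0,T)\to\mathbb R^d$ satisfy $\operatorname{div}_x u=0$ in $\mathcal D'(\Omega\times(0,T))$ and $$u\in L^1(I;BV(O))\cap L^\infty(O\times I)$$ for all open sets $O$, $I$ whose closures are compact subsets of $\Omega$ and $(0,T)$ respectively. Here $u\in L^1(I;BV(O))$ means that $u\in L^1(O\times I)$, that $u(\cdot,t)\in BV(O)$ for a.e. $t\in I$, and that $\int_I|\nabla u(\cdot,t)|(O)\,dt<\infty$. Let $\mathcal K$ be the set of all even, nonnegative $\rho\in C^\infty_c(B_1)$ with $\int\rho\,dz=1$, where $B_1\subset\mathbb R^d$ is the open unit ball. For $\rho\in\mathcal K$ and $\varepsilon>0$ put $$D^\rho_\varepsilon[u](x,t)=\frac1{4\varepsilon}\int\nabla\rho(z)\cdot\delta_{\varepsilon z}u(x,t)\,|\delta_{\varepsilon z}u(x,t)|^2\,dz,\qquad \delta_\xi u(x,t)=u(x+\xi,t)-u(x,t),$$ which is defined for $\varepsilon<\operatorname{dist}(x,\partial\Omega)$. (a) Let $D[u]$ be a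 signed Radon measure on $\Omega\times(0,T)$ which is a weak limit of the approximations independently of the kernel, that is: for every $\rho\in\mathcal K$ there is a sequence $\varepsilon_n\to0^+$ such that $$\int D^\rho_{\varepsilon_n}[u]\,\varphi\,dx\,dt\to\langle D[u],\varphi\rangle\qquad\text{for all }\varphi\in C_c(\Omega\times(0,T)).$$ Then the variation of $D[u]$ satisfies $|D[u]|(K)=0$ for every compact $K\subset\Omega\times(0,T)$. (b) Consequently, if in addition $p\in L^1_{\rm loc}(\Omega\times(0,T))$ is such that $(u,p)$ solves the incompressible Euler equations $\partial_tu+\operatorname{div}(u\otimes u)+\nabla p=0$, $\operatorname{div}u=0$ in the sense of distributions on $\Omega\times(0,T)$, then energy is conserved locally: $$\partial_t\Big(\frac{|u|^2}2\Big)+\operatorname{div}\Big(\Big(\frac{|u|^2}2+p\Big)u\Big)=0\qquad\text{in }\mathcal D'(\Omega\times(0,T)).$$ -/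

import Mathlib

open MeasureTheory Set Filter Topology
open scoped ContDiff

noncomputable section

namespace DuchonRobert

/-- The Euclidean space of dimension `d`. -/
abbrev Space (d : ℕ) : Type := EuclideanSpace ℝ (Fin d)

/-- `A` is compactly contained in `B`: the closure of `A` is compact and is a subset of `B`. -/
def CompactlyIn {X : Type*} [TopologicalSpace X] (A B : Set X) : Prop :=
  IsCompact (closure A) ∧ closure A ⊆ B

/-- Real test functions of class `C_c^∞(U)`. -/
structure IsTestFunction {E : Type*} [NormedAddCommGroup E] [NormedSpace ℝ E]
    (U : Set E) (φ : E → ℝ) : Prop where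
  smooth : ContDiff ℝ ∞ φ
  compact : HasCompactSupport φ
  subset : tsupport φ ⊆ U

/-- Real test functions of class `C_c(U)`. -/
structure IsContTestFunction {X : Type*} [TopologicalSpace X] (U : Set X) (φ : X → ℝ) : Prop where
  cont : Continuous φ
  compact : HasCompactSupport φ
  subset : tsupport φ ⊆ U

/-- A signed Radon measure on `U`: a signed Borel measure which is finite on the compact subsets of
`U` (but whose total variation may be infinite on `U`), given by its Jordan decomposition into two
mutually singular positive measures. -/
structure SignedRadonMeasure {X : Type*} [TopologicalSpace X] [MeasurableSpace X]
    (U : Set X) where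
  posPart : Measure X
  negPart : Measure X
  mutuallySingular : posPart ⟂ₘ negPart
  posPart_compl : posPart Uᶜ = 0
  negPart_compl : negPart Uᶜ = 0
  posPart_compact : ∀ K : Set X, IsCompact K → K ⊆ U → posPart K < ⊤
  negPart_compact : ∀ K : Set X, IsCompact K → K ⊆ U → negPart K < ⊤

namespace SignedRadonMeasure

variable {X : Type*} [TopologicalSpace X] [MeasurableSpace X] {U : Set X}

/-- The duality pairing of a signed Radon measure with a function. -/
def pairing (D : SignedRadonMeasure U) (φ : X → ℝ) : ℝ :=
  ∫ x, φ x ∂D.posPart - ∫ x, φ x ∂D.negPart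

/-- The variation `|D|` of a signed Radon measure. -/
def variation (D : SignedRadonMeasure U) : Measure X := D.posPart + D.negPart

end SignedRadonMeasure

variable {d : ℕ}

/-- The spatial gradient of a scalar function of `(x, t)`. -/
def gradX (φ : Space d × ℝ → ℝ) (p : Space d × ℝ) : Space d :=
  gradient (fun y => φ (y, p.2)) p.1

/-- The time derivative of a scalar function of `(x, t)`. -/
def derivT (φ : Space d × ℝ → ℝ) (p : Space d × ℝ) : ℝ :=
  deriv (fun s => φ (p.1, s)) p.2

/-- `f ∈ BV(O)` with distributional gradient the finite matrix-valued measure `Df`, that is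
`f ∈ L¹(O)` and `∫_O fᵢ ∂ⱼφ dx = - ∫_O φ d(Df)ᵢⱼ` for all `φ ∈ C_c^∞(O)`. Matrices carry their
Euclidean (Frobenius) norm. -/
def HasBVGradient (O : Set (Space d)) (f : Space d → Space d)
    (Df : VectorMeasure (Space d) (EuclideanSpace ℝ (Fin d × Fin d))) : Prop :=
  IntegrableOn f O ∧ Df.variation O < ⊤ ∧
    ∀ φ : Space d → ℝ, IsTestFunction O φ → ∀ i j : Fin d,
      ∫ x in O, f x i * gradient φ x j = -((∫ᵛ x, φ x ∂•Df) (i, j))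

/-- `u ∈ L¹(I; BV(O))`: `u` is integrable on `O × I`, almost every time slice lies in `BV(O)`, and
the total variation over `O` of the spatial gradient is integrable in time. (The gradient measure
is determined on `O` by the slice, and its total variation over `O` is then almost everywhere equal
to a measurable function of time.) -/
def MemLOneBV (O : Set (Space d)) (I : Set ℝ) (u : Space d × ℝ → Space d) : Prop :=
  IntegrableOn u (O ×ˢ I) ∧
    ∃ Du : ℝ → VectorMeasure (Space d) (EuclideanSpace ℝ (Fin d × Fin d)),
      (∀ᵐ t ∂(volume.restrict I), HasBVGradient O (fun x => u (x, t)) (Du t)) ∧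
        ∫⁻ t in I, (Du t).variation O < ⊤

/-- `div u = 0` in the sense of distributions on the open space-time set `U`. -/
def IsDivergenceFree (U : Set (Space d × ℝ)) (u : Space d × ℝ → Space d) : Prop :=
  ∀ φ : Space d × ℝ → ℝ, IsTestFunction U φ → ∫ p in U, inner ℝ (u p) (gradX φ p) = 0

/-- The class `𝒦` of admissible kernels: nonnegative even functions in `C_c^∞(B₁)` with integral
one, `B₁` being the open unit ball. -/
structure IsKernel (ρ : Space d → ℝ) : Prop where
  test : IsTestFunction (Metric.ball 0 1) ρ
  integral_eq_one : ∫ z, ρ z = 1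
  nonneg : ∀ z, 0 ≤ ρ z
  even : ∀ z, ρ (-z) = ρ z

/-- The spatial increment `δ_ξ u (x,t) = u (x + ξ, t) - u (x, t)`. -/
def increment (u : Space d × ℝ → Space d) (ξ : Space d) (p : Space d × ℝ) : Space d :=
  u (p.1 + ξ, p.2) - u p

/-- The Duchon–Robert approximation
`D_ε[u] = (4ε)⁻¹ ∫ ∇ρ(z) · δ_{εz} u |δ_{εz} u|² dz` with kernel `ρ`. When `u` is given on
`Ω × (0,T)`, its value at `(x,t)` is meaningful as soon as `ε` is less than the distance of `x` from
the boundary of `Ω`, since `∇ρ` vanishes outside the unit ball. -/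
def approx (ρ : Space d → ℝ) (u : Space d × ℝ → Space d) (ε : ℝ) (p : Space d × ℝ) : ℝ :=
  1 / (4 * ε) *
    ∫ z, inner ℝ (gradient ρ z) (increment u (ε • z) p) * ‖increment u (ε • z) p‖ ^ 2

/-- `D` is a weak limit in the sense of measures on `U` of `D_ε[u]`, with kernel `ρ`, along some
sequence `ε → 0⁺`. -/
def IsWeakLimit (U : Set (Space d × ℝ)) (ρ : Space d → ℝ) (u : Space d × ℝ → Space d)
    (D : SignedRadonMeasure U) : Prop :=
  ∃ ε : ℕ → ℝ, (∀ n, 0 < ε n) ∧ Tendsto ε atTop (𝓝 0) ∧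
    ∀ φ : Space d × ℝ → ℝ, IsContTestFunction U φ →
      Tendsto (fun n => ∫ p in U, approx ρ u (ε n) p * φ p) atTop (𝓝 (D.pairing φ))

/-- The momentum equation `∂ₜ u + div (u ⊗ u) + ∇ p = 0` in the sense of distributions on `U`,
componentwise. Together with `div u = 0` this is the incompressible Euler system. -/
def IsWeakEulerMomentum (U : Set (Space d × ℝ)) (u : Space d × ℝ → Space d)
    (p : Space d × ℝ → ℝ) : Prop :=
  ∀ φ : Space d × ℝ → ℝ, IsTestFunction U φ → ∀ i : Fin d,
    ∫ q in U, (u q i * derivT φ q + u q i * inner ℝ (u q) (gradX φ q) + p q * gradX φ q i) = 0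

/-- Local conservation of energy: `∂ₜ (|u|²/2) + div ((|u|²/2 + p) u) = 0` in the sense of
distributions on `U`. -/
def ConservesEnergyLocally (U : Set (Space d × ℝ)) (u : Space d × ℝ → Space d)
    (p : Space d × ℝ → ℝ) : Prop :=
  ∀ φ : Space d × ℝ → ℝ, IsTestFunction U φ →
    ∫ q in U, (‖u q‖ ^ 2 / 2 * derivT φ q +
      (‖u q‖ ^ 2 / 2 + p q) * inner ℝ (u q) (gradX φ q)) = 0

end DuchonRobert

end

noncomputable section

namespace DuchonRobert

-- A heuristic first. Writing one of the three increments in `approx` as an integral of the spatial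
-- gradient and bounding the other two by the sup norm C gives `|∫ D_ε φ| ≲ C² ∫ |φ| Λ_ρ(∇u)`, where
-- `Λ_ρ(A) = ∫ |∇ρ(z) · A z| dz` is `gauge ρ A`. The gradient is only a measure, so this does not
-- tend to zero for a fixed kernel, but the limit does not depend on the kernel and the kernel may
-- be adapted to the direction of the gradient. Incompressibility makes that direction trace-free,
-- and for a trace-free matrix M the infimum of `gauge ρ M` over kernels is zero: the flow of `z ↦ M
-- z` preserves volume, so averaging a bump along it over a long time gives a density almost
-- constant along the flow (`exists_almost_invariant_density`).
--
-- The direction varies from point to point, and no polar decomposition of the gradient measure is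
-- used. It is replaced by a smooth field ψ with `‖ψ‖ ≤ 1` that nearly attains the total variation
-- in the duality with `divPairing`. The mollified gradients N then have small defect `∫ (‖N‖ - ⟨ψ,
-- N⟩)`, hence are close to `‖N‖ ψ` in L¹ (`norm_sub_norm_smul_le`). Projecting ψ onto trace-free
-- matrices costs nothing because the velocity is divergence free (`divPairing_devMat`). By
-- compactness finitely many kernels `ρ i` serve all trace-free directions in the unit ball, with
-- smooth weights `χ i` (`exists_kernel_partition`). Splitting φ into the pieces `φ · χ i (ψ)` and
-- testing each piece with its own kernel gives `functional_eq_zero`: any finitely additive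
-- functional on test functions which is a limit of the approximations for every kernel vanishes.
--
-- For (a) the functional is the pairing with D, and mutual singularity of the Jordan parts turns
-- vanishing on test functions into vanishing of the variation. For (b) no defect measure has to be
-- constructed: doubling of variables shows that for a bounded Euler flow the approximations
-- converge, for every kernel and every sequence of scales, to the energy balance tested against φ
-- (`LocalEulerFlow.tendsto_integral_approx`), so `functional_eq_zero` applies to the energy balance
-- itself.

variable {d : ℕ}

-- Matrices as a Euclidean space, and rank-one matrices.

/-- Real `d × d` matrices with the Frobenius norm. -/
abbrev Mat (d : ℕ) : Type := EuclideanSpace ℝ (Fin d × Fin d)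

/-- The rank-one matrix `v ⊗ z`. -/
def tens (v z : Space d) : Mat d := WithLp.toLp 2 fun ij => v ij.1 * z ij.2

/-- The trace of a matrix. -/
def matTrace (M : Mat d) : ℝ := ∑ i, M (i, i)

/-- The linear map attached to a matrix. -/
def matCLM (M : Mat d) : Space d →L[ℝ] Space d :=
  LinearMap.toContinuousLinearMap (Matrix.toEuclideanLin (Matrix.of fun i j => M (i, j)))

lemma matCLM_apply (M : Mat d) (z : Space d) (i : Fin d) :
    matCLM M z i = ∑ j, M (i, j) * z j := by
  simp [matCLM, Matrix.toLpLin_apply, Matrix.mulVec, dotProduct]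

lemma inner_mat (A B : Mat d) : inner ℝ A B = ∑ i, ∑ j, A (i, j) * B (i, j) := by
  rw [PiLp.inner_apply, Fintype.sum_prod_type]
  simp [mul_comm]

lemma inner_space (v w : Space d) : inner ℝ v w = ∑ i, v i * w i := by
  rw [PiLp.inner_apply]; simp [mul_comm]

lemma inner_tens (v z : Space d) (M : Mat d) : inner ℝ (tens v z) M = inner ℝ v (matCLM M z) := by
  rw [inner_mat, inner_space]
  refine Finset.sum_congr rfl fun i _ => ?_
  rw [matCLM_apply, Finset.mul_sum]
  exact Finset.sum_congr rfl fun j _ => by simp [tens]; ring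

lemma norm_tens (v z : Space d) : ‖tens v z‖ = ‖v‖ * ‖z‖ := by
  rw [EuclideanSpace.norm_eq, EuclideanSpace.norm_eq, EuclideanSpace.norm_eq, ← Real.sqrt_mul
    (by positivity), Fintype.sum_prod_type, Finset.sum_mul_sum]
  simp [tens, mul_pow]

@[fun_prop]
lemma continuous_tens {X : Type*} [TopologicalSpace X] {f g : X → Space d} (hf : Continuous f)
    (hg : Continuous g) : Continuous fun x => tens (f x) (g x) := by
  unfold DuchonRobert.tens
  fun_prop

-- The flow of a trace-free linear field has determinant one.

section DetExp

variable {E : Type*} [NormedAddCommGroup E] [NormedSpace ℝ E]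

/-- The determinant of an endomorphism. -/
def detCLM (A : E →L[ℝ] E) : ℝ := LinearMap.det A.toLinearMap

lemma detCLM_mul (A B : E →L[ℝ] E) : detCLM (A * B) = detCLM A * detCLM B := by
  unfold detCLM
  rw [← LinearMap.det_comp]
  rfl

lemma differentiable_detCLM [FiniteDimensional ℝ E] : Differentiable ℝ (detCLM (E := E)) := by
  have : (detCLM (E := E)) = fun A => ∑ σ : Equiv.Perm (Fin (Module.finrank ℝ E)),
      Equiv.Perm.sign σ • ∏ i, LinearMap.toContinuousLinearMap
        ((Module.finBasis ℝ E).coord (σ i)) (A (Module.finBasis ℝ E i)) := by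
    funext A
    rw [detCLM, ← LinearMap.det_toMatrix (Module.finBasis ℝ E),
      Matrix.det_apply]
    simp [LinearMap.toMatrix_apply]
  rw [this]
  simp only [Units.smul_def, zsmul_eq_mul]
  fun_prop

/-- The curves `exp (t A)` and `1 + t A` agree to first order at `t = 0`, so the chain rule gives
the same derivative for both determinants. For `1 + t A` the determinant is a polynomial in t whose
linear coefficient is the trace. -/
lemma hasDerivAt_detCLM_exp [FiniteDimensional ℝ E] (A : E →L[ℝ] E) :
    HasDerivAt (fun t : ℝ => detCLM (NormedSpace.exp (t • A)))
      (LinearMap.trace ℝ _ A.toLinearMap) 0 := by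
  have := FiniteDimensional.complete ℝ E
  have h1 : HasFDerivAt detCLM (fderiv ℝ detCLM 1) (1 : E →L[ℝ] E) :=
    (differentiable_detCLM 1).hasFDerivAt
  have h2 : HasDerivAt (fun t : ℝ => (1 : E →L[ℝ] E) + t • A) A 0 := by
    have := ((hasDerivAt_id (0 : ℝ)).smul_const A).const_add 1
    rwa [one_smul] at this
  have h3 : HasDerivAt (fun t : ℝ => NormedSpace.exp (t • A)) A 0 := by
    have := hasDerivAt_exp_smul_const (𝕂 := ℝ) A 0
    rwa [zero_smul, NormedSpace.exp_zero, one_mul] at this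
  have h2' := HasFDerivAt.comp_hasDerivAt (x := (0 : ℝ)) (l := detCLM) (l' := fderiv ℝ detCLM 1)
    (by rwa [zero_smul, add_zero]) h2
  have h3' := HasFDerivAt.comp_hasDerivAt (x := (0 : ℝ)) (l := detCLM) (l' := fderiv ℝ detCLM 1)
    (by rwa [zero_smul, NormedSpace.exp_zero]) h3
  suffices h : HasDerivAt (detCLM ∘ fun t : ℝ => (1 : E →L[ℝ] E) + t • A)
      (LinearMap.trace ℝ _ A.toLinearMap) 0 by
    rw [← h.unique h2'] at h3'
    exact h3'
  let b := (Module.finBasis ℝ E)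
  -- The two applications of `divX` collect everything beyond first order, which is then multiplied
  -- by `t ^ 2` and does not affect the derivative at 0.
  have key : (detCLM ∘ fun t : ℝ => (1 : E →L[ℝ] E) + t • A) = fun t : ℝ =>
      1 + (LinearMap.toMatrix b b A.toLinearMap).trace * t +
        (Matrix.det (1 + (Polynomial.X : Polynomial ℝ) •
          (LinearMap.toMatrix b b A.toLinearMap).map Polynomial.C)).divX.divX.eval t * t ^ 2 := by
    funext t
    rw [← Matrix.det_one_add_smul]
    simp only [detCLM, Function.comp]
    rw [← LinearMap.det_toMatrix b]
    congr 1
    rw [ContinuousLinearMap.toLinearMap_add, ContinuousLinearMap.toLinearMap_smul, map_add,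
      map_smul]
    congr 1
    exact LinearMap.toMatrix_one b
  rw [key, LinearMap.trace_eq_matrix_trace ℝ b]
  set P := (Matrix.det (1 + (Polynomial.X : Polynomial ℝ) •
          (LinearMap.toMatrix b b A.toLinearMap).map Polynomial.C)).divX.divX
  have := (((hasDerivAt_id (0 : ℝ)).const_mul
    (LinearMap.toMatrix b b A.toLinearMap).trace).const_add 1).add
    ((P.hasDerivAt 0).mul (hasDerivAt_pow 2 (0 : ℝ)))
  exact this.congr_deriv (by simp)

/-- The determinant is multiplicative along the one-parameter group, so its derivative at any s is
its value at s times the derivative at 0, that is, the trace. It is therefore constant. -/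
lemma detCLM_exp_of_trace_eq_zero [FiniteDimensional ℝ E] (A : E →L[ℝ] E)
    (hA : LinearMap.trace ℝ _ A.toLinearMap = 0) (t : ℝ) :
    detCLM (NormedSpace.exp (t • A)) = 1 := by
  have := FiniteDimensional.complete ℝ E
  let : NormedAlgebra ℚ (E →L[ℝ] E) := NormedAlgebra.restrictScalars ℚ ℝ _
  have hadd : ∀ s t : ℝ, detCLM (NormedSpace.exp ((s + t) • A)) =
      detCLM (NormedSpace.exp (s • A)) * detCLM (NormedSpace.exp (t • A)) := by
    intro s t
    rw [add_smul, NormedSpace.exp_add_of_commute (((Commute.refl A).smul_left s).smul_right t),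
      detCLM_mul]
  have h0 := hasDerivAt_detCLM_exp A
  rw [hA] at h0
  have hd : ∀ s : ℝ, HasDerivAt (fun t : ℝ => detCLM (NormedSpace.exp (t • A))) 0 s := by
    intro s
    have h1 : HasDerivAt (fun t : ℝ => detCLM (NormedSpace.exp ((t - s) • A))) 0 s := by
      have h0' : HasDerivAt (fun t : ℝ => detCLM (NormedSpace.exp (t • A))) 0 (s - s) := by
        rwa [sub_self]
      exact h0'.comp_sub_const s s
    have h2 := h1.const_mul (detCLM (NormedSpace.exp (s • A)))
    rw [mul_zero] at h2
    simp_rw [← hadd, add_sub_cancel] at h2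
    exact h2
  have := is_const_of_deriv_eq_zero (fun s => (hd s).differentiableAt) (fun s => (hd s).deriv) t 0
  simp only [zero_smul, NormedSpace.exp_zero] at this
  rw [this]
  exact LinearMap.det_id

lemma trace_matCLM (M : Mat d) : LinearMap.trace ℝ _ (matCLM M).toLinearMap = matTrace M := by
  rw [LinearMap.trace_eq_matrix_trace ℝ (EuclideanSpace.basisFun (Fin d) ℝ).toBasis]
  simp [Matrix.trace, LinearMap.toMatrix_apply, matCLM_apply, matTrace]

end DetExp

-- Averaging a bump along a linear flow.

section AveragedBump

variable {E : Type*} [NormedAddCommGroup E] [NormedSpace ℝ E] [FiniteDimensional ℝ E]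

lemma contDiff_exp_smul (A : E →L[ℝ] E) : ContDiff ℝ ∞ fun s : ℝ => NormedSpace.exp (s • A) := by
  have := FiniteDimensional.complete ℝ E
  have h : ContDiff ℝ ∞ (NormedSpace.exp : (E →L[ℝ] E) → (E →L[ℝ] E)) :=
    contDiff_iff_contDiffAt.2 fun x => (NormedSpace.exp_analytic (𝕂 := ℝ) x).contDiffAt
  exact h.comp (contDiff_id.smul contDiff_const)

lemma exp_smul_apply_exp_smul_apply (A : E →L[ℝ] E) (s t : ℝ) (z : E) :
    NormedSpace.exp (s • A) (NormedSpace.exp (t • A) z) = NormedSpace.exp ((s + t) • A) z := by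
  have := FiniteDimensional.complete ℝ E
  let : NormedAlgebra ℚ (E →L[ℝ] E) := NormedAlgebra.restrictScalars ℚ ℝ _
  rw [add_smul, NormedSpace.exp_add_of_commute (((Commute.refl A).smul_left s).smul_right t)]
  rfl

/-- Differentiation under the integral is obtained by reading the average as a convolution in s with
parameter z, evaluated at 0, between the indicator of `(0, T]` and a smooth function. -/
lemma contDiff_integral_comp_exp_smul (A : E →L[ℝ] E) {g : E → ℝ} (hg : ContDiff ℝ ∞ g) (T : ℝ)
    (hT : 0 < T) :
    ContDiff ℝ ∞ fun z => ∫ s in (0 : ℝ)..T, g (NormedSpace.exp ((-s) • A) z) := by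
  -- The cutoff equals one on `[-T, T]`: it supplies the compact support that convolution needs and
  -- does not change the integrand on the interval of integration.
  let c : ContDiffBump (0 : ℝ) := ⟨T, T + 1, hT, by linarith⟩
  let G : E → ℝ → ℝ := fun z x => c x * g (NormedSpace.exp (x • A) z)
  have hG : ContDiff ℝ ∞ ↿G := by
    have h1 : ContDiff ℝ ∞ fun q : E × ℝ => NormedSpace.exp (q.2 • A) q.1 :=
      ((contDiff_exp_smul A).comp contDiff_snd).clm_apply contDiff_fst
    exact (c.contDiff.comp contDiff_snd).mul (hg.comp h1)
  have key := contDiffOn_convolution_right_with_param_comp (n := (⊤ : ℕ∞)) (μ := volume)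
    (ContinuousLinearMap.lsmul ℝ ℝ) (s := (univ : Set E)) (v := fun _ : E => (0 : ℝ))
    contDiffOn_const (f := (Ioc (0 : ℝ) T).indicator 1) (g := G) isOpen_univ c.hasCompactSupport
    (fun p x _ hx => by simp [G, image_eq_zero_of_notMem_tsupport hx])
    ((integrable_indicator_iff measurableSet_Ioc).2
      (integrableOn_const (by simp))).locallyIntegrable hG.contDiffOn
  rw [contDiffOn_univ] at key
  convert key using 2 with z
  rw [convolution_def, intervalIntegral.integral_of_le hT.le, ← integral_indicator measurableSet_Ioc]
  refine integral_congr_ae (ae_of_all _ fun s => ?_)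
  by_cases hs : s ∈ Ioc 0 T
  · have : c (-s) = 1 := c.one_of_mem_closedBall (by
      rw [Metric.mem_closedBall, dist_zero_right, norm_neg, Real.norm_of_nonneg hs.1.le]
      exact hs.2)
    simp [G, indicator_of_mem hs, this]
  · simp [indicator_of_notMem hs]

/-- By the group law the translated average is the integral of one fixed function over `[h - T, h]`,
so its derivative in h only sees the two endpoints. This does not grow with T, whereas the average
will be divided by T. -/
lemma hasDerivAt_integral_comp_exp_smul (A : E →L[ℝ] E) {g : E → ℝ} (hg : Continuous g) (T : ℝ)
    (z : E) :
    HasDerivAt (fun h : ℝ => ∫ s in (0 : ℝ)..T, g (NormedSpace.exp ((-s) • A)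
      (NormedSpace.exp (h • A) z))) (g z - g (NormedSpace.exp ((-T) • A) z)) 0 := by
  have := FiniteDimensional.complete ℝ E
  let G : ℝ → ℝ := fun x => g (NormedSpace.exp (x • A) z)
  have hG : Continuous G := hg.comp ((contDiff_exp_smul A).continuous.clm_apply continuous_const)
  have h1 : (fun h : ℝ => ∫ s in (0 : ℝ)..T, g (NormedSpace.exp ((-s) • A)
      (NormedSpace.exp (h • A) z))) =
        fun h => (∫ x in (0 : ℝ)..h, G x) - ∫ x in (0 : ℝ)..(h - T), G x := by
    funext h
    simp_rw [exp_smul_apply_exp_smul_apply]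
    rw [intervalIntegral.integral_interval_sub_left (hG.intervalIntegrable _ _)
      (hG.intervalIntegrable _ _)]
    have := intervalIntegral.integral_comp_sub_left (a := 0) (b := T) G h
    rw [sub_zero] at this
    rw [← this]
    exact intervalIntegral.integral_congr fun s _ => by simp only [G, sub_eq_neg_add]
  rw [h1]
  have d1 : HasDerivAt (fun h => ∫ x in (0 : ℝ)..h, G x) (G 0) 0 :=
    hG.integral_hasStrictDerivAt 0 0 |>.hasDerivAt
  have d2 : HasDerivAt (fun h => ∫ x in (0 : ℝ)..(h - T), G x) (G (0 - T)) 0 :=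
    (hG.integral_hasStrictDerivAt 0 (0 - T) |>.hasDerivAt).comp_sub_const 0 T
  refine (d1.sub d2).congr_deriv ?_
  have h0 : NormedSpace.exp ((0 : ℝ) • A) z = z := by rw [zero_smul, NormedSpace.exp_zero]; rfl
  simp only [G, zero_sub, h0]

variable [MeasurableSpace E] [BorelSpace E] (μ : Measure E) [μ.IsAddHaarMeasure]

lemma measurePreserving_exp_smul {A : E →L[ℝ] E} (hA : LinearMap.trace ℝ _ A.toLinearMap = 0)
    (s : ℝ) : MeasurePreserving (fun z => NormedSpace.exp (s • A) z) μ μ := by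
  refine ⟨(NormedSpace.exp (s • A)).continuous.measurable, ?_⟩
  have h := detCLM_exp_of_trace_eq_zero A hA s
  have := Measure.map_linearMap_addHaar_eq_smul_addHaar μ
    (f := (NormedSpace.exp (s • A)).toLinearMap) (by rw [← detCLM, h]; exact one_ne_zero)
  rw [← detCLM, h] at this
  simpa using this

/-- For a trace-free linear field `z ↦ A z` there is a smooth even probability density, supported
near the origin, which is almost invariant under the flow of the field. -/
lemma exists_almost_invariant_density {A : E →L[ℝ] E}
    (hA : LinearMap.trace ℝ _ A.toLinearMap = 0) {κ : ℝ} (hκ : 0 < κ) :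
    ∃ ρ : E → ℝ, ContDiff ℝ ∞ ρ ∧ HasCompactSupport ρ ∧ tsupport ρ ⊆ Metric.ball 0 1 ∧
      ∫ z, ρ z ∂μ = 1 ∧ (∀ z, 0 ≤ ρ z) ∧ (∀ z, ρ (-z) = ρ z) ∧
      ∫ z, |fderiv ℝ ρ z (A z)| ∂μ < κ := by
  -- With averaging time `4 / κ` the final bound `2 / T` equals `κ / 2`.
  obtain ⟨T, hT, hTκ⟩ : ∃ T : ℝ, 0 < T ∧ T⁻¹ * 2 < κ :=
    ⟨4 / κ, by positivity, by rw [inv_div]; linarith⟩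
  obtain ⟨C, hC0, hC⟩ : ∃ C : ℝ, 0 < C ∧ ∀ s ∈ Icc 0 T, ‖NormedSpace.exp (s • A)‖ ≤ C := by
    obtain ⟨C, hC⟩ := isCompact_Icc.exists_bound_of_continuousOn (s := Icc 0 T)
      (contDiff_exp_smul A).continuous.continuousOn
    exact ⟨max C 1, by positivity, fun s hs => (hC s hs).trans (le_max_left _ _)⟩
  -- C bounds the flow up to time T, so a bump of radius `1 / (2 C)` is carried inside the closed
  -- ball of radius `1 / 2` at all those times.
  let f : ContDiffBump (0 : E) := ⟨1 / (4 * C), 1 / (2 * C), by positivity, by gcongr; norm_num⟩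
  let g : E → ℝ := f.normed μ
  have hg : ContDiff ℝ ∞ g := f.contDiff_normed
  let ρ : E → ℝ := fun z => T⁻¹ * ∫ s in (0 : ℝ)..T, g (NormedSpace.exp ((-s) • A) z)
  have hρ : ContDiff ℝ ∞ ρ := contDiff_const.mul (contDiff_integral_comp_exp_smul A hg T hT)
  have hzero : ∀ z, z ∉ Metric.closedBall (0 : E) (1 / 2) → ∀ s ∈ Icc 0 T,
      g (NormedSpace.exp ((-s) • A) z) = 0 := by
    intro z hz s hs
    by_contra hne
    apply hz
    have h1 : NormedSpace.exp ((-s) • A) z ∈ Metric.ball (0 : E) f.rOut := by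
      rw [← f.support_normed_eq (μ := μ)]; exact hne
    have h2 : NormedSpace.exp (s • A) (NormedSpace.exp ((-s) • A) z) = z := by
      rw [exp_smul_apply_exp_smul_apply, add_neg_cancel, zero_smul, NormedSpace.exp_zero]; rfl
    rw [mem_ball_zero_iff] at h1
    rw [mem_closedBall_zero_iff, ← h2]
    calc _ ≤ ‖NormedSpace.exp (s • A)‖ * ‖NormedSpace.exp ((-s) • A) z‖ :=
          ContinuousLinearMap.le_opNorm _ _
      _ ≤ C * (1 / (2 * C)) := by
          gcongr
          · exact hC s hs
      _ = 1 / 2 := by field_simp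
  have hρ0 : ∀ z, z ∉ Metric.closedBall (0 : E) (1 / 2) → ρ z = 0 := by
    intro z hz
    simp only [ρ]
    rw [intervalIntegral.integral_congr (g := fun _ => (0 : ℝ))]
    · simp
    · intro s hs
      rw [uIcc_of_le hT.le] at hs
      exact hzero z hz s hs
  have hsupp : tsupport ρ ⊆ Metric.closedBall (0 : E) (1 / 2) :=
    closure_minimal (fun z hz => by_contra fun h => hz (hρ0 z h)) Metric.isClosed_closedBall
  have hpres := fun s : ℝ => measurePreserving_exp_smul μ hA s
  have hgc : Continuous fun q : E × ℝ => g (NormedSpace.exp ((-q.2) • A) q.1) :=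
    hg.continuous.comp (((contDiff_exp_smul A).continuous.comp
      (continuous_neg.comp continuous_snd)).clm_apply continuous_fst)
  have hgI : ∀ s : ℝ, ∫ z, g (NormedSpace.exp (s • A) z) ∂μ = 1 := by
    intro s
    have := integral_map (μ := μ) (hpres s).measurable.aemeasurable
      hg.continuous.aestronglyMeasurable
    rw [(hpres s).map_eq] at this
    rw [← this, f.integral_normed]
  have hgint : Integrable g μ := f.integrable_normed
  have hgint' : ∀ s : ℝ, Integrable (fun z => g (NormedSpace.exp (s • A) z)) μ := fun s =>
    (hpres s).integrable_comp_of_integrable hgint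
  refine ⟨ρ, hρ, ?_, hsupp.trans (Metric.closedBall_subset_ball (by norm_num)), ?_, ?_, ?_, ?_⟩
  · exact HasCompactSupport.of_support_subset_isCompact (isCompact_closedBall 0 (1 / 2))
      ((subset_tsupport ρ).trans hsupp)
  · have hint : Integrable (Function.uncurry fun z s => g (NormedSpace.exp ((-s) • A) z))
        (μ.prod (volume.restrict (Ioc 0 T))) := by
      have e : μ.prod (volume.restrict (Ioc 0 T)) = (μ.prod volume).restrict (univ ×ˢ Ioc 0 T) := by
        rw [← Measure.prod_restrict, Measure.restrict_univ]
      rw [e]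
      have h1 : IntegrableOn (fun q : E × ℝ => g (NormedSpace.exp ((-q.2) • A) q.1))
          (Metric.closedBall (0 : E) (1 / 2) ×ˢ Icc 0 T) (μ.prod volume) :=
        hgc.continuousOn.integrableOn_compact ((isCompact_closedBall _ _).prod isCompact_Icc)
      refine IntegrableOn.of_forall_sdiff_eq_zero
        (h1.mono_set (Set.prod_mono_right Ioc_subset_Icc_self))
        (MeasurableSet.univ.prod measurableSet_Ioc) ?_
      rintro ⟨z, s⟩ ⟨⟨_, hs⟩, hn⟩
      exact hzero z (fun h => hn ⟨h, hs⟩) s (Ioc_subset_Icc_self hs)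
    simp only [ρ]
    rw [integral_const_mul]
    simp_rw [intervalIntegral.integral_of_le hT.le]
    rw [integral_integral_swap hint]
    simp_rw [hgI]
    simp [hT.le, hT.ne']
  · intro z
    exact mul_nonneg (by positivity)
      (intervalIntegral.integral_nonneg hT.le fun s _ => f.nonneg_normed _)
  · intro z
    simp only [ρ, map_neg, g, f.normed_neg]
  · have hder : ∀ z, fderiv ℝ ρ z (A z) = T⁻¹ * (g z - g (NormedSpace.exp ((-T) • A) z)) := by
      intro z
      have := FiniteDimensional.complete ℝ E
      have h1 := (hasDerivAt_integral_comp_exp_smul A hg.continuous T z).const_mul T⁻¹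
      have e0 : NormedSpace.exp ((0 : ℝ) • A) = 1 := by rw [zero_smul, NormedSpace.exp_zero]
      have h2 : HasDerivAt (fun h : ℝ => NormedSpace.exp (h • A) z) (A z) 0 := by
        have := (hasDerivAt_exp_smul_const (𝕂 := ℝ) A 0).clm_apply (hasDerivAt_const (0 : ℝ) z)
        rw [e0] at this
        simpa using this
      have h3 : HasDerivAt (ρ ∘ fun h : ℝ => NormedSpace.exp (h • A) z) (fderiv ℝ ρ z (A z)) 0 := by
        refine HasFDerivAt.comp_hasDerivAt (x := (0 : ℝ)) ?_ h2
        rw [e0]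
        exact (hρ.differentiable (by simp) z).hasFDerivAt
      exact h3.unique h1
    -- The flow preserves μ, so both endpoint terms have mass one whatever the size of A.
    simp_rw [hder]
    calc ∫ z, |T⁻¹ * (g z - g (NormedSpace.exp ((-T) • A) z))| ∂μ
        ≤ ∫ z, T⁻¹ * (g z + g (NormedSpace.exp ((-T) • A) z)) ∂μ := by
          refine integral_mono ((hgint.sub (hgint' _)).const_mul _).abs
            ((hgint.add (hgint' _)).const_mul _) fun z => ?_
          have h1 : 0 ≤ g z := f.nonneg_normed _
          have h2 : 0 ≤ g (NormedSpace.exp ((-T) • A) z) := f.nonneg_normed _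
          simp only [abs_mul, abs_of_pos (inv_pos.2 hT)]
          gcongr
          rw [abs_le]; constructor <;> linarith
      _ = T⁻¹ * 2 := by
          rw [integral_const_mul, integral_add hgint (hgint' _), hgI, f.integral_normed]
          norm_num
      _ < κ := hTκ

end AveragedBump

-- The gauge of a kernel, and finitely many kernels for all trace-free directions.

lemma gradient_eq (ρ : Space d → ℝ) :
    gradient ρ = fun z => (InnerProductSpace.toDual ℝ (Space d)).symm (fderiv ℝ ρ z) := rfl

lemma inner_gradient (ρ : Space d → ℝ) (z v : Space d) :
    inner ℝ (gradient ρ z) v = fderiv ℝ ρ z v := by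
  rw [gradient_eq, InnerProductSpace.toDual_symm_apply]

/-- The matrix field `∇ρ(z) ⊗ z`. -/
def gradTens (ρ : Space d → ℝ) (z : Space d) : Mat d := tens (gradient ρ z) z

/-- The anisotropic gauge `A ↦ ∫ |∇ρ(z) · A z| dz` attached to a kernel. -/
def gauge (ρ : Space d → ℝ) (A : Mat d) : ℝ := ∫ z, |inner ℝ (gradTens ρ z) A|

lemma inner_gradTens (ρ : Space d → ℝ) (z : Space d) (A : Mat d) :
    inner ℝ (gradTens ρ z) A = fderiv ℝ ρ z (matCLM A z) := by
  rw [gradTens, inner_tens, inner_gradient]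

lemma IsKernel.continuous_gradient {ρ : Space d → ℝ} (hρ : IsKernel ρ) :
    Continuous (gradient ρ) := by
  rw [gradient_eq]
  exact (LinearIsometryEquiv.continuous _).comp (hρ.test.smooth.continuous_fderiv (by simp))

lemma IsKernel.gradient_eq_zero {ρ : Space d → ℝ} (hρ : IsKernel ρ) {z : Space d}
    (hz : 1 ≤ ‖z‖) : gradient ρ z = 0 := by
  have : z ∉ tsupport ρ := fun h => by
    have := hρ.test.subset h
    rw [mem_ball_zero_iff] at this
    linarith
  have h0 : fderiv ℝ ρ z = 0 := by
    by_contra h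
    exact this (support_fderiv_subset ℝ h)
  rw [gradient_eq]
  simp [h0]

lemma IsKernel.hasCompactSupport_gradient {ρ : Space d → ℝ} (hρ : IsKernel ρ) :
    HasCompactSupport (gradient ρ) :=
  HasCompactSupport.intro (isCompact_closedBall 0 1) fun z hz => hρ.gradient_eq_zero (by
    rw [mem_closedBall_zero_iff] at hz; linarith)

lemma IsKernel.continuous_gradTens {ρ : Space d → ℝ} (hρ : IsKernel ρ) :
    Continuous (gradTens ρ) := continuous_tens hρ.continuous_gradient continuous_id

lemma IsKernel.hasCompactSupport_gradTens {ρ : Space d → ℝ} (hρ : IsKernel ρ) :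
    HasCompactSupport (gradTens ρ) :=
  HasCompactSupport.intro (isCompact_closedBall 0 1) fun z hz => by
    have : gradient ρ z = 0 := hρ.gradient_eq_zero (by
      rw [mem_closedBall_zero_iff] at hz; linarith)
    rw [← norm_eq_zero, gradTens, norm_tens, this, norm_zero, zero_mul]

lemma IsKernel.integrable_gradTens {ρ : Space d → ℝ} (hρ : IsKernel ρ) :
    Integrable (gradTens ρ) :=
  hρ.continuous_gradTens.integrable_of_hasCompactSupport hρ.hasCompactSupport_gradTens

lemma IsKernel.integrable_inner_gradTens {ρ : Space d → ℝ} (hρ : IsKernel ρ) (A : Mat d) :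
    Integrable fun z => inner ℝ (gradTens ρ z) A := hρ.integrable_gradTens.inner_const A

lemma gauge_nonneg (ρ : Space d → ℝ) (A : Mat d) : 0 ≤ gauge ρ A :=
  integral_nonneg fun _ => abs_nonneg _

lemma gauge_smul (ρ : Space d → ℝ) (a : ℝ) (A : Mat d) : gauge ρ (a • A) = |a| * gauge ρ A := by
  simp only [gauge, inner_smul_right, abs_mul, integral_const_mul]

lemma IsKernel.gauge_le_add {ρ : Space d → ℝ} (hρ : IsKernel ρ) (A B : Mat d) :
    gauge ρ A ≤ gauge ρ B + (∫ z, ‖gradTens ρ z‖) * ‖A - B‖ := by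
  rw [gauge, gauge, ← integral_mul_const, ← integral_add (hρ.integrable_inner_gradTens B).abs
    (hρ.integrable_gradTens.norm.mul_const _)]
  refine integral_mono (hρ.integrable_inner_gradTens A).abs
    ((hρ.integrable_inner_gradTens B).abs.add (hρ.integrable_gradTens.norm.mul_const _))
    fun z => ?_
  have h1 : inner ℝ (gradTens ρ z) A = inner ℝ (gradTens ρ z) B + inner ℝ (gradTens ρ z) (A - B) := by
    rw [← inner_add_right]; simp
  simp only
  rw [h1]
  exact (abs_add_le _ _).trans (by gcongr; exact abs_real_inner_le_norm _ _)

lemma IsKernel.continuous_gauge {ρ : Space d → ℝ} (hρ : IsKernel ρ) : Continuous (gauge ρ) := by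
  refine (LipschitzWith.of_le_add_mul (Real.toNNReal (∫ z, ‖gradTens ρ z‖)) fun A B => ?_).continuous
  rw [Real.coe_toNNReal _ (integral_nonneg fun _ => norm_nonneg _), dist_eq_norm]
  exact hρ.gauge_le_add A B

/-- Homogeneity and the Lipschitz bound combined: a matrix N is compared with its own length times a
preferred direction M for which the kernel was chosen. -/
lemma IsKernel.gauge_le {ρ : Space d → ℝ} (hρ : IsKernel ρ) (N M : Mat d) :
    gauge ρ N ≤ ‖N‖ * gauge ρ M + (∫ z, ‖gradTens ρ z‖) * ‖N - ‖N‖ • M‖ := by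
  simpa [gauge_smul] using hρ.gauge_le_add N (‖N‖ • M)

lemma exists_isKernel_gauge_lt {M : Mat d} (hM : matTrace M = 0) {κ : ℝ} (hκ : 0 < κ) :
    ∃ ρ : Space d → ℝ, IsKernel ρ ∧ gauge ρ M < κ := by
  obtain ⟨ρ, h1, h2, h3, h4, h5, h6, h7⟩ := exists_almost_invariant_density (volume : Measure (Space d))
    (A := matCLM M) ((trace_matCLM M).trans hM) hκ
  refine ⟨ρ, ⟨⟨h1, h2, h3⟩, h4, h5, h6⟩, ?_⟩
  simpa only [gauge, inner_gradTens] using h7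

lemma continuous_matTrace : Continuous (matTrace (d := d)) := by
  unfold matTrace; fun_prop

/-- Finitely many kernels suffice for all trace-free matrices of norm at most one, and they can be
selected by a smooth partition of unity. -/
lemma exists_kernel_partition (d : ℕ) {κ : ℝ} (hκ : 0 < κ) :
    ∃ (ι : Type) (_ : Fintype ι) (ρ : ι → Space d → ℝ) (χ : ι → Mat d → ℝ),
      (∀ i, IsKernel (ρ i)) ∧ (∀ i, ContDiff ℝ ∞ (χ i)) ∧ (∀ i M, 0 ≤ χ i M) ∧
      ∀ M, ‖M‖ ≤ 1 → matTrace M = 0 → ∑ i, χ i M = 1 ∧ ∀ i, χ i M * gauge (ρ i) M ≤ χ i M * κ := by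
  let S : Set (Mat d) := Metric.closedBall 0 1 ∩ {M | matTrace M = 0}
  have hSc : IsClosed {M : Mat d | matTrace M = 0} :=
    isClosed_eq continuous_matTrace continuous_const
  have hS : IsCompact S := (isCompact_closedBall 0 1).inter_right hSc
  let U : {ρ : Space d → ℝ // IsKernel ρ} → Set (Mat d) := fun ρ => {M | gauge ρ.1 M < κ}
  have hU : ∀ ρ, IsOpen (U ρ) := fun ρ => isOpen_lt ρ.2.continuous_gauge continuous_const
  -- Each kernel is good on an open set of matrices because its gauge is continuous; the trace-free
  -- unit ball is compact.
  obtain ⟨t, ht⟩ := hS.elim_finite_subcover U hU fun M hM => by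
    obtain ⟨ρ, h1, h2⟩ := exists_isKernel_gauge_lt hM.2 hκ
    exact mem_iUnion.2 ⟨⟨ρ, h1⟩, h2⟩
  obtain ⟨f, hf⟩ := SmoothPartitionOfUnity.exists_isSubordinate (modelWithCornersSelf ℝ (Mat d))
    hS.isClosed (fun i : t => U i.1) (fun i => hU i.1) (by
      intro M hM
      obtain ⟨ρ, hρ, hMρ⟩ := mem_iUnion₂.1 (ht hM)
      exact mem_iUnion.2 ⟨⟨ρ, hρ⟩, hMρ⟩)
  refine ⟨t, inferInstance, fun i => i.1.1, fun i => f i, fun i => i.1.2,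
    fun i => (f i).contMDiff.contDiff, fun i M => f.nonneg i M, fun M h1 h2 => ⟨?_, fun i => ?_⟩⟩
  · rw [← finsum_eq_sum_of_fintype]
    exact f.sum_eq_one (x := M) ⟨by simpa using h1, h2⟩
  -- Weighting the inequality by `χ i M` makes it hold for every i: it is vacuous where kernel i is
  -- not selected.
  · by_cases h : f i M = 0
    · simp [h]
    · have : M ∈ U i.1 := hf i (subset_tsupport _ h)
      exact mul_le_mul_of_nonneg_left (le_of_lt this) (f.nonneg i M)

-- Mollification on space-time.

/-- Space-time. -/
abbrev SpaceTime (d : ℕ) : Type := Space d × ℝ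

instance : (volume : Measure (SpaceTime d)).IsAddHaarMeasure :=
  inferInstanceAs ((volume : Measure (Space d)).prod (volume : Measure ℝ)).IsAddHaarMeasure

section Mollify

open ContinuousLinearMap (lsmul)
open scoped Convolution

/-- Bump functions on space-time, with radii tending to zero. -/
def bumpSeq (d n : ℕ) : ContDiffBump (0 : SpaceTime d) :=
  ⟨1 / (n + 1), 2 / (n + 1), by positivity, by gcongr; norm_num⟩

/-- The standard sequence of mollifiers on space-time. -/
def mollifier (d n : ℕ) : SpaceTime d → ℝ := (bumpSeq d n).normed volume

variable {F : Type*} [NormedAddCommGroup F] [NormedSpace ℝ F]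

/-- Mollification on space-time. -/
def mollify (n : ℕ) (f : SpaceTime d → F) : SpaceTime d → F :=
  mollifier d n ⋆[lsmul ℝ ℝ, volume] f

lemma contDiff_mollifier (n : ℕ) : ContDiff ℝ ∞ (mollifier d n) := (bumpSeq d n).contDiff_normed

lemma hasCompactSupport_mollifier (n : ℕ) : HasCompactSupport (mollifier d n) :=
  (bumpSeq d n).hasCompactSupport_normed

lemma mollifier_nonneg (n : ℕ) (p : SpaceTime d) : 0 ≤ mollifier d n p :=
  (bumpSeq d n).nonneg_normed p

lemma integral_mollifier (n : ℕ) : ∫ p, mollifier d n p = 1 := (bumpSeq d n).integral_normed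

lemma integrable_mollifier (n : ℕ) : Integrable (mollifier d n) := (bumpSeq d n).integrable_normed

lemma mollifier_neg (n : ℕ) (p : SpaceTime d) : mollifier d n (-p) = mollifier d n p :=
  (bumpSeq d n).normed_neg p

/-- The mollifier is even, so its derivative is odd; this is the source of the minus sign when a
mollification is moved from one factor of a pairing to the other. -/
lemma fderiv_mollifier_neg (n : ℕ) (p v : SpaceTime d) :
    fderiv ℝ (mollifier d n) (-p) v = -fderiv ℝ (mollifier d n) p v := by
  have h : (fun p => mollifier d n (-p)) = mollifier d n := funext fun p => mollifier_neg n p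
  have hd : Differentiable ℝ (mollifier d n) := (contDiff_mollifier n).differentiable (by simp)
  have h2 : HasFDerivAt (fun p => mollifier d n (-p))
      ((fderiv ℝ (mollifier d n) (-p)).comp (-ContinuousLinearMap.id ℝ (SpaceTime d))) p :=
    (hd (-p)).hasFDerivAt.comp p (hasFDerivAt_id p).neg
  rw [h] at h2
  rw [h2.fderiv]
  simp

lemma mollify_apply (n : ℕ) (f : SpaceTime d → F) (p : SpaceTime d) :
    mollify n f p = ∫ q, mollifier d n (p - q) • f q := by
  rw [mollify, convolution_eq_swap]; rfl

lemma mollify_apply' (n : ℕ) (f : SpaceTime d → F) (p : SpaceTime d) :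
    mollify n f p = ∫ q, mollifier d n q • f (p - q) := rfl

lemma norm_mollify_le (n : ℕ) {f : SpaceTime d → F} {C : ℝ} (hf : ∀ q, ‖f q‖ ≤ C)
    (p : SpaceTime d) : ‖mollify n f p‖ ≤ C := by
  rw [mollify_apply']
  calc ‖∫ q, mollifier d n q • f (p - q)‖ ≤ ∫ q, mollifier d n q * C :=
        norm_integral_le_of_norm_le ((integrable_mollifier n).mul_const C) <| ae_of_all _ fun q => by
          rw [norm_smul, Real.norm_of_nonneg (mollifier_nonneg n q)]
          exact mul_le_mul_of_nonneg_left (hf _) (mollifier_nonneg n q)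
    _ = C := by rw [integral_mul_const, integral_mollifier, one_mul]

lemma tendsto_bumpSeq_rOut (d : ℕ) : Tendsto (fun n => (bumpSeq d n).rOut) atTop (𝓝 0) := by
  have := (tendsto_one_div_add_atTop_nhds_zero_nat (𝕜 := ℝ)).const_mul 2
  simpa [bumpSeq, div_eq_mul_inv] using this

lemma tendsto_mollify_of_continuous [CompleteSpace F] {f : SpaceTime d → F} (hf : Continuous f)
    (p : SpaceTime d) : Tendsto (fun n => mollify n f p) atTop (𝓝 (f p)) :=
  ContDiffBump.convolution_tendsto_right_of_continuous (tendsto_bumpSeq_rOut d) hf p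

lemma ae_tendsto_mollify [CompleteSpace F] {f : SpaceTime d → F} (hf : LocallyIntegrable f) :
    ∀ᵐ p, Tendsto (fun n => mollify n f p) atTop (𝓝 (f p)) :=
  ContDiffBump.ae_convolution_tendsto_right_of_locallyIntegrable (K := 2) (tendsto_bumpSeq_rOut d)
    (Eventually.of_forall fun n => by simp [bumpSeq, div_eq_mul_inv]) hf

lemma contDiff_mollify [CompleteSpace F] (n : ℕ) {f : SpaceTime d → F} (hf : LocallyIntegrable f) :
    ContDiff ℝ ∞ (mollify n f) :=
  (hasCompactSupport_mollifier n).contDiff_convolution_left _ (contDiff_mollifier n) hf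

lemma fderiv_mollify [CompleteSpace F] (n : ℕ) {f : SpaceTime d → F} (hf : LocallyIntegrable f)
    (p v : SpaceTime d) :
    fderiv ℝ (mollify n f) p v = ∫ q, fderiv ℝ (mollifier d n) (p - q) v • f q := by
  have h := (hasCompactSupport_mollifier n).hasFDerivAt_convolution_right (lsmul ℝ ℝ).flip hf
    ((contDiff_mollifier (d := d) n).of_le (by simp)) p
  have e : f ⋆[(lsmul ℝ ℝ).flip, volume] mollifier d n = mollify n f := convolution_flip _
  rw [e] at h
  rw [h.fderiv, convolution_precompR_apply _ hf ((hasCompactSupport_mollifier n).fderiv ℝ)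
    ((contDiff_mollifier n).continuous_fderiv (by simp))]
  rfl

lemma fderiv_mollify_of_contDiff [CompleteSpace F] (n : ℕ) {f : SpaceTime d → F}
    (hf : ContDiff ℝ ∞ f) (hfc : HasCompactSupport f) (p v : SpaceTime d) :
    fderiv ℝ (mollify n f) p v = mollify n (fun q => fderiv ℝ f q v) p := by
  have hl : LocallyIntegrable (mollifier d n) := (integrable_mollifier n).locallyIntegrable
  have h := hfc.hasFDerivAt_convolution_right (lsmul ℝ ℝ) hl (hf.of_le (by simp)) p
  have h' : fderiv ℝ (mollify n f) p = _ := h.fderiv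
  rw [h', convolution_precompR_apply _ hl (hfc.fderiv ℝ) (hf.continuous_fderiv (by simp))]
  rfl

lemma tsupport_mollify_subset {n : ℕ} {f : SpaceTime d → F} {K : Set (SpaceTime d)}
    (hf : ∀ q, q ∉ K → f q = 0) {r : ℝ} (hr : (bumpSeq d n).rOut ≤ r) :
    tsupport (mollify n f) ⊆ Metric.cthickening r K := by
  refine closure_minimal (fun p hp => ?_) Metric.isClosed_cthickening
  by_contra hn
  apply hp
  rw [mollify_apply]
  refine integral_eq_zero_of_ae (ae_of_all _ fun q => ?_)
  by_cases hq : q ∈ K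
  · have : mollifier d n (p - q) = 0 := by
      by_contra h
      have : p - q ∈ Metric.ball (0 : SpaceTime d) (bumpSeq d n).rOut := by
        rw [← (bumpSeq d n).support_normed_eq (μ := volume)]; exact h
      rw [mem_ball_zero_iff, ← dist_eq_norm] at this
      exact hn (Metric.mem_cthickening_of_dist_le p q r K hq (this.le.trans hr))
    simp [this]
  · simp [hf q hq]

end Mollify

-- Duality between a rough field and the gradient of its mollification.

section GradientPairing

/-- The spatial unit vector `e_j` of space-time. -/
def spaceUnit (j : Fin d) : SpaceTime d := (EuclideanSpace.single j 1, 0)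

/-- Matrix-valued test functions. -/
structure IsMatTest (U : Set (SpaceTime d)) (Ψ : SpaceTime d → Mat d) : Prop where
  smooth : ContDiff ℝ ∞ Ψ
  compact : HasCompactSupport Ψ
  subset : tsupport Ψ ⊆ U

/-- The pairing `∫ ∑ uᵢ ∂ⱼΨᵢⱼ` of a vector field with the divergence of a matrix field. -/
def divPairing (u : SpaceTime d → Space d) (Ψ : SpaceTime d → Mat d) : ℝ :=
  ∫ p, ∑ j, inner ℝ (tens (u p) (EuclideanSpace.single j 1)) (fderiv ℝ Ψ p (spaceUnit j))

/-- The spatial gradient of a vector field. -/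
def gradMat (v : SpaceTime d → Space d) (p : SpaceTime d) : Mat d :=
  ∑ j, tens (fderiv ℝ v p (spaceUnit j)) (EuclideanSpace.single j 1)

lemma space_eq_sum (z : Space d) : z = ∑ j, z j • EuclideanSpace.single j (1 : ℝ) := by
  ext i; simp [Finset.sum_apply, Pi.single_apply]

/-- Both sides are `∑ ∂ᵢρ(z) zⱼ ∂ⱼvᵢ`. It identifies the integrand of the gauge with the derivative
of v in the direction z, contracted with `∇ρ(z)`. -/
lemma inner_gradTens_gradMat (ρ : Space d → ℝ) (z : Space d) (v : SpaceTime d → Space d)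
    (p : SpaceTime d) :
    inner ℝ (gradTens ρ z) (gradMat v p) = inner ℝ (gradient ρ z) (fderiv ℝ v p (z, 0)) := by
  have h : ((z, 0) : SpaceTime d) = ∑ j, z j • spaceUnit j := by
    ext1
    · rw [Prod.fst_sum]; exact space_eq_sum z
    · rw [Prod.snd_sum]; simp [spaceUnit]
  rw [h, map_sum, gradMat, inner_sum, inner_sum]
  refine Finset.sum_congr rfl fun j _ => ?_
  rw [map_smul, inner_smul_right, inner_mat, inner_space, Finset.mul_sum]
  refine Finset.sum_congr rfl fun i _ => ?_
  rw [Finset.sum_eq_single j]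
  · simp [gradTens, tens]; ring
  · intro k _ hk; simp [tens, hk]
  · simp

lemma continuous_gradMat {v : SpaceTime d → Space d} (hv : ContDiff ℝ ∞ v) :
    Continuous (gradMat v) := by
  unfold gradMat
  have := hv.continuous_fderiv (by simp)
  exact continuous_finsetSum _ fun j _ => continuous_tens (this.clm_apply continuous_const)
    continuous_const

lemma inner_tens_left_eq (v : Space d) (z : Space d) (M : Mat d) :
    inner ℝ M (tens v z) = inner ℝ v (matCLM M z) := by
  rw [real_inner_comm, inner_tens]

variable {u : SpaceTime d → Space d}

lemma integrable_fderiv_mollifier_mul (n : ℕ) (v : SpaceTime d) (hum : StronglyMeasurable u)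
    (hui : Integrable u) {Ξ : SpaceTime d → Mat d} (hΞm : StronglyMeasurable Ξ)
    (hΞi : Integrable Ξ) (w : Space d) :
    Integrable (Function.uncurry fun p q => fderiv ℝ (mollifier d n) (p - q) v *
      inner ℝ (tens (u p) w) (Ξ q)) (volume.prod volume) := by
  have hc : Continuous fun x => fderiv ℝ (mollifier d n) x v :=
    ((contDiff_mollifier n).continuous_fderiv (by simp)).clm_apply continuous_const
  obtain ⟨C, hC⟩ := hc.bounded_above_of_compact_support
    ((hasCompactSupport_mollifier n).fderiv_apply (𝕜 := ℝ) v)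
  have hC0 : 0 ≤ C := (norm_nonneg _).trans (hC 0)
  refine Integrable.mono' ((hui.norm.mul_prod hΞi.norm).const_mul (C * ‖w‖)) ?_ (ae_of_all _ ?_)
  · have h1 : StronglyMeasurable fun x : SpaceTime d × SpaceTime d => tens (u x.1) w :=
      (continuous_tens continuous_id continuous_const).comp_stronglyMeasurable
        (hum.comp_measurable measurable_fst)
    have h2 : StronglyMeasurable fun x : SpaceTime d × SpaceTime d => Ξ x.2 :=
      hΞm.comp_measurable measurable_snd
    exact ((hc.comp (continuous_fst.sub continuous_snd)).stronglyMeasurable.mul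
      (h1.inner h2)).aestronglyMeasurable
  · rintro ⟨p, q⟩
    simp only [Function.uncurry, norm_mul]
    calc _ ≤ C * (‖u p‖ * ‖w‖ * ‖Ξ q‖) := by
          gcongr
          · exact hC _
          · rw [← norm_tens]; exact norm_inner_le_norm _ _
      _ = _ := by ring

/-- The derivative is put on the mollifier, Fubini exchanges the two points, and oddness of the
mollifier's derivative hands it over to u. Hence Ξ need only be measurable and integrable, which
allows the discontinuous polar field of the gradient. -/
lemma divPairing_mollify (n : ℕ) (hum : StronglyMeasurable u) (hui : Integrable u)
    {Ξ : SpaceTime d → Mat d} (hΞm : StronglyMeasurable Ξ) (hΞi : Integrable Ξ) :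
    divPairing u (mollify n Ξ) = -∫ q, inner ℝ (Ξ q) (gradMat (mollify n u) q) := by
  set e : Fin d → Space d := fun j => EuclideanSpace.single j 1
  have hi := fun j : Fin d => integrable_fderiv_mollifier_mul n (spaceUnit j) hum hui hΞm hΞi (e j)
  have hD : ∀ j : Fin d, Continuous fun x => fderiv ℝ (mollifier d n) x (spaceUnit j) := fun j =>
    ((contDiff_mollifier n).continuous_fderiv (by simp)).clm_apply continuous_const
  have hDb : ∀ j : Fin d, ∃ C, ∀ x, ‖fderiv ℝ (mollifier d n) x (spaceUnit j)‖ ≤ C := fun j =>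
    (hD j).bounded_above_of_compact_support
      ((hasCompactSupport_mollifier n).fderiv_apply (𝕜 := ℝ) (spaceUnit j))
  have hsm : ∀ {F : Type} [NormedAddCommGroup F] [NormedSpace ℝ F] (f : SpaceTime d → F) (j : Fin d)
      (p : SpaceTime d), Integrable f →
      Integrable fun q => fderiv ℝ (mollifier d n) (p - q) (spaceUnit j) • f q := by
    intro F _ _ f j p hf
    obtain ⟨C, hC⟩ := hDb j
    exact hf.bdd_smul C ((hD j).comp (continuous_const.sub continuous_id)).aestronglyMeasurable
      (ae_of_all _ fun q => hC _)
  have h1 : ∀ j p, inner ℝ (tens (u p) (e j)) (fderiv ℝ (mollify n Ξ) p (spaceUnit j)) =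
      ∫ q, fderiv ℝ (mollifier d n) (p - q) (spaceUnit j) * inner ℝ (tens (u p) (e j)) (Ξ q) := by
    intro j p
    rw [fderiv_mollify n hΞi.locallyIntegrable, ← integral_inner (hsm Ξ j p hΞi)]
    simp_rw [inner_smul_right]
  have h2 : ∀ j q, inner ℝ (Ξ q) (tens (fderiv ℝ (mollify n u) q (spaceUnit j)) (e j)) =
      ∫ p, -(fderiv ℝ (mollifier d n) (p - q) (spaceUnit j) * inner ℝ (tens (u p) (e j)) (Ξ q)) := by
    intro j q
    rw [fderiv_mollify n hui.locallyIntegrable, inner_tens_left_eq, real_inner_comm,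
      ← integral_inner (hsm u j q hui)]
    refine integral_congr_ae (ae_of_all _ fun p => ?_)
    simp only [inner_smul_right, inner_tens, ← neg_mul, ← fderiv_mollifier_neg, neg_sub]
    rw [real_inner_comm]
  unfold divPairing gradMat
  simp_rw [inner_sum]
  rw [integral_finsetSum, integral_finsetSum, ← Finset.sum_neg_distrib]
  · refine Finset.sum_congr rfl fun j _ => ?_
    simp_rw [show EuclideanSpace.single j (1 : ℝ) = e j from rfl, h1, h2, integral_neg, neg_neg]
    exact integral_integral_swap (hi j)
  · intro j _
    simp_rw [show EuclideanSpace.single j (1 : ℝ) = e j from rfl, h2, integral_neg]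
    exact (hi j).integral_prod_right.neg
  · intro j _
    simp_rw [show EuclideanSpace.single j (1 : ℝ) = e j from rfl, h1]
    exact (hi j).integral_prod_left

end GradientPairing

-- Partial derivatives, total variation and the defect of a test field.

lemma inner_gradX {φ : SpaceTime d → ℝ} {p : SpaceTime d} (hφ : DifferentiableAt ℝ φ p)
    (v : Space d) : inner ℝ (gradX φ p) v = fderiv ℝ φ p (v, 0) := by
  have h : HasFDerivAt (fun y => φ (y, p.2))
      ((fderiv ℝ φ p).comp (ContinuousLinearMap.inl ℝ (Space d) ℝ)) p.1 :=
    HasFDerivAt.comp p.1 (g := φ) hφ.hasFDerivAt (hasFDerivAt_prodMk_left p.1 p.2)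
  rw [gradX, inner_gradient, h.fderiv]
  rfl

lemma derivT_eq {φ : SpaceTime d → ℝ} {p : SpaceTime d} (hφ : DifferentiableAt ℝ φ p) :
    derivT φ p = fderiv ℝ φ p (0, 1) := by
  have h : HasDerivAt (fun s => φ (p.1, s)) (fderiv ℝ φ p (0, 1)) p.2 :=
    HasFDerivAt.comp_hasDerivAt p.2 (l := φ) hφ.hasFDerivAt
      ((hasDerivAt_const p.2 p.1).prodMk (hasDerivAt_id p.2))
  rw [derivT, h.deriv]

lemma gradX_apply {φ : SpaceTime d → ℝ} {p : SpaceTime d} (hφ : DifferentiableAt ℝ φ p)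
    (j : Fin d) : gradX φ p j = fderiv ℝ φ p (spaceUnit j) := by
  rw [spaceUnit, ← inner_gradX hφ]
  simp [EuclideanSpace.inner_single_right]

section DivPairing

variable {u : SpaceTime d → Space d}

lemma integrable_divPairing (hum : StronglyMeasurable u) (hui : Integrable u)
    {Ψ : SpaceTime d → Mat d} (hΨ : ContDiff ℝ ∞ Ψ) (hΨc : HasCompactSupport Ψ) :
    Integrable fun p => ∑ j, inner ℝ (tens (u p) (EuclideanSpace.single j 1))
      (fderiv ℝ Ψ p (spaceUnit j)) := by
  refine integrable_finsetSum _ fun j _ => ?_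
  have hc : Continuous fun p => fderiv ℝ Ψ p (spaceUnit j) :=
    (hΨ.continuous_fderiv (by simp)).clm_apply continuous_const
  obtain ⟨C, hC⟩ := hc.bounded_above_of_compact_support (hΨc.fderiv_apply (𝕜 := ℝ) (spaceUnit j))
  refine Integrable.mono' (hui.norm.const_mul C) ?_ (ae_of_all _ fun p => ?_)
  · exact (((continuous_tens continuous_id continuous_const).comp_stronglyMeasurable hum).inner
      hc.stronglyMeasurable).aestronglyMeasurable
  · calc _ ≤ ‖tens (u p) (EuclideanSpace.single j 1)‖ * ‖fderiv ℝ Ψ p (spaceUnit j)‖ :=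
          norm_inner_le_norm _ _
      _ ≤ ‖u p‖ * C := by
          rw [norm_tens]
          simp only [PiLp.norm_single, norm_one, mul_one]
          gcongr
          exact hC p
      _ = _ := mul_comm _ _

lemma divPairing_sub (hum : StronglyMeasurable u) (hui : Integrable u) {U : Set (SpaceTime d)}
    {Ψ Ψ' : SpaceTime d → Mat d} (hΨ : IsMatTest U Ψ) (hΨ' : IsMatTest U Ψ') :
    divPairing u (fun p => Ψ p - Ψ' p) = divPairing u Ψ - divPairing u Ψ' := by
  unfold divPairing
  rw [← integral_sub (integrable_divPairing hum hui hΨ.smooth hΨ.compact)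
    (integrable_divPairing hum hui hΨ'.smooth hΨ'.compact)]
  refine integral_congr_ae (ae_of_all _ fun p => ?_)
  simp only
  rw [← Finset.sum_sub_distrib]
  refine Finset.sum_congr rfl fun j _ => ?_
  rw [fderiv_fun_sub (hΨ.smooth.differentiable (by simp) p) (hΨ'.smooth.differentiable (by simp) p),
    sub_apply, inner_sub_right]

lemma tendsto_divPairing_mollify (hum : StronglyMeasurable u) (hui : Integrable u)
    {Ψ : SpaceTime d → Mat d} (hΨ : ContDiff ℝ ∞ Ψ) (hΨc : HasCompactSupport Ψ) :
    Tendsto (fun n => divPairing u (mollify n Ψ)) atTop (𝓝 (divPairing u Ψ)) := by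
  have hc : ∀ j : Fin d, Continuous fun p => fderiv ℝ Ψ p (spaceUnit j) := fun j =>
    (hΨ.continuous_fderiv (by simp)).clm_apply continuous_const
  have hb : ∀ j : Fin d, ∃ C, ∀ p, ‖fderiv ℝ Ψ p (spaceUnit j)‖ ≤ C := fun j =>
    (hc j).bounded_above_of_compact_support (hΨc.fderiv_apply (𝕜 := ℝ) (spaceUnit j))
  choose C hC using hb
  unfold divPairing
  simp_rw [fderiv_mollify_of_contDiff _ hΨ hΨc]
  refine tendsto_integral_of_dominated_convergence (fun p => ∑ j, ‖u p‖ * C j) (fun n => ?_)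
    ?_ (fun n => ae_of_all _ fun p => ?_) (ae_of_all _ fun p => ?_)
  · refine Finset.aestronglyMeasurable_fun_sum _ fun j _ => ?_
    refine ((((continuous_tens continuous_id continuous_const).comp_stronglyMeasurable hum).inner
      (Continuous.stronglyMeasurable ?_)).aestronglyMeasurable)
    exact (contDiff_mollify n (hc j).locallyIntegrable).continuous
  · exact integrable_finsetSum _ fun j _ => hui.norm.mul_const _
  · refine (norm_sum_le _ _).trans (Finset.sum_le_sum fun j _ => ?_)
    refine (norm_inner_le_norm _ _).trans ?_
    rw [norm_tens]
    simp only [PiLp.norm_single, norm_one, mul_one]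
    gcongr
    exact norm_mollify_le n (hC j) p
  · exact tendsto_finsetSum _ fun j _ =>
      tendsto_const_nhds.inner (tendsto_mollify_of_continuous (hc j) p)

/-- `V` bounds the total variation on `U` of the spatial gradient of `u`. -/
def VariationBound (U : Set (SpaceTime d)) (u : SpaceTime d → Space d) (V : ℝ) : Prop :=
  ∀ Ψ, IsMatTest U Ψ → (∀ p, ‖Ψ p‖ ≤ 1) → -divPairing u Ψ ≤ V

/-- The left side is the pairing of the mollified gradient with its own polar field restricted to K.
Moving the mollifier onto that field yields an admissible test: averaging does not increase the sup
norm, and the support stays in U once the mollification radius is below the distance available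
around K. -/
lemma eventually_setIntegral_norm_gradMat_le (hum : StronglyMeasurable u) (hui : Integrable u)
    {U : Set (SpaceTime d)} (hU : IsOpen U) {V : ℝ} (hV : VariationBound U u V)
    {K : Set (SpaceTime d)} (hK : IsCompact K) (hKU : K ⊆ U) :
    ∀ᶠ n in atTop, ∫ p in K, ‖gradMat (mollify n u) p‖ ≤ V := by
  obtain ⟨δ, hδ, hδU⟩ := hK.exists_cthickening_subset_open hU hKU
  filter_upwards [(tendsto_bumpSeq_rOut d).eventually (gt_mem_nhds hδ)] with n hn
  set N := gradMat (mollify n u) with hN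
  have hNc : Continuous N := continuous_gradMat (contDiff_mollify n hui.locallyIntegrable)
  -- Where N vanishes the inverse is 0 by convention, so the polar field is 0 there and the bound by
  -- one still holds.
  let Ξ : SpaceTime d → Mat d := K.indicator fun p => ‖N p‖⁻¹ • N p
  have hΞm : StronglyMeasurable Ξ :=
    (hNc.norm.measurable.inv.stronglyMeasurable.smul hNc.stronglyMeasurable).indicator
      hK.measurableSet
  have hΞ1 : ∀ p, ‖Ξ p‖ ≤ 1 := by
    intro p
    by_cases hp : p ∈ K
    · simp only [Ξ, indicator_of_mem hp, norm_smul, norm_inv, norm_norm]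
      exact inv_mul_le_one
    · simp [Ξ, indicator_of_notMem hp]
  have hΞ0 : ∀ p, p ∉ K → Ξ p = 0 := fun p hp => indicator_of_notMem hp _
  have hΞi : Integrable Ξ := by
    have h1 : Integrable (K.indicator fun _ : SpaceTime d => (1 : ℝ)) :=
      (integrable_indicator_iff hK.measurableSet).2
        (integrableOn_const hK.measure_lt_top.ne)
    refine h1.mono' hΞm.aestronglyMeasurable (ae_of_all _ fun p => ?_)
    by_cases hp : p ∈ K
    · simpa [indicator_of_mem hp] using hΞ1 p
    · simp [hΞ0 p hp, indicator_of_notMem hp]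
  have hsub := (tsupport_mollify_subset hΞ0 hn.le).trans hδU
  have hcomp : HasCompactSupport (mollify n Ξ) :=
    (hK.cthickening (r := δ)).of_isClosed_subset (isClosed_tsupport _)
      (tsupport_mollify_subset hΞ0 hn.le)
  have h := hV _ ⟨contDiff_mollify n hΞi.locallyIntegrable, hcomp, hsub⟩ (norm_mollify_le n hΞ1)
  rw [divPairing_mollify n hum hui hΞm hΞi, neg_neg] at h
  refine le_of_eq_of_le ?_ h
  rw [← integral_indicator hK.measurableSet]
  refine integral_congr_ae (ae_of_all _ fun p => ?_)
  by_cases hp : p ∈ K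
  · simp only [indicator_of_mem hp, Ξ, ← hN, inner_smul_left, real_inner_self_eq_norm_sq]
    by_cases h0 : ‖N p‖ = 0
    · simp [h0]
    · simp only [map_inv₀, conj_trivial]; field_simp
  · simp [indicator_of_notMem hp, hΞ0 p hp]

/-- The mass is eventually at most V, and the pairing with ψ tends to `-divPairing u ψ`. When ψ
nearly attains V the right side is small, so the mollified gradients nearly point along ψ in an
integrated sense. -/
lemma eventually_setIntegral_defect_le (hum : StronglyMeasurable u) (hui : Integrable u)
    {U : Set (SpaceTime d)} (hU : IsOpen U) {V : ℝ} (hV : VariationBound U u V)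
    {K : Set (SpaceTime d)} (hK : IsCompact K) (hKU : K ⊆ U)
    {ψ : SpaceTime d → Mat d} (hψ : IsMatTest U ψ) (hψK : tsupport ψ ⊆ K) {η : ℝ} (hη : 0 < η) :
    ∀ᶠ n in atTop, ∫ p in K, (‖gradMat (mollify n u) p‖ - inner ℝ (ψ p) (gradMat (mollify n u) p)) ≤
      V + divPairing u ψ + η := by
  filter_upwards [eventually_setIntegral_norm_gradMat_le hum hui hU hV hK hKU,
    (tendsto_divPairing_mollify hum hui hψ.smooth hψ.compact).eventually
      (gt_mem_nhds (show divPairing u ψ < divPairing u ψ + η by linarith))] with n h1 h2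
  have hNc : Continuous (gradMat (mollify n u)) :=
    continuous_gradMat (contDiff_mollify n hui.locallyIntegrable)
  rw [divPairing_mollify n hum hui hψ.smooth.continuous.stronglyMeasurable
    (hψ.smooth.continuous.integrable_of_hasCompactSupport hψ.compact)] at h2
  rw [integral_sub (hNc.norm.continuousOn.integrableOn_compact hK)
    ((hψ.smooth.continuous.inner hNc).continuousOn.integrableOn_compact hK)]
  have h3 : ∫ p in K, inner ℝ (ψ p) (gradMat (mollify n u) p) =
      ∫ p, inner ℝ (ψ p) (gradMat (mollify n u) p) := by
    refine setIntegral_eq_integral_of_forall_compl_eq_zero fun p hp => ?_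
    rw [image_eq_zero_of_notMem_tsupport fun h => hp (hψK h), inner_zero_left]
  linarith

end DivPairing

-- Trace-free projection and incompressibility.

section TraceFree

/-- The identity matrix. -/
def idMat (d : ℕ) : Mat d := ∑ j, tens (EuclideanSpace.single j 1) (EuclideanSpace.single j 1)

lemma inner_idMat (M : Mat d) : inner ℝ M (idMat d) = matTrace M := by
  rw [idMat, inner_sum, matTrace]
  refine Finset.sum_congr rfl fun j _ => ?_
  rw [inner_tens_left_eq, EuclideanSpace.inner_single_left, matCLM_apply]
  simp

lemma inner_tens_idMat (v z : Space d) : inner ℝ (tens v z) (idMat d) = inner ℝ v z := by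
  rw [inner_idMat, matTrace, inner_space]; rfl

lemma matTrace_idMat (d : ℕ) : matTrace (idMat d) = d := by
  rw [← inner_idMat, idMat, sum_inner]
  have h : ∀ j : Fin d, inner ℝ (tens (EuclideanSpace.single j (1:ℝ)) (EuclideanSpace.single j 1))
      (idMat d) = 1 := fun j => by simp [inner_tens_idMat]
  rw [← idMat]
  simp [h]

/-- The trace-free part of a matrix. -/
def devMat (M : Mat d) : Mat d := M - (matTrace M / d) • idMat d

lemma matTrace_sub_smul (M N : Mat d) (c : ℝ) :
    matTrace (M - c • N) = matTrace M - c * matTrace N := by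
  simp [matTrace, Finset.sum_sub_distrib, Finset.mul_sum]

lemma matTrace_devMat (M : Mat d) : matTrace (devMat M) = 0 := by
  rw [devMat, matTrace_sub_smul, matTrace_idMat]
  -- In dimension 0 the quotient by d has no meaning, but the trace is an empty sum.
  rcases Nat.eq_zero_or_pos d with rfl | h
  · simp [matTrace]
  · field_simp; simp

/-- The trace-free part is orthogonal to the identity matrix in the Frobenius inner product, so this
is Pythagoras. -/
lemma norm_devMat_le (M : Mat d) : ‖devMat M‖ ≤ ‖M‖ := by
  set c := matTrace M / d
  have h : M = devMat M + c • idMat d := by simp [devMat, c]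
  have h0 : inner ℝ (devMat M) (c • idMat d) = 0 := by
    rw [inner_smul_right, inner_idMat, matTrace_devMat, mul_zero]
  have := norm_add_sq_eq_norm_sq_add_norm_sq_of_inner_eq_zero _ _ h0
  rw [← h] at this
  nlinarith [norm_nonneg M, norm_nonneg (devMat M), mul_self_nonneg ‖c • idMat d‖]

variable {u : SpaceTime d → Space d}

lemma contDiff_matTrace_comp {Ψ : SpaceTime d → Mat d} (hΨ : ContDiff ℝ ∞ Ψ) :
    ContDiff ℝ ∞ fun p => matTrace (Ψ p) / (d : ℝ) := by
  simp_rw [← inner_idMat]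
  exact (hΨ.inner ℝ contDiff_const).div_const _

lemma IsMatTest.devMat {U : Set (SpaceTime d)} {Ψ : SpaceTime d → Mat d} (hΨ : IsMatTest U Ψ) :
    IsMatTest U fun p => devMat (Ψ p) := by
  have hs : Function.support (fun p => DuchonRobert.devMat (Ψ p)) ⊆ Function.support Ψ := by
    intro p hp h
    exact hp (by simp [h, DuchonRobert.devMat, matTrace])
  exact ⟨hΨ.smooth.sub ((contDiff_matTrace_comp hΨ.smooth).smul contDiff_const),
    hΨ.compact.mono hs, (closure_mono hs).trans hΨ.subset⟩

/-- The discarded part is a scalar test function θ times the identity, whose pairing with u is `∫ u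
· ∇θ = 0`. Incompressibility thus lets near-optimal test fields be taken trace-free. -/
lemma divPairing_devMat (hum : StronglyMeasurable u) (hui : Integrable u) {U : Set (SpaceTime d)}
    (hdiv : ∀ θ, IsTestFunction U θ → ∫ p, inner ℝ (u p) (gradX θ p) = 0)
    {Ψ : SpaceTime d → Mat d} (hΨ : IsMatTest U Ψ) :
    divPairing u (fun p => devMat (Ψ p)) = divPairing u Ψ := by
  let θ : SpaceTime d → ℝ := fun p => matTrace (Ψ p) / d
  have hs : Function.support θ ⊆ Function.support Ψ := by
    intro p hp h
    exact hp (by simp [θ, h, matTrace])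
  have hθ : IsTestFunction U θ := ⟨contDiff_matTrace_comp hΨ.smooth, hΨ.compact.mono hs,
    (closure_mono hs).trans hΨ.subset⟩
  have hs' : Function.support (fun p => θ p • idMat d) ⊆ Function.support θ := by
    intro p hp h
    exact hp (by simp [h])
  have hI : IsMatTest U fun p => θ p • idMat d := ⟨hθ.smooth.smul contDiff_const,
    hθ.compact.mono hs', (closure_mono hs').trans hθ.subset⟩
  have h0 : divPairing u (fun p => θ p • idMat d) = 0 := by
    rw [← hdiv θ hθ]
    refine integral_congr_ae (ae_of_all _ fun p => ?_)
    have hd := hθ.smooth.differentiable (by simp) p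
    simp only
    rw [inner_space]
    refine Finset.sum_congr rfl fun j _ => ?_
    rw [fderiv_smul_const hd, gradX_apply hd, ContinuousLinearMap.smulRight_apply, inner_smul_right,
      inner_tens_idMat, EuclideanSpace.inner_single_right]
    simp [mul_comm]
  have := divPairing_sub hum hui hΨ hI
  rw [h0, sub_zero] at this
  exact this

end TraceFree

-- The trilinear flux and its bound by the gauge.

/-- By Fubini the property holds almost everywhere on almost every time slice, and `z ↦ x + ε z`
preserves null sets. The shift is purely spatial, so a null set of space-time cannot simply be
translated for each z. -/
lemma ae_ae_shift {P : SpaceTime d → Prop} (h : ∀ᵐ q, P q) {ε : ℝ} (hε : ε ≠ 0) :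
    ∀ᵐ q : SpaceTime d, ∀ᵐ z : Space d, P (q.1 + ε • z, q.2) := by
  have h1 : ∀ᵐ r : ℝ × Space d, P (r.2, r.1) :=
    (Measure.measurePreserving_swap (μ := (volume : Measure ℝ))
      (ν := (volume : Measure (Space d)))).quasiMeasurePreserving.ae h
  have h2 : ∀ᵐ t : ℝ, ∀ᵐ x : Space d, P (x, t) := Measure.ae_ae_of_ae_prod h1
  have h3 : ∀ᵐ q : SpaceTime d, ∀ᵐ x : Space d, P (x, q.2) :=
    Measure.quasiMeasurePreserving_snd.ae h2
  filter_upwards [h3] with q hq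
  have hs : Measure.QuasiMeasurePreserving (fun z : Space d => ε • z) volume volume := by
    refine ⟨measurable_const_smul ε, ?_⟩
    rw [Measure.map_addHaar_smul _ hε]
    exact Measure.AbsolutelyContinuous.rfl.smul_left _
  have ha : Measure.QuasiMeasurePreserving (fun z : Space d => q.1 + z) volume volume :=
    (measurePreserving_add_left volume q.1).quasiMeasurePreserving
  exact (ha.comp hs).ae hq

/-- The trilinear quantity behind `approx`, with one increment taken of another field `v`. -/
def mixedFlux (ρ : Space d → ℝ) (ε : ℝ) (φ : SpaceTime d → ℝ) (u v : SpaceTime d → Space d) : ℝ :=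
  ∫ q, φ q * ∫ z, inner ℝ (gradient ρ z) (increment v (ε • z) q) * ‖increment u (ε • z) q‖ ^ 2

lemma integral_approx_mul (ρ : Space d → ℝ) (ε : ℝ) (φ : SpaceTime d → ℝ)
    (u : SpaceTime d → Space d) :
    ∫ q, approx ρ u ε q * φ q = 1 / (4 * ε) * mixedFlux ρ ε φ u u := by
  rw [mixedFlux, ← integral_const_mul]
  refine integral_congr_ae (ae_of_all _ fun q => ?_)
  simp only [approx]; ring

section MixedFlux

variable {u : SpaceTime d → Space d} {C : ℝ}

lemma norm_increment_le (hC : ∀ p, ‖u p‖ ≤ C) (ξ : Space d) (q : SpaceTime d) :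
    ‖increment u ξ q‖ ≤ 2 * C := by
  refine (norm_sub_le _ _).trans ?_
  linarith [hC (q.1 + ξ, q.2), hC q]

lemma stronglyMeasurable_increment {v : SpaceTime d → Space d} (hv : StronglyMeasurable v) (ε : ℝ) :
    StronglyMeasurable fun x : SpaceTime d × Space d => increment v (ε • x.2) x.1 := by
  unfold increment
  refine (hv.comp_measurable ?_).sub (hv.comp_measurable measurable_fst)
  fun_prop

lemma norm_mixedFlux_integrand_le {v : SpaceTime d → Space d} (hC : ∀ p, ‖u p‖ ≤ C)
    (hv : ∀ p, ‖v p‖ ≤ C) (ρ : Space d → ℝ) (ε : ℝ) (q : SpaceTime d) (z : Space d) :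
    ‖inner ℝ (gradient ρ z) (increment v (ε • z) q) * ‖increment u (ε • z) q‖ ^ 2‖ ≤
      ‖gradient ρ z‖ * (8 * C ^ 3) := by
  have hC0 : 0 ≤ C := (norm_nonneg _).trans (hC 0)
  rw [norm_mul, norm_pow, norm_norm]
  calc _ ≤ (‖gradient ρ z‖ * (2 * C)) * (2 * C) ^ 2 := by
        gcongr
        · exact (norm_inner_le_norm _ _).trans (by gcongr; exact norm_increment_le hv _ _)
        · exact norm_increment_le hC _ _
    _ = _ := by ring

lemma stronglyMeasurable_mixedFlux_integrand {ρ : Space d → ℝ} (hρ : IsKernel ρ)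
    {v : SpaceTime d → Space d} (hum : StronglyMeasurable u) (hvm : StronglyMeasurable v) (ε : ℝ) :
    StronglyMeasurable fun x : SpaceTime d × Space d =>
      inner ℝ (gradient ρ x.2) (increment v (ε • x.2) x.1) * ‖increment u (ε • x.2) x.1‖ ^ 2 :=
  ((hρ.continuous_gradient.comp continuous_snd).stronglyMeasurable.inner
    (stronglyMeasurable_increment hvm ε)).mul ((stronglyMeasurable_increment hum ε).norm.pow 2)

lemma IsKernel.integrable_gradient {ρ : Space d → ℝ} (hρ : IsKernel ρ) :
    Integrable (gradient ρ) :=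
  hρ.continuous_gradient.integrable_of_hasCompactSupport hρ.hasCompactSupport_gradient

/-- Only the increment contracted with `∇ρ` is mollified; the squared increment stays rough and is
later bounded by `(2 C) ^ 2`. The mollified increments obey the same sup bound, so dominated
convergence applies at fixed ε. -/
lemma tendsto_mixedFlux_mollify {ρ : Space d → ℝ} (hρ : IsKernel ρ) {ε : ℝ} (hε : ε ≠ 0)
    (hum : StronglyMeasurable u) (hui : Integrable u) (hC : ∀ p, ‖u p‖ ≤ C)
    {φ : SpaceTime d → ℝ} (hφ : Continuous φ) (hφc : HasCompactSupport φ) :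
    Tendsto (fun n => mixedFlux ρ ε φ u (mollify n u)) atTop (𝓝 (mixedFlux ρ ε φ u u)) := by
  have hm : ∀ n, StronglyMeasurable (mollify n u) := fun n =>
    (contDiff_mollify n hui.locallyIntegrable).continuous.stronglyMeasurable
  have hφi : Integrable φ := hφ.integrable_of_hasCompactSupport hφc
  have hae := ae_tendsto_mollify hui.locallyIntegrable
  refine tendsto_integral_of_dominated_convergence
    (fun q => ‖φ q‖ * ∫ z, ‖gradient ρ z‖ * (8 * C ^ 3)) (fun n => ?_) ?_
    (fun n => ae_of_all _ fun q => ?_) ?_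
  · exact (hφ.stronglyMeasurable.mul (stronglyMeasurable_mixedFlux_integrand hρ hum
      (hm n) ε).integral_prod_right).aestronglyMeasurable
  · exact hφi.norm.mul_const _
  · rw [norm_mul]
    gcongr
    exact norm_integral_le_of_norm_le (hρ.integrable_gradient.norm.mul_const _)
      (ae_of_all _ fun z => norm_mixedFlux_integrand_le hC (norm_mollify_le n hC) ρ ε q z)
  · filter_upwards [hae, ae_ae_shift hae hε] with q h1 h2
    refine Tendsto.const_mul _ ?_
    refine tendsto_integral_of_dominated_convergence (fun z => ‖gradient ρ z‖ * (8 * C ^ 3))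
      (fun n => ?_) (hρ.integrable_gradient.norm.mul_const _) (fun n => ae_of_all _ fun z =>
        norm_mixedFlux_integrand_le hC (norm_mollify_le n hC) ρ ε q z) ?_
    · exact ((stronglyMeasurable_mixedFlux_integrand hρ hum (hm n) ε).comp_measurable
        measurable_prodMk_left).aestronglyMeasurable
    · filter_upwards [h2] with z hz
      exact (tendsto_const_nhds.inner (hz.sub h1)).mul tendsto_const_nhds

/-- The fundamental theorem of calculus along the segment from x to `x + ε z`; the derivative in
direction z is rewritten through `gradTens`. -/
lemma enorm_inner_increment_le {v : SpaceTime d → Space d} (hv : ContDiff ℝ ∞ v)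
    (ρ : Space d → ℝ) {ε : ℝ} (hε : 0 < ε) (q : SpaceTime d) (z : Space d) :
    ‖inner ℝ (gradient ρ z) (increment v (ε • z) q)‖ₑ ≤
      ENNReal.ofReal ε * ∫⁻ s in Ioc (0 : ℝ) 1,
        ‖inner ℝ (gradTens ρ z) (gradMat v (q + ((s * ε) • z, 0)))‖ₑ := by
  have hd : ∀ s : ℝ, HasDerivAt (fun s : ℝ => inner ℝ (gradient ρ z) (v (q + ((s * ε) • z, 0))))
      (ε * inner ℝ (gradTens ρ z) (gradMat v (q + ((s * ε) • z, 0)))) s := by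
    intro s
    have h1 : HasDerivAt (fun s : ℝ => q + ((s * ε) • z, (0 : ℝ))) (ε • (z, (0 : ℝ))) s := by
      refine HasDerivAt.const_add q ?_
      have := (((hasDerivAt_id s).mul_const ε).smul_const z).prodMk (hasDerivAt_const s (0 : ℝ))
      simpa using this
    have h2 := (hv.differentiable (by simp) (q + ((s * ε) • z, 0))).hasFDerivAt.comp_hasDerivAt s h1
    have h3 := (hasDerivAt_const s (gradient ρ z)).inner ℝ h2
    refine h3.congr_deriv ?_
    rw [inner_gradTens_gradMat, map_smul, inner_smul_right, inner_zero_left, add_zero]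
  have hc : Continuous fun s : ℝ =>
      ε * inner ℝ (gradTens ρ z) (gradMat v (q + ((s * ε) • z, 0))) := by
    have := continuous_gradMat hv
    fun_prop
  have h := intervalIntegral.integral_eq_sub_of_hasDerivAt (a := 0) (b := 1)
    (fun s _ => hd s) (hc.intervalIntegrable _ _)
  have e : inner ℝ (gradient ρ z) (increment v (ε • z) q) = ∫ s in (0 : ℝ)..1,
      ε * inner ℝ (gradTens ρ z) (gradMat v (q + ((s * ε) • z, 0))) := by
    rw [h, ← inner_sub_right, increment]
    congr 2
    · congr 1; ext1 <;> simp
    · congr 1; ext1 <;> simp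
  rw [e, intervalIntegral.integral_of_le zero_le_one, integral_const_mul, enorm_mul,
    Real.enorm_eq_ofReal hε.le]
  gcongr
  exact enorm_integral_le_lintegral_enorm _

lemma ofReal_gauge {ρ : Space d → ℝ} (hρ : IsKernel ρ) (A : Mat d) :
    ENNReal.ofReal (gauge ρ A) = ∫⁻ z, ‖inner ℝ (gradTens ρ z) A‖ₑ := by
  rw [gauge, ofReal_integral_eq_lintegral_ofReal (hρ.integrable_inner_gradTens A).abs
    (ae_of_all _ fun _ => abs_nonneg _)]
  exact lintegral_congr fun z => by rw [← Real.enorm_eq_ofReal_abs]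

/-- Translating q moves the shift `s ε z` from N onto φ, where the majorant f absorbs it uniformly
in z and s. The z-integral is then exactly the gauge of N at an unshifted point, and the s-interval
has length one. -/
lemma lintegral_shift_le {ρ : Space d → ℝ} (hρ : IsKernel ρ) {N : SpaceTime d → Mat d}
    (hN : Continuous N) {ε : ℝ} (hε : 0 < ε) {φ f : SpaceTime d → ℝ} (hφ : Continuous φ)
    (hf : Measurable f) (hφf : ∀ q y, ‖y‖ ≤ ε → |φ (q.1 - y, q.2)| ≤ f q) :
    ∫⁻ q, ‖φ q‖ₑ * ∫⁻ z, ∫⁻ s in Ioc (0 : ℝ) 1,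
        ‖inner ℝ (gradTens ρ z) (N (q + ((s * ε) • z, 0)))‖ₑ ≤
      ∫⁻ q, ENNReal.ofReal (f q) * ENNReal.ofReal (gauge ρ (N q)) := by
  set ν : Measure (Space d × ℝ) :=
    (volume : Measure (Space d)).prod (volume.restrict (Ioc (0 : ℝ) 1)) with hν
  have hW := hρ.continuous_gradTens
  have hc : Continuous fun x : SpaceTime d × (Space d × ℝ) =>
      inner ℝ (gradTens ρ x.2.1) (N (x.1 + ((x.2.2 * ε) • x.2.1, 0))) := by fun_prop
  have hm1 : Measurable fun x : SpaceTime d × (Space d × ℝ) =>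
      ‖φ x.1‖ₑ * ‖inner ℝ (gradTens ρ x.2.1) (N (x.1 + ((x.2.2 * ε) • x.2.1, 0)))‖ₑ :=
    (hφ.comp continuous_fst).measurable.enorm.mul hc.measurable.enorm
  have hc2 : Continuous fun x : SpaceTime d × (Space d × ℝ) =>
      inner ℝ (gradTens ρ x.2.1) (N x.1) := by fun_prop
  have hm2 : Measurable fun x : SpaceTime d × (Space d × ℝ) =>
      ENNReal.ofReal (f x.1) * ‖inner ℝ (gradTens ρ x.2.1) (N x.1)‖ₑ :=
    (hf.comp measurable_fst).ennreal_ofReal.mul hc2.measurable.enorm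
  calc _ = ∫⁻ q, ∫⁻ w, ‖φ q‖ₑ *
        ‖inner ℝ (gradTens ρ w.1) (N (q + ((w.2 * ε) • w.1, 0)))‖ₑ ∂ν := by
        refine lintegral_congr fun q => ?_
        have hq : Measurable fun w : Space d × ℝ =>
            ‖inner ℝ (gradTens ρ w.1) (N (q + ((w.2 * ε) • w.1, 0)))‖ₑ :=
          (hc.comp (continuous_const.prodMk continuous_id)).measurable.enorm
        rw [lintegral_const_mul _ hq, hν, lintegral_prod _ hq.aemeasurable]
    _ = ∫⁻ w, ∫⁻ q, ‖φ q‖ₑ *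
        ‖inner ℝ (gradTens ρ w.1) (N (q + ((w.2 * ε) • w.1, 0)))‖ₑ ∂volume ∂ν :=
        lintegral_lintegral_swap hm1.aemeasurable
    _ ≤ ∫⁻ w, ∫⁻ q, ENNReal.ofReal (f q) * ‖inner ℝ (gradTens ρ w.1) (N q)‖ₑ ∂volume ∂ν := by
        have hs : ∀ᵐ w ∂ν, w.2 ∈ Ioc (0 : ℝ) 1 :=
          Measure.quasiMeasurePreserving_snd.ae (ae_restrict_mem measurableSet_Ioc)
        refine lintegral_mono_ae ?_
        filter_upwards [hs] with w hw
        -- The translation that removes the shift from the argument of N.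
        rw [← lintegral_sub_right_eq_self _ (((w.2 * ε) • w.1, 0) : SpaceTime d)]
        refine lintegral_mono fun q => ?_
        simp only [sub_add_cancel]
        by_cases hz : 1 ≤ ‖w.1‖
        · have : gradTens ρ w.1 = 0 := by
            rw [← norm_eq_zero, gradTens, norm_tens, hρ.gradient_eq_zero hz, norm_zero, zero_mul]
          simp [this]
        · gcongr
          rw [Real.enorm_eq_ofReal_abs]
          refine ENNReal.ofReal_le_ofReal ?_
          have h1 := hφf q ((w.2 * ε) • w.1) (by
            rw [norm_smul, norm_mul, Real.norm_of_nonneg hw.1.le, Real.norm_of_nonneg hε.le]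
            calc w.2 * ε * ‖w.1‖ ≤ 1 * ε * 1 := by
                  gcongr
                  · exact hw.2
                  · exact (not_le.1 hz).le
              _ = ε := by ring)
          have e : q - ((w.2 * ε) • w.1, 0) = (q.1 - (w.2 * ε) • w.1, q.2) := by ext1 <;> simp
          rwa [e]
    _ = ∫⁻ q, ∫⁻ w, ENNReal.ofReal (f q) * ‖inner ℝ (gradTens ρ w.1) (N q)‖ₑ ∂ν :=
        (lintegral_lintegral_swap hm2.aemeasurable).symm
    _ = _ := by
        refine lintegral_congr fun q => ?_
        have hq : Measurable fun w : Space d × ℝ => ‖inner ℝ (gradTens ρ w.1) (N q)‖ₑ :=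
          (hc2.comp (continuous_const.prodMk continuous_id)).measurable.enorm
        rw [lintegral_const_mul _ hq, hν, lintegral_prod _ hq.aemeasurable, ofReal_gauge hρ]
        simp

/-- The flux of a smooth field is controlled by its gradient, measured by the gauge of the
kernel. -/
lemma norm_mixedFlux_le {ρ : Space d → ℝ} (hρ : IsKernel ρ) {v : SpaceTime d → Space d}
    (hv : ContDiff ℝ ∞ v) (hC : ∀ p, ‖u p‖ ≤ C) {ε : ℝ} (hε : 0 < ε) {φ f : SpaceTime d → ℝ}
    (hφ : Continuous φ) (hf : Measurable f) (hf0 : ∀ q, 0 ≤ f q)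
    (hφf : ∀ q y, ‖y‖ ≤ ε → |φ (q.1 - y, q.2)| ≤ f q)
    (hfi : Integrable fun q => f q * gauge ρ (gradMat v q)) :
    ‖mixedFlux ρ ε φ u v‖ ≤ ε * (4 * C ^ 2) * ∫ q, f q * gauge ρ (gradMat v q) := by
  have hC0 : 0 ≤ C := (norm_nonneg _).trans (hC 0)
  have hI0 : 0 ≤ ∫ q, f q * gauge ρ (gradMat v q) :=
    integral_nonneg fun q => mul_nonneg (hf0 q) (gauge_nonneg _ _)
  rw [← ENNReal.ofReal_le_ofReal_iff (by positivity), ofReal_norm]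
  have hN := continuous_gradMat hv
  have hin : ∀ q, ‖∫ z, inner ℝ (gradient ρ z) (increment v (ε • z) q) *
      ‖increment u (ε • z) q‖ ^ 2‖ₑ ≤ ENNReal.ofReal (ε * (4 * C ^ 2)) *
      ∫⁻ z, ∫⁻ s in Ioc (0 : ℝ) 1,
        ‖inner ℝ (gradTens ρ z) (gradMat v (q + ((s * ε) • z, 0)))‖ₑ := by
    intro q
    refine (enorm_integral_le_lintegral_enorm _).trans ?_
    rw [← lintegral_const_mul' _ _ ENNReal.ofReal_ne_top]
    refine lintegral_mono fun z => ?_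
    rw [enorm_mul, mul_comm ε, ENNReal.ofReal_mul (by positivity), mul_assoc, mul_comm]
    gcongr
    · rw [Real.enorm_eq_ofReal (by positivity)]
      refine ENNReal.ofReal_le_ofReal ?_
      calc _ ≤ (2 * C) ^ 2 := by gcongr; exact norm_increment_le hC _ _
        _ = _ := by ring
    · exact enorm_inner_increment_le hv ρ hε q z
  calc ‖mixedFlux ρ ε φ u v‖ₑ ≤ ∫⁻ q, ‖φ q‖ₑ * (ENNReal.ofReal (ε * (4 * C ^ 2)) *
        ∫⁻ z, ∫⁻ s in Ioc (0 : ℝ) 1,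
          ‖inner ℝ (gradTens ρ z) (gradMat v (q + ((s * ε) • z, 0)))‖ₑ) := by
        refine (enorm_integral_le_lintegral_enorm _).trans (lintegral_mono fun q => ?_)
        rw [enorm_mul]
        gcongr
        exact hin q
    _ = ENNReal.ofReal (ε * (4 * C ^ 2)) * ∫⁻ q, ‖φ q‖ₑ *
        ∫⁻ z, ∫⁻ s in Ioc (0 : ℝ) 1,
          ‖inner ℝ (gradTens ρ z) (gradMat v (q + ((s * ε) • z, 0)))‖ₑ := by
        rw [← lintegral_const_mul' _ _ ENNReal.ofReal_ne_top]
        exact lintegral_congr fun q => by ring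
    _ ≤ ENNReal.ofReal (ε * (4 * C ^ 2)) *
        ∫⁻ q, ENNReal.ofReal (f q) * ENNReal.ofReal (gauge ρ (gradMat v q)) := by
        exact mul_le_mul' le_rfl (lintegral_shift_le hρ hN hε hφ hf hφf)
    _ = _ := by
        rw [ENNReal.ofReal_mul (p := ε * (4 * C ^ 2)) (by positivity), ofReal_integral_eq_lintegral_ofReal hfi
          (ae_of_all _ fun q => mul_nonneg (hf0 q) (gauge_nonneg _ _))]
        congr 1
        exact lintegral_congr fun q => (ENNReal.ofReal_mul (hf0 q)).symm

end MixedFlux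

-- Localization and kernel selection.

/-- Expanding the square gives `‖N - ‖N‖ M‖² ≤ 2 ‖N‖ (‖N‖ - ⟨M, N⟩)`, and the geometric mean is
split with weight l. The square root of the defect becomes a linear expression, which can be
integrated against bounds on the mass and on the defect separately. -/
lemma norm_sub_norm_smul_le {E : Type*} [NormedAddCommGroup E] [InnerProductSpace ℝ E]
    (N M : E) (hM : ‖M‖ ≤ 1) {l : ℝ} (hl : 0 < l) :
    ‖N - ‖N‖ • M‖ ≤ l * ‖N‖ + (‖N‖ - inner ℝ M N) / (2 * l) := by
  have h1 : ‖N - ‖N‖ • M‖ ^ 2 ≤ 2 * ‖N‖ * (‖N‖ - inner ℝ M N) := by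
    rw [norm_sub_sq_real, inner_smul_right, norm_smul, norm_norm, real_inner_comm]
    have : (‖N‖ * ‖M‖) ^ 2 ≤ (‖N‖ * 1) ^ 2 := by gcongr
    nlinarith
  have h2 : 0 ≤ ‖N‖ - inner ℝ M N := by
    have := real_inner_le_norm M N
    have : ‖M‖ * ‖N‖ ≤ 1 * ‖N‖ := by gcongr
    linarith
  set b := ‖N‖ - inner ℝ M N
  refine le_of_sq_le_sq (h1.trans ?_) (by positivity)
  -- The inequality `4 x y ≤ (x + y)²` with x, y the two summands of the claim.
  have h3 : 4 * (l * ‖N‖) * (b / (2 * l)) = 2 * ‖N‖ * b := by field_simp; ring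
  nlinarith [sq_nonneg (l * ‖N‖ - b / (2 * l))]

section Localization

variable {u : SpaceTime d → Space d} {C : ℝ}

/-- An arbitrary bound is replaced by the least one, so that some admissible field comes within η of
it; only then is the defect small. -/
lemma exists_variation_sup {U : Set (SpaceTime d)} {V : ℝ} (hV : VariationBound U u V) :
    ∃ V₀ : ℝ, 0 ≤ V₀ ∧ VariationBound U u V₀ ∧ ∀ η > 0, ∃ Ψ, IsMatTest U Ψ ∧ (∀ p, ‖Ψ p‖ ≤ 1) ∧
      V₀ - η < -divPairing u Ψ := by
  let S : Set ℝ := {x | ∃ Ψ, IsMatTest U Ψ ∧ (∀ p, ‖Ψ p‖ ≤ 1) ∧ -divPairing u Ψ = x}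
  have hb : BddAbove S := ⟨V, by rintro x ⟨Ψ, h1, h2, rfl⟩; exact hV Ψ h1 h2⟩
  have h0 : (0 : ℝ) ∈ S := by
    refine ⟨fun _ => 0, ⟨contDiff_const, HasCompactSupport.zero, by simp [tsupport]⟩,
      fun p => by simp, ?_⟩
    simp [divPairing]
  refine ⟨sSup S, le_csSup hb h0, fun Ψ h1 h2 => le_csSup hb ⟨Ψ, h1, h2, rfl⟩, fun η hη => ?_⟩
  obtain ⟨x, ⟨Ψ, h1, h2, rfl⟩, h3⟩ := exists_lt_of_lt_csSup ⟨0, h0⟩ (sub_lt_self (sSup S) hη)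
  exact ⟨Ψ, h1, h2, h3⟩

lemma exists_shift_bound {φ : SpaceTime d → ℝ} (hφ : Continuous φ) {K₀ K : Set (SpaceTime d)}
    (hφ0 : ∀ q, q ∉ K₀ → φ q = 0) (hK₀ : IsCompact K₀) {δ : ℝ} (hδ : 0 < δ)
    (hK : Metric.cthickening δ K₀ ⊆ K) {w : ℝ} (hw : 0 < w) :
    ∃ r > 0, ∀ ε ≤ r, ∀ (q : SpaceTime d) (y : Space d), ‖y‖ ≤ ε →
      |φ (q.1 - y, q.2)| ≤ |φ q| + K.indicator (fun _ => w) q := by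
  have hc : HasCompactSupport φ := HasCompactSupport.intro hK₀ hφ0
  obtain ⟨r, hr, h⟩ := Metric.uniformContinuous_iff.1 (hc.uniformContinuous_of_continuous hφ) w hw
  -- The δ keeps shifted points out of `K₀` when q is outside K; the half turns `‖y‖ ≤ ε` into the
  -- strict inequality of uniform continuity.
  refine ⟨min δ (r / 2), by positivity, fun ε hε q y hy => ?_⟩
  have hdist : dist ((q.1 - y, q.2) : SpaceTime d) q = ‖y‖ := by
    rw [dist_eq_norm, Prod.norm_def]; simp
  by_cases hq : q ∈ K
  · rw [indicator_of_mem hq]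
    have h1 := h (a := (q.1 - y, q.2)) (b := q) (by
      rw [hdist]; linarith [min_le_right δ (r / 2)])
    rw [Real.dist_eq] at h1
    have := abs_sub_abs_le_abs_sub (φ (q.1 - y, q.2)) (φ q)
    linarith
  · rw [hφ0 (q.1 - y, q.2) fun hmem => hq (hK (Metric.mem_cthickening_of_dist_le _ _ _ _ hmem (by
      rw [dist_comm, hdist]; exact hy.trans (hε.trans (min_le_left _ _))))), abs_zero,
      indicator_of_notMem hq, add_zero]
    exact abs_nonneg _

/-- The pointwise estimate behind the kernel selection. Each gauge of N is compared with `‖N‖` times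
the gauge of M. The main part is paid by κ, since the weights `c i` charge only kernels good for M;
the margin w is paid with the crude bound `∫ ‖gradTens (ρ i) z‖`; and the Lipschitz error is
controlled by the defect. -/
lemma sum_weight_mul_gauge_le {ι : Type} [Fintype ι] {ρ : ι → Space d → ℝ}
    (hρ : ∀ i, IsKernel (ρ i)) {c : ι → ℝ} (hc : ∀ i, 0 ≤ c i) {κ a Φ w l : ℝ} {M : Mat d}
    (hM : ‖M‖ ≤ 1) (hc1 : ∑ i, c i = 1) (hcκ : ∀ i, c i * gauge (ρ i) M ≤ c i * κ)
    (ha : 0 ≤ a) (haΦ : a ≤ Φ) (hw : 0 ≤ w) (hl : 0 < l) (N : Mat d) :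
    ∑ i, (a * c i + w) * gauge (ρ i) N ≤
      (Φ * κ + w * ∑ i, ∫ z, ‖gradTens (ρ i) z‖) * ‖N‖ +
      (Φ + w) * (∑ i, ∫ z, ‖gradTens (ρ i) z‖) * (l * ‖N‖ + (‖N‖ - inner ℝ M N) / (2 * l)) := by
  set Γ : ι → ℝ := fun i => ∫ z, ‖gradTens (ρ i) z‖ with hΓ
  have hΓ0 : ∀ i, 0 ≤ Γ i := fun i => integral_nonneg fun _ => norm_nonneg _
  have hc1' : ∀ i, c i ≤ 1 := fun i => by
    rw [← hc1]; exact Finset.single_le_sum (fun j _ => hc j) (Finset.mem_univ i)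
  have hgM : ∀ i, gauge (ρ i) M ≤ Γ i := fun i => by
    have := (hρ i).gauge_le_add M 0
    have h0 : gauge (ρ i) (0 : Mat d) = 0 := by simp [gauge]
    rw [h0, zero_add, sub_zero] at this
    exact this.trans (mul_le_of_le_one_right (hΓ0 i) hM)
  have hD := norm_sub_norm_smul_le N M hM hl
  set D := l * ‖N‖ + (‖N‖ - inner ℝ M N) / (2 * l)
  have hD0 : 0 ≤ D := (norm_nonneg _).trans hD
  have step : ∀ i, (a * c i + w) * gauge (ρ i) N ≤
      (Φ * (c i * κ) + w * Γ i) * ‖N‖ + (Φ + w) * Γ i * D := by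
    intro i
    have hwt : 0 ≤ a * c i + w := add_nonneg (mul_nonneg ha (hc i)) hw
    have hwtΦ : a * c i + w ≤ Φ + w := by
      have := mul_le_mul haΦ (hc1' i) (hc i) (ha.trans haΦ)
      linarith
    have hg : gauge (ρ i) N ≤ ‖N‖ * gauge (ρ i) M + Γ i * D :=
      ((hρ i).gauge_le N M).trans (by gcongr)
    calc _ ≤ (a * c i + w) * (‖N‖ * gauge (ρ i) M + Γ i * D) := by gcongr
      _ = (a * (c i * gauge (ρ i) M) + w * gauge (ρ i) M) * ‖N‖ + (a * c i + w) * (Γ i * D) := by ring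
      _ ≤ (Φ * (c i * κ) + w * Γ i) * ‖N‖ + (Φ + w) * (Γ i * D) := by
          have hh : 0 ≤ Γ i * D := mul_nonneg (hΓ0 i) hD0
          have h1 : a * (c i * gauge (ρ i) M) ≤ Φ * (c i * κ) :=
            mul_le_mul haΦ (hcκ i) (mul_nonneg (hc i) (gauge_nonneg _ _)) (ha.trans haΦ)
          have h2 : w * gauge (ρ i) M ≤ w * Γ i := mul_le_mul_of_nonneg_left (hgM i) hw
          have h3 : (a * c i + w) * (Γ i * D) ≤ (Φ + w) * (Γ i * D) :=
            mul_le_mul_of_nonneg_right hwtΦ hh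
          have h4 := mul_le_mul_of_nonneg_right (add_le_add h1 h2) (norm_nonneg N)
          linarith
      _ = _ := by ring
  refine (Finset.sum_le_sum fun i _ => step i).trans (le_of_eq ?_)
  rw [Finset.sum_add_distrib, ← Finset.sum_mul, ← Finset.sum_mul, ← Finset.mul_sum,
    Finset.sum_add_distrib, ← Finset.mul_sum, ← Finset.mul_sum, ← Finset.sum_mul, hc1, one_mul]

/-- Quantitative smallness of the localized Duchon–Robert approximations. -/
lemma abs_sum_integral_approx_le (hum : StronglyMeasurable u) (hui : Integrable u)
    (hC : ∀ p, ‖u p‖ ≤ C) {U : Set (SpaceTime d)} (hU : IsOpen U) {V : ℝ}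
    (hV : VariationBound U u V)
    {ι : Type} [Fintype ι] {ρ : ι → Space d → ℝ} (hρ : ∀ i, IsKernel (ρ i)) {κ : ℝ} (hκ : 0 ≤ κ)
    {K : Set (SpaceTime d)} (hK : IsCompact K) (hKU : K ⊆ U)
    {ψ : SpaceTime d → Mat d} (hψ : IsMatTest U ψ) (hψK : tsupport ψ ⊆ K) (hψ1 : ∀ p, ‖ψ p‖ ≤ 1)
    {c : ι → SpaceTime d → ℝ} (hcc : ∀ i, Continuous (c i)) (hc : ∀ i p, 0 ≤ c i p)
    (hc1 : ∀ p, ∑ i, c i p = 1) (hcκ : ∀ i p, c i p * gauge (ρ i) (ψ p) ≤ c i p * κ)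
    {η : ℝ} (hη : 0 < η) (hψV : V - η < -divPairing u ψ)
    {φ : SpaceTime d → ℝ} (hφ : Continuous φ) (hφK : ∀ q, q ∉ K → φ q = 0) {Φ : ℝ}
    (hφΦ : ∀ q, |φ q| ≤ Φ) {w l : ℝ} (hw : 0 ≤ w) (hl : 0 < l) {ε : ι → ℝ} (hε : ∀ i, 0 < ε i)
    (hshift : ∀ i (q : SpaceTime d) (y : Space d), ‖y‖ ≤ ε i →
      |φ (q.1 - y, q.2) * c i (q.1 - y, q.2)| ≤ |φ q * c i q| + K.indicator (fun _ => w) q) :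
    |∑ i, ∫ q, approx (ρ i) u (ε i) q * (φ q * c i q)| ≤
      C ^ 2 * ((Φ * κ + w * ∑ i, ∫ z, ‖gradTens (ρ i) z‖) * V +
        (Φ + w) * (∑ i, ∫ z, ‖gradTens (ρ i) z‖) * (l * V + η / l)) := by
  have hΦ0 : 0 ≤ Φ := (abs_nonneg _).trans (hφΦ 0)
  have hΓ0 : 0 ≤ ∑ i, ∫ z, ‖gradTens (ρ i) z‖ :=
    Finset.sum_nonneg fun i _ => integral_nonneg fun _ => norm_nonneg _
  set Γ := ∑ i, ∫ z, ‖gradTens (ρ i) z‖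
  have hφc : ∀ i, HasCompactSupport fun q => φ q * c i q := fun i =>
    HasCompactSupport.intro hK fun q hq => by rw [hφK q hq, zero_mul]
  have hlim : Tendsto (fun n => |∑ i, 1 / (4 * ε i) *
      mixedFlux (ρ i) (ε i) (fun q => φ q * c i q) u (mollify n u)|) atTop
      (𝓝 |∑ i, ∫ q, approx (ρ i) u (ε i) q * (φ q * c i q)|) := by
    simp_rw [integral_approx_mul]
    exact (tendsto_finsetSum _ fun i _ => (tendsto_mixedFlux_mollify (hρ i) (hε i).ne' hum hui hC
      (hφ.mul (hcc i)) (hφc i)).const_mul _).abs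
  refine le_of_tendsto hlim ?_
  -- Both bounds hold for all large n with right-hand sides free of n, so they survive the removal
  -- of the mollification.
  filter_upwards [eventually_setIntegral_norm_gradMat_le hum hui hU hV hK hKU,
    eventually_setIntegral_defect_le hum hui hU hV hK hKU hψ hψK hη] with n h1 h2
  set N := gradMat (mollify n u) with hN
  have hNc : Continuous N := continuous_gradMat (contDiff_mollify n hui.locallyIntegrable)
  let f : ι → SpaceTime d → ℝ := fun i q => |φ q * c i q| + K.indicator (fun _ => w) q
  have hfm : ∀ i, Measurable (f i) := fun i =>
    (hφ.mul (hcc i)).abs.measurable.add (measurable_const.indicator hK.measurableSet)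
  have hf0 : ∀ i q, 0 ≤ f i q := fun i q =>
    add_nonneg (abs_nonneg _) (indicator_nonneg (fun _ _ => hw) _)
  have hfK : ∀ i, (fun q => f i q * gauge (ρ i) (N q)) =
      K.indicator fun q => (|φ q| * c i q + w) * gauge (ρ i) (N q) := by
    intro i
    funext q
    by_cases hq : q ∈ K
    · simp only [f, indicator_of_mem hq, abs_mul, abs_of_nonneg (hc i q)]
    · simp [f, indicator_of_notMem hq, hφK q hq]
  have hgc : ∀ i, Continuous fun q => gauge (ρ i) (N q) := fun i =>
    (hρ i).continuous_gauge.comp hNc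
  have hgi : ∀ i, IntegrableOn (fun q => (|φ q| * c i q + w) * gauge (ρ i) (N q)) K := fun i =>
    ((((hφ.abs.mul (hcc i)).add continuous_const).mul (hgc i)).continuousOn).integrableOn_compact hK
  have hfi : ∀ i, Integrable fun q => f i q * gauge (ρ i) (N q) := fun i => by
    rw [hfK]
    exact (integrable_indicator_iff hK.measurableSet).2 (hgi i)
  have hterm : ∀ i, |1 / (4 * ε i) * mixedFlux (ρ i) (ε i) (fun q => φ q * c i q) u (mollify n u)| ≤
      C ^ 2 * ∫ q in K, (|φ q| * c i q + w) * gauge (ρ i) (N q) := by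
    intro i
    have := norm_mixedFlux_le (φ := fun q => φ q * c i q) (hρ i)
      (contDiff_mollify n hui.locallyIntegrable) hC (hε i)
      (hφ.mul (hcc i)) (hfm i) (hf0 i) (hshift i) (hfi i)
    rw [← hN, hfK, integral_indicator hK.measurableSet, Real.norm_eq_abs] at this
    have hp := hε i
    rw [abs_mul, abs_of_pos (by positivity)]
    -- The factor `ε · 4 C²` in the flux bound meets the prefactor `1 / (4 ε)` and leaves `C²`,
    -- uniformly in the scale.
    refine (mul_le_mul_of_nonneg_left this (by positivity)).trans (le_of_eq ?_)
    field_simp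
  have hNi : IntegrableOn (fun q => ‖N q‖) K := hNc.norm.continuousOn.integrableOn_compact hK
  have hDi : IntegrableOn (fun q => ‖N q‖ - inner ℝ (ψ q) (N q)) K :=
    (hNc.norm.sub (hψ.smooth.continuous.inner hNc)).continuousOn.integrableOn_compact hK
  have hEi : IntegrableOn
      (fun q => l * ‖N q‖ + (‖N q‖ - inner ℝ (ψ q) (N q)) / (2 * l)) K :=
    (hNi.const_mul _).add (hDi.div_const _)
  calc |∑ i, 1 / (4 * ε i) * mixedFlux (ρ i) (ε i) (fun q => φ q * c i q) u (mollify n u)|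
      ≤ ∑ i, C ^ 2 * ∫ q in K, (|φ q| * c i q + w) * gauge (ρ i) (N q) :=
        (Finset.abs_sum_le_sum_abs _ _).trans (Finset.sum_le_sum fun i _ => hterm i)
    _ = C ^ 2 * ∫ q in K, ∑ i, (|φ q| * c i q + w) * gauge (ρ i) (N q) := by
        rw [← Finset.mul_sum, integral_finsetSum _ fun i _ => hgi i]
    _ ≤ C ^ 2 * ∫ q in K, ((Φ * κ + w * Γ) * ‖N q‖ + (Φ + w) * Γ *
          (l * ‖N q‖ + (‖N q‖ - inner ℝ (ψ q) (N q)) / (2 * l))) := by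
        refine mul_le_mul_of_nonneg_left ?_ (sq_nonneg C)
        refine integral_mono (integrable_finsetSum _ fun i _ => hgi i)
          ((hNi.const_mul _).add (hEi.const_mul _)) fun q => ?_
        exact sum_weight_mul_gauge_le hρ (fun i => hc i q) (hψ1 q) (hc1 q) (fun i => hcκ i q)
          (abs_nonneg _) (hφΦ q) hw hl (N q)
    _ = C ^ 2 * ((Φ * κ + w * Γ) * (∫ q in K, ‖N q‖) + (Φ + w) * Γ *
          (l * (∫ q in K, ‖N q‖) + (∫ q in K, (‖N q‖ - inner ℝ (ψ q) (N q))) / (2 * l))) := by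
        rw [integral_add (hNi.const_mul _) (hEi.const_mul _),
          integral_const_mul, integral_const_mul, integral_add (hNi.const_mul _) (hDi.div_const _),
          integral_const_mul, integral_div]
    _ ≤ _ := by
        -- Near-optimality of ψ contributes one η to the defect and the convergence of the pairing
        -- another, so the defect is below `2 η`.
        have h3 : (∫ q in K, (‖N q‖ - inner ℝ (ψ q) (N q))) / (2 * l) ≤ η / l := by
          rw [div_le_div_iff₀ (by positivity) hl]
          nlinarith
        gcongr

/-- A functional which is a limit of the Duchon–Robert approximations independently of the kernel
vanishes, when the velocity is bounded, divergence free and of bounded variation in space. -/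
theorem functional_eq_zero (hum : StronglyMeasurable u) (hui : Integrable u)
    (hC : ∀ p, ‖u p‖ ≤ C) {U : Set (SpaceTime d)} (hU : IsOpen U)
    (hdiv : ∀ θ, IsTestFunction U θ → ∫ p, inner ℝ (u p) (gradX θ p) = 0)
    {V : ℝ} (hV : VariationBound U u V) (L : (SpaceTime d → ℝ) → ℝ)
    (hsum : ∀ (ι : Type) [Fintype ι] (φ : ι → SpaceTime d → ℝ), (∀ i, IsTestFunction U (φ i)) →
      L (fun p => ∑ i, φ i p) = ∑ i, L (φ i))
    (hL : ∀ ρ, IsKernel ρ → ∃ ε : ℕ → ℝ, (∀ n, 0 < ε n) ∧ Tendsto ε atTop (𝓝 0) ∧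
      ∀ φ, IsTestFunction U φ →
        Tendsto (fun n => ∫ q, approx ρ u (ε n) q * φ q) atTop (𝓝 (L φ)))
    {φ : SpaceTime d → ℝ} (hφ : IsTestFunction U φ) : L φ = 0 := by
  obtain ⟨V, hV0, hV, hsup⟩ := exists_variation_sup hV
  obtain ⟨Φ, hΦ⟩ := hφ.smooth.continuous.bounded_above_of_compact_support hφ.compact
  have hΦ0 : 0 ≤ Φ := (norm_nonneg _).trans (hΦ 0)
  suffices h : ∀ κ > 0, |L φ| ≤ C ^ 2 * (Φ * κ * V) by
    have h1 : Tendsto (fun κ : ℝ => C ^ 2 * (Φ * κ * V)) (𝓝[>] 0) (𝓝 (C ^ 2 * (Φ * 0 * V))) :=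
      ((continuous_const.mul ((continuous_const.mul continuous_id).mul continuous_const)).tendsto
        0).mono_left nhdsWithin_le_nhds
    have h2 := ge_of_tendsto h1 (eventually_nhdsWithin_of_forall fun κ hκ => h κ hκ)
    simpa using h2
  intro κ hκ
  obtain ⟨ι, _, ρ, χ, hρ, hχ, hχ0, hχS⟩ := exists_kernel_partition d hκ
  set Γ := ∑ i, ∫ z, ‖gradTens (ρ i) z‖
  -- A single parameter l serves as the uniform continuity margin, as the weight in
  -- `norm_sub_norm_smul_le`, and through `η = l ^ 2` as the accuracy of ψ. The order of limits
  -- matters: the kernels, hence Γ, depend on κ, so l tends to 0 first and κ afterwards.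
  suffices h : ∀ l > 0, |L φ| ≤ C ^ 2 * ((Φ * κ + l * Γ) * V + (Φ + l) * Γ * (l * V + l ^ 2 / l)) by
    have h1 : Tendsto (fun l : ℝ => C ^ 2 * ((Φ * κ + l * Γ) * V + (Φ + l) * Γ * (l * V + l)))
        (𝓝[>] 0) (𝓝 (C ^ 2 * ((Φ * κ + 0 * Γ) * V + (Φ + 0) * Γ * (0 * V + 0)))) :=
      (Continuous.tendsto (by fun_prop) 0).mono_left nhdsWithin_le_nhds
    have h2 := ge_of_tendsto h1 (b := |L φ|) (eventually_nhdsWithin_of_forall fun l hl => by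
      have hl' : (0 : ℝ) < l := hl
      have := h l hl
      rwa [show l ^ 2 / l = l by field_simp] at this)
    simpa using h2
  intro l hl
  obtain ⟨ψ', hψ', hψ'1, hψ'V⟩ := hsup (l ^ 2) (by positivity)
  -- Now trace-free and still near-optimal, so the kernels of the partition apply to its values.
  set ψ : SpaceTime d → Mat d := fun p => devMat (ψ' p) with hψdef
  have hψ : IsMatTest U ψ := hψ'.devMat
  have hψ1 : ∀ p, ‖ψ p‖ ≤ 1 := fun p => (norm_devMat_le _).trans (hψ'1 p)
  have hψV : V - l ^ 2 < -divPairing u ψ := by rwa [hψdef, divPairing_devMat hum hui hdiv hψ']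
  have hS := fun p => hχS (ψ p) (hψ1 p) (matTrace_devMat _)
  obtain ⟨δ, hδ, hδU⟩ := IsCompact.exists_cthickening_subset_open hφ.compact hU hφ.subset
  set K := Metric.cthickening δ (tsupport φ) ∪ tsupport ψ
  have hK : IsCompact K := (IsCompact.cthickening hφ.compact).union hψ.compact
  have hKU : K ⊆ U := union_subset hδU hψ.subset
  have hcs : ∀ i, ContDiff ℝ ∞ fun p => χ i (ψ p) := fun i => (hχ i).comp hψ.smooth
  have hsub : ∀ i, Function.support (fun q => φ q * χ i (ψ q)) ⊆ Function.support φ := fun i =>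
    Function.support_mul_subset_left _ _
  have hφi : ∀ i, IsTestFunction U fun q => φ q * χ i (ψ q) := fun i =>
    ⟨hφ.smooth.mul (hcs i), hφ.compact.mono (hsub i), (closure_mono (hsub i)).trans hφ.subset⟩
  choose ε hε0 hε hεL using fun i => hL (ρ i) (hρ i)
  choose r hr hrs using fun i => exists_shift_bound (φ := fun q => φ q * χ i (ψ q))
    (hφi i).smooth.continuous (K₀ := tsupport φ) (fun q hq => by
      rw [image_eq_zero_of_notMem_tsupport hq, zero_mul]) hφ.compact hδ
      (show Metric.cthickening δ (tsupport φ) ⊆ K from subset_union_left) hl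
  -- Independence of the kernel enters here: the same L is evaluated on every piece, but each piece
  -- is approximated with its own kernel and its own sequence of scales.
  have hφL : L φ = ∑ i, L fun q => φ q * χ i (ψ q) := by
    rw [← hsum ι _ hφi]
    congr 1
    funext p
    rw [← Finset.mul_sum, (hS p).1, mul_one]
  have hlim : Tendsto (fun n => |∑ i, ∫ q, approx (ρ i) u (ε i n) q * (φ q * χ i (ψ q))|) atTop
      (𝓝 |L φ|) := by
    rw [hφL]
    exact (tendsto_finsetSum _ fun i _ => hεL i _ (hφi i)).abs
  refine le_of_tendsto hlim ?_
  have hev : ∀ᶠ n in atTop, ∀ i, ε i n < r i :=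
    eventually_all.2 fun i => (hε i).eventually (gt_mem_nhds (hr i))
  filter_upwards [hev] with n hn
  exact abs_sum_integral_approx_le hum hui hC hU hV hρ hκ.le hK hKU hψ subset_union_right hψ1
    (fun i => (hcs i).continuous) (fun i p => hχ0 i _) (fun p => (hS p).1) (fun i p => (hS p).2 i)
    (by positivity) hψV hφ.smooth.continuous
    (fun q hq => image_eq_zero_of_notMem_tsupport fun h =>
      hq (Or.inl (Metric.self_subset_cthickening _ h)))
    hΦ hl.le hl (fun i => hε0 i n) (fun i => hrs i _ (hn i).le)

end Localization

-- From BV time slices to a variation bound on space-time.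

lemma IsTestFunction.slice {O : Set (Space d)} {I : Set ℝ} {φ : SpaceTime d → ℝ}
    (hφ : IsTestFunction (O ×ˢ I) φ) (t : ℝ) : IsTestFunction O fun x => φ (x, t) := by
  have hK : IsCompact (Prod.fst '' tsupport φ) := IsCompact.image hφ.compact continuous_fst
  have hs : Function.support (fun x => φ (x, t)) ⊆ Prod.fst '' tsupport φ := fun x hx =>
    ⟨(x, t), subset_tsupport φ hx, rfl⟩
  refine ⟨hφ.smooth.comp (contDiff_id.prodMk contDiff_const),
    HasCompactSupport.of_support_subset_isCompact hK hs,
    (closure_minimal hs hK.isClosed).trans ?_⟩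
  rintro _ ⟨p, hp, rfl⟩
  exact (hφ.subset hp).1

lemma fderiv_mat_apply {Ψ : SpaceTime d → Mat d} (hΨ : Differentiable ℝ Ψ) (p v : SpaceTime d)
    (ij : Fin d × Fin d) : fderiv ℝ Ψ p v ij = fderiv ℝ (fun q => Ψ q ij) p v := by
  have h := (EuclideanSpace.proj ij : Mat d →L[ℝ] ℝ).hasFDerivAt.comp p
    (hΨ p).hasFDerivAt
  have h2 : fderiv ℝ (fun q => Ψ q ij) p = _ := h.fderiv
  rw [h2]
  rfl

lemma inner_tens_single (v : Space d) (j : Fin d) (M : Mat d) :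
    inner ℝ (tens v (EuclideanSpace.single j 1)) M = ∑ i, v i * M (i, j) := by
  rw [inner_tens, inner_space]
  refine Finset.sum_congr rfl fun i _ => ?_
  rw [matCLM_apply]
  simp

lemma IsMatTest.apply {U : Set (SpaceTime d)} {Ψ : SpaceTime d → Mat d} (hΨ : IsMatTest U Ψ)
    (ij : Fin d × Fin d) : IsTestFunction U fun p => Ψ p ij := by
  have hs : Function.support (fun p => Ψ p ij) ⊆ Function.support Ψ := fun p hp h =>
    hp (by simp [h])
  exact ⟨(EuclideanSpace.proj ij : Mat d →L[ℝ] ℝ).contDiff.comp hΨ.smooth,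
    hΨ.compact.mono hs, (closure_mono hs).trans hΨ.subset⟩

lemma enorm_vectorIntegral_le {O : Set (Space d)} (hO : MeasurableSet O)
    (μ : VectorMeasure (Space d) (Mat d)) {f : Space d → ℝ} (hf : ∀ x, ‖f x‖ ≤ 1)
    (hf0 : ∀ x, x ∉ O → f x = 0) (ij : Fin d × Fin d) :
    ‖(∫ᵛ x, f x ∂•μ) ij‖ₑ ≤
      ‖(ContinuousLinearMap.lsmul ℝ ℝ : ℝ →L[ℝ] Mat d →L[ℝ] Mat d)‖ₑ * μ.variation O := by
  have h1 : ‖(∫ᵛ x, f x ∂•μ) ij‖ₑ ≤ ‖∫ᵛ x, f x ∂•μ‖ₑ := by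
    rw [enorm_le_iff_norm_le]
    exact PiLp.norm_apply_le _ _
  refine h1.trans (VectorMeasure.enorm_integral_le_lintegral_enorm.trans ?_)
  gcongr
  rw [← lintegral_indicator_one hO]
  refine lintegral_mono fun x => ?_
  by_cases hx : x ∈ O
  · rw [indicator_of_mem hx, Pi.one_apply, ← enorm_one (G := ℝ), enorm_le_iff_norm_le]
    simpa using hf x
  · simp [hf0 x hx]

/-- By Fubini the pairing is a time integral of slice pairings. On almost every slice each matrix
entry is integrated by parts against the gradient measure and bounded by its variation, whose time
integral is finite. -/
lemma variationBound_of_memLOneBV {O : Set (Space d)} {I : Set ℝ} (hO : IsOpen O) (hI : IsOpen I)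
    {u v : SpaceTime d → Space d} (hu : MemLOneBV O I u) (hvm : StronglyMeasurable v)
    (hvi : Integrable v) (hvu : ∀ᵐ p ∂volume.restrict (O ×ˢ I), v p = u p) :
    ∃ V, VariationBound (O ×ˢ I) v V := by
  obtain ⟨-, Du, hDu, hfin⟩ := hu
  set c := ‖(ContinuousLinearMap.lsmul ℝ ℝ : ℝ →L[ℝ] Mat d →L[ℝ] Mat d)‖ₑ
  -- A crude dimensional constant from estimating entry by entry; only finiteness of the bound
  -- matters, since it is later replaced by the supremum.
  set c' : ENNReal := ∑ _j : Fin d, ∑ _i : Fin d, c with hc'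
  have hc'top : c' ≠ ⊤ := by simp [hc', c, ENNReal.mul_eq_top]
  refine ⟨(c' * ∫⁻ t in I, (Du t).variation O).toReal, fun Ψ hΨ hΨ1 => ?_⟩
  have hzero : ∀ p, p ∉ O ×ˢ I → ∀ j, fderiv ℝ Ψ p (spaceUnit j) = 0 := fun p hp j => by
    have : fderiv ℝ Ψ p = 0 := by
      by_contra h
      exact hp (hΨ.subset (support_fderiv_subset ℝ h))
    rw [this]; rfl
  have hae : ∀ᵐ t ∂volume.restrict I, ∀ᵐ x ∂volume.restrict O, v (x, t) = u (x, t) := by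
    rw [Measure.volume_eq_prod, ← Measure.prod_restrict] at hvu
    have h1 : ∀ᵐ r ∂((volume.restrict I).prod (volume.restrict O)), v (r.2, r.1) = u (r.2, r.1) :=
      (Measure.measurePreserving_swap (μ := volume.restrict I)
        (ν := volume.restrict O)).quasiMeasurePreserving.ae hvu
    exact Measure.ae_ae_of_ae_prod h1
  set F : SpaceTime d → ℝ := fun p => ∑ j, inner ℝ (tens (v p) (EuclideanSpace.single j 1))
      (fderiv ℝ Ψ p (spaceUnit j)) with hF
  have hF0 : ∀ p, p ∉ O ×ˢ I → F p = 0 := fun p hp => by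
    simp [hF, hzero p hp]
  have hFi : Integrable F := integrable_divPairing hvm hvi hΨ.smooth hΨ.compact
  have hslice : ∀ᵐ t ∂volume.restrict I, ‖∫ x, F (x, t)‖ₑ ≤ c' * (Du t).variation O := by
    filter_upwards [hae, hDu] with t h1 h2
    obtain ⟨hint, -, hparts⟩ := h2
    have e : ∫ x, F (x, t) = ∑ j, ∑ i, -((∫ᵛ x, Ψ (x, t) (i, j) ∂•(Du t)) (i, j)) := by
      have e1 : ∫ x, F (x, t) = ∫ x in O, F (x, t) :=
        (setIntegral_eq_integral_of_forall_compl_eq_zero fun x hx =>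
          hF0 (x, t) fun h => hx h.1).symm
      have hd : ∀ (i j : Fin d) (x : Space d), fderiv ℝ Ψ (x, t) (spaceUnit j) (i, j) =
          gradient (fun y => Ψ (y, t) (i, j)) x j := by
        intro i j x
        rw [fderiv_mat_apply (hΨ.smooth.differentiable (by simp)),
          ← gradX_apply ((hΨ.apply (i, j)).smooth.differentiable (by simp) _)]
        rfl
      have e2 : ∫ x in O, F (x, t) = ∫ x in O, ∑ j, ∑ i,
          u (x, t) i * gradient (fun y => Ψ (y, t) (i, j)) x j := by
        refine integral_congr_ae ?_
        filter_upwards [h1] with x hx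
        simp only [hF, inner_tens_single, hx, hd]
      have hi : ∀ i j : Fin d, IntegrableOn
          (fun x => u (x, t) i * gradient (fun y => Ψ (y, t) (i, j)) x j) O := by
        intro i j
        have hc : Continuous fun x : Space d => fderiv ℝ Ψ (x, t) (spaceUnit j) :=
          ((hΨ.smooth.continuous_fderiv (by simp)).comp
            (continuous_id.prodMk continuous_const)).clm_apply continuous_const
        obtain ⟨C, hC⟩ := ((hΨ.smooth.continuous_fderiv (by simp)).clm_apply
          continuous_const).bounded_above_of_compact_support
          (hΨ.compact.fderiv_apply (𝕜 := ℝ) (spaceUnit j))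
        have hui : IntegrableOn (fun x => u (x, t) i) O :=
          (EuclideanSpace.proj i : Space d →L[ℝ] ℝ).integrable_comp hint
        simp_rw [← hd]
        refine hui.mul_bdd (c := C) ?_ (ae_of_all _ fun x => ?_)
        · exact Continuous.aestronglyMeasurable (by fun_prop)
        · exact (PiLp.norm_apply_le _ _).trans (hC (x, t))
      rw [e1, e2, integral_finsetSum _ fun j _ => integrable_finsetSum _ fun i _ => hi i j]
      refine Finset.sum_congr rfl fun j _ => ?_
      rw [integral_finsetSum _ fun i _ => hi i j]
      exact Finset.sum_congr rfl fun i _ => hparts _ ((hΨ.apply (i, j)).slice t) i j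
    rw [e, hc', Finset.sum_mul]
    refine (enorm_sum_le _ _).trans (Finset.sum_le_sum fun j _ => ?_)
    rw [Finset.sum_mul]
    refine (enorm_sum_le _ _).trans (Finset.sum_le_sum fun i _ => ?_)
    rw [enorm_neg]
    refine enorm_vectorIntegral_le hO.measurableSet (Du t)
      (fun x => (PiLp.norm_apply_le _ _).trans (hΨ1 (x, t))) (fun x hx => ?_) (i, j)
    exact image_eq_zero_of_notMem_tsupport (f := fun y => Ψ (y, t) (i, j)) fun h =>
      hx (((hΨ.apply (i, j)).slice t).subset h)
  have hmain : ‖divPairing v Ψ‖ₑ ≤ c' * ∫⁻ t in I, (Du t).variation O := by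
    have e : divPairing v Ψ = ∫ t, ∫ x, F (x, t) := by
      rw [divPairing, Measure.volume_eq_prod]
      exact integral_prod_symm F hFi
    -- Finiteness of the constant lets it pass through the integral without any measurability of the
    -- variation in time.
    rw [e, ← lintegral_const_mul' _ _ hc'top]
    refine (enorm_integral_le_lintegral_enorm _).trans ?_
    calc ∫⁻ t, ‖∫ x, F (x, t)‖ₑ ≤ ∫⁻ t, I.indicator (fun t => ‖∫ x, F (x, t)‖ₑ) t := by
          refine lintegral_mono fun t => ?_
          by_cases ht : t ∈ I
          · simp [indicator_of_mem ht]
          · have : ∀ x, F (x, t) = 0 := fun x => hF0 (x, t) fun h => ht h.2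
            simp [this]
      _ = ∫⁻ t in I, ‖∫ x, F (x, t)‖ₑ := lintegral_indicator hI.measurableSet _
      _ ≤ _ := lintegral_mono_ae hslice
  calc -divPairing v Ψ ≤ ‖divPairing v Ψ‖ := neg_le_abs _
    _ = (‖divPairing v Ψ‖ₑ).toReal := (toReal_enorm _).symm
    _ ≤ _ := ENNReal.toReal_mono (ENNReal.mul_ne_top hc'top hfin.ne) hmain

-- Replacing the velocity by a bounded, globally defined representative.

/-- A measurable representative is set to zero outside S and wherever it exceeds the essential
supremum, which changes it on S only on a null set. The bounds then hold everywhere, as the later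
estimates require. -/
lemma exists_bounded_representative {S : Set (SpaceTime d)} (hS : MeasurableSet S)
    (hSfin : volume S ≠ ⊤) {u : SpaceTime d → Space d} (hu : MemLp u ⊤ (volume.restrict S)) :
    ∃ (v : SpaceTime d → Space d) (C : ℝ), StronglyMeasurable v ∧ Integrable v ∧
      (∀ p, ‖v p‖ ≤ C) ∧ (∀ᵐ p ∂volume.restrict S, v p = u p) ∧ ∀ p, p ∉ S → v p = 0 := by
  obtain ⟨hm, hb⟩ := hu
  set C := (eLpNorm u ⊤ (volume.restrict S)).toReal with hC
  set w := hm.mk u with hw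
  have hwm : StronglyMeasurable w := hm.stronglyMeasurable_mk
  have hwu : u =ᵐ[volume.restrict S] w := hm.ae_eq_mk
  have hA : MeasurableSet (S ∩ {p | ‖w p‖ ≤ C}) :=
    hS.inter (measurableSet_le hwm.norm.measurable measurable_const)
  have hbd : ∀ p, ‖(S ∩ {p | ‖w p‖ ≤ C}).indicator w p‖ ≤ C := by
    intro p
    by_cases hp : p ∈ S ∩ {p | ‖w p‖ ≤ C}
    · rw [indicator_of_mem hp]; exact hp.2
    · rw [indicator_of_notMem hp, norm_zero]; exact ENNReal.toReal_nonneg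
  have h0 : ∀ p, p ∉ S → (S ∩ {p | ‖w p‖ ≤ C}).indicator w p = 0 := fun p hp =>
    indicator_of_notMem (fun h => hp h.1) _
  refine ⟨(S ∩ {p | ‖w p‖ ≤ C}).indicator w, C, hwm.indicator hA, ?_, hbd, ?_, h0⟩
  · have h1 : IntegrableOn ((S ∩ {p | ‖w p‖ ≤ C}).indicator w) S :=
      Measure.integrableOn_of_bounded (M := C) hSfin (hwm.indicator hA).aestronglyMeasurable
        (ae_of_all _ hbd)
    exact h1.integrable_of_forall_notMem_eq_zero h0
  · have hle : ∀ᵐ p ∂volume.restrict S, ‖u p‖ₑ ≤ eLpNorm u ⊤ (volume.restrict S) := by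
      rw [eLpNorm_exponent_top]; exact ae_le_eLpNormEssSup
    filter_upwards [hwu, hle, ae_restrict_mem hS] with p h1 h2 h3
    rw [indicator_of_mem, ← h1]
    refine ⟨h3, ?_⟩
    simp only [mem_ofPred_eq, ← h1, hC]
    rw [← toReal_enorm]
    exact ENNReal.toReal_mono hb.ne h2

lemma setIntegral_eq_integral_of_ae_eq {S U : Set (SpaceTime d)}
    (hU : MeasurableSet U) (hSU : S ⊆ U) {g h : SpaceTime d → ℝ}
    (hgh : ∀ᵐ p ∂volume.restrict S, g p = h p) (hg : ∀ p, p ∉ S → g p = 0)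
    (hh : ∀ p, p ∉ S → h p = 0) : ∫ p in U, g p = ∫ p, h p := by
  rw [setIntegral_eq_of_subset_of_forall_sdiff_eq_zero hU hSU fun p hp => hg p hp.2,
    integral_congr_ae hgh, setIntegral_eq_integral_of_forall_compl_eq_zero hh]

lemma IsTestFunction.fderiv_eq_zero {S : Set (SpaceTime d)} {φ : SpaceTime d → ℝ}
    (hφ : IsTestFunction S φ) {p : SpaceTime d} (hp : p ∉ S) : fderiv ℝ φ p = 0 := by
  by_contra h
  exact hp (hφ.subset (support_fderiv_subset ℝ h))

lemma IsTestFunction.gradX_eq_zero {S : Set (SpaceTime d)} {φ : SpaceTime d → ℝ}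
    (hφ : IsTestFunction S φ) {p : SpaceTime d} (hp : p ∉ S) : gradX φ p = 0 := by
  refine ext_inner_right ℝ fun v => ?_
  rw [inner_gradX (hφ.smooth.differentiable (by simp) p), hφ.fderiv_eq_zero hp]
  simp

lemma IsTestFunction.derivT_eq_zero {S : Set (SpaceTime d)} {φ : SpaceTime d → ℝ}
    (hφ : IsTestFunction S φ) {p : SpaceTime d} (hp : p ∉ S) : derivT φ p = 0 := by
  rw [derivT_eq (hφ.smooth.differentiable (by simp) p), hφ.fderiv_eq_zero hp]
  simp

lemma IsTestFunction.eq_zero {X : Type*} [NormedAddCommGroup X] [NormedSpace ℝ X] {S : Set X}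
    {φ : X → ℝ} (hφ : IsTestFunction S φ) {p : X} (hp : p ∉ S) : φ p = 0 :=
  image_eq_zero_of_notMem_tsupport fun h => hp (hφ.subset h)

lemma IsTestFunction.mono {X : Type*} [NormedAddCommGroup X] [NormedSpace ℝ X] {S U : Set X}
    {φ : X → ℝ} (hφ : IsTestFunction S φ) (h : S ⊆ U) : IsTestFunction U φ :=
  ⟨hφ.smooth, hφ.compact, hφ.subset.trans h⟩

/-- The approximations, tested against a function supported in `S`, only see the values of the
velocity on `S` up to null sets, when the scale is small. -/
lemma exists_setIntegral_approx_eq {S U : Set (SpaceTime d)} (hS : IsOpen S)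
    (hU : MeasurableSet U) (hSU : S ⊆ U) {u v : SpaceTime d → Space d}
    (hvu : ∀ᵐ p ∂volume.restrict S, v p = u p) {φ : SpaceTime d → ℝ} (hφ : IsTestFunction S φ) :
    ∃ δ > 0, ∀ ε, 0 < ε → ε ≤ δ → ∀ ρ, IsKernel ρ →
      ∫ p in U, approx ρ u ε p * φ p = ∫ p, approx ρ v ε p * φ p := by
  obtain ⟨δ, hδ, hδS⟩ := IsCompact.exists_cthickening_subset_open hφ.compact hS hφ.subset
  refine ⟨δ, hδ, fun ε hε hεδ ρ hρ => ?_⟩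
  have hP : ∀ᵐ p, p ∈ S → v p = u p := (ae_restrict_iff' hS.measurableSet).1 hvu
  refine setIntegral_eq_integral_of_ae_eq hU hSU (ae_restrict_of_ae ?_)
    (fun p hp => by rw [hφ.eq_zero hp, mul_zero]) (fun p hp => by rw [hφ.eq_zero hp, mul_zero])
  filter_upwards [hP, ae_ae_shift hP hε.ne'] with p h1 h2
  by_cases hp : p ∈ tsupport φ
  · congr 1
    unfold approx
    congr 1
    refine integral_congr_ae ?_
    filter_upwards [h2] with z hz
    by_cases hz1 : 1 ≤ ‖z‖
    · simp [hρ.gradient_eq_zero hz1]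
    · have hmem : (p.1 + ε • z, p.2) ∈ S := by
        refine hδS (Metric.mem_cthickening_of_dist_le _ p _ _ hp ?_)
        rw [dist_eq_norm, Prod.norm_def]
        simp only [Prod.fst_sub, Prod.snd_sub, add_sub_cancel_left, sub_self, norm_zero]
        rw [max_eq_left (norm_nonneg _), norm_smul, Real.norm_of_nonneg hε.le]
        nlinarith [norm_nonneg z]
      have e : increment u (ε • z) p = increment v (ε • z) p := by
        rw [increment, increment, hz hmem, h1 (hφ.subset hp)]
      rw [e]
  · rw [image_eq_zero_of_notMem_tsupport hp, mul_zero, mul_zero]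

-- Test functions determine a signed Radon measure.

section Measures

variable {E : Type*} [NormedAddCommGroup E] [NormedSpace ℝ E]

lemma IsTestFunction.integrable_measure {S : Set E} {φ : E → ℝ} (hφ : IsTestFunction S φ)
    [MeasurableSpace E] [BorelSpace E] {μ : Measure E}
    (hμ : ∀ K, IsCompact K → K ⊆ S → μ K < ⊤) : Integrable φ μ := by
  obtain ⟨C, hC⟩ := hφ.smooth.continuous.bounded_above_of_compact_support hφ.compact
  have h : IntegrableOn φ (tsupport φ) μ :=
    Measure.integrableOn_of_bounded (M := C) (hμ _ hφ.compact hφ.subset).ne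
      hφ.smooth.continuous.aestronglyMeasurable (ae_of_all _ hC)
  exact h.integrable_of_forall_notMem_eq_zero fun x hx => image_eq_zero_of_notMem_tsupport hx

lemma SignedRadonMeasure.pairing_sum {U S : Set E} [MeasurableSpace E] [BorelSpace E]
    (D : SignedRadonMeasure U) (hSU : S ⊆ U)
    {ι : Type} [Fintype ι] {φ : ι → E → ℝ} (hφ : ∀ i, IsTestFunction S (φ i)) :
    D.pairing (fun x => ∑ i, φ i x) = ∑ i, D.pairing (φ i) := by
  unfold pairing
  rw [integral_finsetSum _ fun i _ => ((hφ i).mono hSU).integrable_measure D.posPart_compact,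
    integral_finsetSum _ fun i _ => ((hφ i).mono hSU).integrable_measure D.negPart_compact,
    Finset.sum_sub_distrib]

variable [FiniteDimensional ℝ E]

lemma exists_smooth_cutoff {K : Set E} (hK : IsCompact K) {r : ℝ} (hr : 0 < r) :
    ∃ φ : E → ℝ, IsTestFunction (Metric.cthickening r K) φ ∧ (∀ x ∈ K, φ x = 1) ∧
      ∀ x, φ x ∈ Icc (0 : ℝ) 1 := by
  have hd : Disjoint (Metric.thickening r K)ᶜ K :=
    disjoint_left.2 fun x hx hxK => hx (Metric.self_subset_thickening hr K hxK)
  obtain ⟨f, hf0, hf1, hf⟩ := exists_contMDiffMap_zero_one_of_isClosed (n := (⊤ : ℕ∞))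
    (modelWithCornersSelf ℝ E) Metric.isOpen_thickening.isClosed_compl hK.isClosed hd
  have hs : Function.support f ⊆ Metric.cthickening r K := fun x hx => by
    by_contra h
    exact hx (hf0 fun h' => h (Metric.thickening_subset_cthickening _ _ h'))
  exact ⟨f, ⟨f.contMDiff.contDiff, HasCompactSupport.of_support_subset_isCompact hK.cthickening hs,
    closure_minimal hs Metric.isClosed_cthickening⟩, fun x hx => hf1 hx, hf⟩

variable [MeasurableSpace E] [BorelSpace E]

/-- A smooth cutoff lies between the indicator of K and that of a closed thickening; the ν-measure
of the thickenings decreases to `ν K` because one of them is finite. -/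
lemma measure_le_of_integral_test_eq {S : Set E} (hS : IsOpen S) {μ ν : Measure E}
    (hμ : ∀ K, IsCompact K → K ⊆ S → μ K < ⊤) (hν : ∀ K, IsCompact K → K ⊆ S → ν K < ⊤)
    (h : ∀ φ, IsTestFunction S φ → ∫ x, φ x ∂μ = ∫ x, φ x ∂ν) {K : Set E} (hK : IsCompact K)
    (hKS : K ⊆ S) : μ K ≤ ν K := by
  obtain ⟨δ, hδ, hδS⟩ := hK.exists_cthickening_subset_open hS hKS
  have hlim : Tendsto (fun r => ν (Metric.cthickening r K)) (𝓝[>] 0) (𝓝 (ν K)) :=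
    (tendsto_measure_cthickening_of_isClosed ⟨δ, hδ, (hν _ hK.cthickening hδS).ne⟩
      hK.isClosed).mono_left nhdsWithin_le_nhds
  refine ge_of_tendsto hlim ?_
  filter_upwards [Ioo_mem_nhdsGT hδ] with r hr
  have hrS : Metric.cthickening r K ⊆ S := (Metric.cthickening_mono hr.2.le K).trans hδS
  obtain ⟨φ, hφ, h1, h01⟩ := exists_smooth_cutoff hK hr.1
  have hφS := hφ.mono hrS
  have hμi := hφS.integrable_measure hμ
  have hνi := hφS.integrable_measure hν
  calc μ K = ∫⁻ x, K.indicator 1 x ∂μ := (lintegral_indicator_one hK.measurableSet).symm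
    _ ≤ ∫⁻ x, ENNReal.ofReal (φ x) ∂μ := by
        refine lintegral_mono fun x => ?_
        by_cases hx : x ∈ K
        · simp [indicator_of_mem hx, h1 x hx]
        · simp [indicator_of_notMem hx]
    _ = ENNReal.ofReal (∫ x, φ x ∂μ) :=
        (ofReal_integral_eq_lintegral_ofReal hμi (ae_of_all _ fun x => (h01 x).1)).symm
    _ = ENNReal.ofReal (∫ x, φ x ∂ν) := by rw [h φ hφS]
    _ = ∫⁻ x, ENNReal.ofReal (φ x) ∂ν :=
        ofReal_integral_eq_lintegral_ofReal hνi (ae_of_all _ fun x => (h01 x).1)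
    _ ≤ ∫⁻ x, (Metric.cthickening r K).indicator 1 x ∂ν := by
        refine lintegral_mono fun x => ?_
        by_cases hx : x ∈ Metric.cthickening r K
        · simpa [indicator_of_mem hx] using (h01 x).2
        · simp [indicator_of_notMem hx, hφ.eq_zero hx]
    _ = ν (Metric.cthickening r K) :=
        lintegral_indicator_one Metric.isClosed_cthickening.measurableSet

/-- Let N be μ-null with ν-null complement. Any compact subset of `K \ N` has μ-measure at most its
ν-measure, which is 0; inner regularity of the finite measure `μ.restrict K` extends this to `K \
N`. -/
lemma measure_eq_zero_of_mutuallySingular {S : Set E} {μ ν : Measure E} (hμν : μ ⟂ₘ ν)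
    (hμ : ∀ K, IsCompact K → K ⊆ S → μ K < ⊤)
    (h : ∀ K, IsCompact K → K ⊆ S → μ K ≤ ν K) {K : Set E} (hK : IsCompact K)
    (hKS : K ⊆ S) : μ K = 0 := by
  have hm := hμν.measurableSet_nullSet
  have hN := hμν.measure_nullSet
  have hNc := hμν.measure_compl_nullSet
  set N := hμν.nullSet
  have hfin : IsFiniteMeasure (μ.restrict K) := ⟨by
    rw [Measure.restrict_apply_univ]; exact hμ K hK hKS⟩
  have hA : MeasurableSet (K \ N) := (hK.measurableSet : MeasurableSet K).diff hm
  have h1 : μ.restrict K (K \ N) = 0 := by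
    have : ProperSpace E := FiniteDimensional.proper_real E
    rw [hA.measure_eq_iSup_isCompact_of_ne_top (measure_ne_top _ _)]
    simp only [ENNReal.iSup_eq_zero]
    intro L hL hLc
    have : μ L ≤ ν Nᶜ := (h L hLc ((hL.trans sdiff_subset).trans hKS)).trans
      (measure_mono fun x hx => (hL hx).2)
    rw [hNc] at this
    exact le_antisymm ((Measure.restrict_apply_le _ _).trans this) zero_le
  rw [Measure.restrict_apply hA, inter_eq_left.2 sdiff_subset] at h1
  refine le_antisymm ?_ zero_le
  calc μ K ≤ μ (K \ N ∪ N) := measure_mono fun x hx => by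
        by_cases hxN : x ∈ N
        · exact Or.inr hxN
        · exact Or.inl ⟨hx, hxN⟩
    _ ≤ μ (K \ N) + μ N := measure_union_le _ _
    _ = 0 := by rw [h1, hN, add_zero]

lemma SignedRadonMeasure.variation_eq_zero {U S : Set E} (D : SignedRadonMeasure U)
    (hS : IsOpen S) (hSU : S ⊆ U) (hD : ∀ φ, IsTestFunction S φ → D.pairing φ = 0)
    {K : Set E} (hK : IsCompact K) (hKS : K ⊆ S) : D.variation K = 0 := by
  have hp : ∀ K, IsCompact K → K ⊆ S → D.posPart K < ⊤ := fun K hK h =>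
    D.posPart_compact K hK (h.trans hSU)
  have hn : ∀ K, IsCompact K → K ⊆ S → D.negPart K < ⊤ := fun K hK h =>
    D.negPart_compact K hK (h.trans hSU)
  have he : ∀ φ, IsTestFunction S φ → ∫ x, φ x ∂D.posPart = ∫ x, φ x ∂D.negPart := fun φ hφ =>
    sub_eq_zero.1 (hD φ hφ)
  have h1 := measure_eq_zero_of_mutuallySingular D.mutuallySingular hp
    (fun K hK hKS => measure_le_of_integral_test_eq hS hp hn he hK hKS) hK hKS
  have h2 := measure_eq_zero_of_mutuallySingular D.mutuallySingular.symm hn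
    (fun K hK hKS => measure_le_of_integral_test_eq hS hn hp (fun φ hφ => (he φ hφ).symm) hK hKS)
    hK hKS
  rw [variation, Measure.add_apply, h1, h2, add_zero]

end Measures

-- Local fields and the vanishing of the defect measure.

/-- A local version of the velocity: a globally bounded measurable field which agrees with it on
the open set `S` and inherits its divergence-freeness and bounded variation there. -/
structure LocalField (U S : Set (SpaceTime d)) (u v : SpaceTime d → Space d) : Prop where
  isOpen : IsOpen S
  subset : S ⊆ U
  measurable : StronglyMeasurable v
  integrable : Integrable v
  bounded : ∃ C, ∀ p, ‖v p‖ ≤ C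
  ae_eq : ∀ᵐ p ∂volume.restrict S, v p = u p
  divFree : ∀ θ, IsTestFunction S θ → ∫ p, inner ℝ (v p) (gradX θ p) = 0
  variation : ∃ V, VariationBound S v V

/-- S is a product of relatively compact open sets squeezed between the projections of K and the
factors of the domain, so the product hypotheses on u apply to it. The compact L around S later
makes the pressure integrable on S. -/
lemma exists_localField {Ω : Set (Space d)} (hΩ : IsOpen Ω) {J : Set ℝ} (hJ : IsOpen J)
    {u : SpaceTime d → Space d} (hdiv : IsDivergenceFree (Ω ×ˢ J) u)
    (hu : ∀ (O : Set (Space d)) (I : Set ℝ), IsOpen O → IsOpen I → CompactlyIn O Ω →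
      CompactlyIn I J → MemLOneBV O I u ∧ MemLp u ⊤ (volume.restrict (O ×ˢ I)))
    {K : Set (SpaceTime d)} (hK : IsCompact K) (hKU : K ⊆ Ω ×ˢ J) :
    ∃ S v, LocalField (Ω ×ˢ J) S u v ∧ K ⊆ S ∧ ∃ L, IsCompact L ∧ S ⊆ L ∧ L ⊆ Ω ×ˢ J := by
  obtain ⟨O, hO, hKO, hOΩ, hOc⟩ := exists_open_between_and_isCompact_closure
    (hK.image continuous_fst) hΩ (image_subset_iff.2 fun p hp => (hKU hp).1)
  obtain ⟨I, hI, hKI, hIJ, hIc⟩ := exists_open_between_and_isCompact_closure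
    (hK.image continuous_snd) hJ (image_subset_iff.2 fun p hp => (hKU hp).2)
  obtain ⟨h1, h2⟩ := hu O I hO hI ⟨hOc, hOΩ⟩ ⟨hIc, hIJ⟩
  have hS : IsOpen (O ×ˢ I) := hO.prod hI
  have hSL : O ×ˢ I ⊆ closure O ×ˢ closure I := prod_mono subset_closure subset_closure
  have hLU : closure O ×ˢ closure I ⊆ Ω ×ˢ J := prod_mono hOΩ hIJ
  have hfin : volume (O ×ˢ I) ≠ ⊤ :=
    ((measure_mono hSL).trans_lt (hOc.prod hIc).measure_lt_top).ne
  obtain ⟨v, C, hvm, hvi, hvC, hvu, -⟩ :=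
    exists_bounded_representative hS.measurableSet hfin h2
  refine ⟨O ×ˢ I, v, ⟨hS, hSL.trans hLU, hvm, hvi, ⟨C, hvC⟩, hvu, fun θ hθ => ?_,
    variationBound_of_memLOneBV hO hI h1 hvm hvi hvu⟩, fun p hp =>
      ⟨hKO (mem_image_of_mem _ hp), hKI (mem_image_of_mem _ hp)⟩, _, hOc.prod hIc, hSL, hLU⟩
  rw [← hdiv θ (hθ.mono (hSL.trans hLU))]
  refine (setIntegral_eq_integral_of_ae_eq (hΩ.prod hJ).measurableSet (hSL.trans hLU) ?_
    (fun p hp => by rw [hθ.gradX_eq_zero hp, inner_zero_right])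
    (fun p hp => by rw [hθ.gradX_eq_zero hp, inner_zero_right])).symm
  filter_upwards [hvu] with p hp
  rw [hp]

lemma IsTestFunction.isContTestFunction {S : Set (SpaceTime d)} {φ : SpaceTime d → ℝ}
    (hφ : IsTestFunction S φ) : IsContTestFunction S φ :=
  ⟨hφ.smooth.continuous, hφ.compact, hφ.subset⟩

/-- `functional_eq_zero` with the pairing as functional. For a fixed test function supported in S
the approximations of u and of its local version coincide at all small scales, so the limit is the
same. -/
theorem variation_eq_zero_of_isWeakLimit {Ω : Set (Space d)} (hΩ : IsOpen Ω) {J : Set ℝ}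
    (hJ : IsOpen J) {u : SpaceTime d → Space d} (hdiv : IsDivergenceFree (Ω ×ˢ J) u)
    (hu : ∀ (O : Set (Space d)) (I : Set ℝ), IsOpen O → IsOpen I → CompactlyIn O Ω →
      CompactlyIn I J → MemLOneBV O I u ∧ MemLp u ⊤ (volume.restrict (O ×ˢ I)))
    (D : SignedRadonMeasure (Ω ×ˢ J)) (hD : ∀ ρ, IsKernel ρ → IsWeakLimit (Ω ×ˢ J) ρ u D)
    {K : Set (SpaceTime d)} (hK : IsCompact K) (hKU : K ⊆ Ω ×ˢ J) : D.variation K = 0 := by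
  obtain ⟨S, v, h, hKS, -⟩ := exists_localField hΩ hJ hdiv hu hK hKU
  obtain ⟨C, hC⟩ := h.bounded
  obtain ⟨V, hV⟩ := h.variation
  refine D.variation_eq_zero h.isOpen h.subset (fun φ hφ => ?_) hK hKS
  refine functional_eq_zero h.measurable h.integrable hC h.isOpen h.divFree hV D.pairing
    (fun ι _ φ hφ => D.pairing_sum h.subset hφ) (fun ρ hρ => ?_) hφ
  obtain ⟨ε, hε0, hε, hlim⟩ := hD ρ hρ
  refine ⟨ε, hε0, hε, fun φ hφ => ?_⟩
  obtain ⟨δ, hδ, hδe⟩ := exists_setIntegral_approx_eq h.isOpen (hΩ.prod hJ).measurableSet h.subset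
    h.ae_eq hφ
  refine (hlim φ (hφ.mono h.subset).isContTestFunction).congr' ?_
  filter_upwards [hε.eventually (gt_mem_nhds hδ)] with n hn
  exact hδe (ε n) (hε0 n) hn.le ρ hρ

-- Euler flows and the algebra of doubling the variables.

/-- A bounded divergence-free field `v` and a pressure `p`, both integrable, which solve the Euler
equations on the open set `S` in the sense of distributions. -/
structure LocalEulerFlow (S : Set (SpaceTime d)) (v : SpaceTime d → Space d)
    (p : SpaceTime d → ℝ) (C : ℝ) : Prop where
  isOpen : IsOpen S
  measurable : StronglyMeasurable v
  integrable : Integrable v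
  bounded : ∀ q, ‖v q‖ ≤ C
  measurable_pressure : StronglyMeasurable p
  integrable_pressure : Integrable p
  divFree : ∀ θ, IsTestFunction S θ → ∫ q, inner ℝ (v q) (gradX θ q) = 0
  momentum : ∀ θ, IsTestFunction S θ → ∀ i : Fin d,
    ∫ q, (v q i * derivT θ q + v q i * inner ℝ (v q) (gradX θ q) + p q * gradX θ q i) = 0

lemma IsTestFunction.continuous_gradX {S : Set (SpaceTime d)} {θ : SpaceTime d → ℝ}
    (hθ : IsTestFunction S θ) : Continuous (gradX θ) := by
  have h : gradX θ = fun q => (InnerProductSpace.toDual ℝ (Space d)).symm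
      ((fderiv ℝ θ q).comp (ContinuousLinearMap.inl ℝ (Space d) ℝ)) := by
    funext q
    refine ext_inner_right ℝ fun v => ?_
    rw [inner_gradX (hθ.smooth.differentiable (by simp) q), InnerProductSpace.toDual_symm_apply]
    simp
  rw [h]
  exact (InnerProductSpace.toDual ℝ (Space d)).symm.continuous.comp
    ((hθ.smooth.continuous_fderiv (by simp)).clm_comp continuous_const)

lemma IsTestFunction.continuous_derivT {S : Set (SpaceTime d)} {θ : SpaceTime d → ℝ}
    (hθ : IsTestFunction S θ) : Continuous (derivT θ) := by
  have h : derivT θ = fun q => fderiv ℝ θ q (0, 1) :=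
    funext fun q => derivT_eq (hθ.smooth.differentiable (by simp) q)
  rw [h]
  exact (hθ.smooth.continuous_fderiv (by simp)).clm_apply continuous_const

lemma IsTestFunction.hasCompactSupport_gradX {S : Set (SpaceTime d)} {θ : SpaceTime d → ℝ}
    (hθ : IsTestFunction S θ) : HasCompactSupport (gradX θ) :=
  HasCompactSupport.intro hθ.compact fun _ hq =>
    IsTestFunction.gradX_eq_zero ⟨hθ.smooth, hθ.compact, subset_rfl⟩ hq

lemma IsTestFunction.hasCompactSupport_derivT {S : Set (SpaceTime d)} {θ : SpaceTime d → ℝ}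
    (hθ : IsTestFunction S θ) : HasCompactSupport (derivT θ) :=
  HasCompactSupport.intro hθ.compact fun _ hq =>
    IsTestFunction.derivT_eq_zero ⟨hθ.smooth, hθ.compact, subset_rfl⟩ hq

lemma exists_norm_le_of_hasCompactSupport {X E : Type*} [TopologicalSpace X]
    [NormedAddCommGroup E] {f : X → E} (hf : Continuous f) (hc : HasCompactSupport f) :
    ∃ M, 0 ≤ M ∧ ∀ x, ‖f x‖ ≤ M := by
  obtain ⟨M, hM⟩ := hf.bounded_above_of_compact_support hc
  exact ⟨max M 0, le_max_right _ _, fun x => (hM x).trans (le_max_left _ _)⟩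

lemma IsTestFunction.integral_inner_gradX {S : Set (SpaceTime d)} {θ : SpaceTime d → ℝ}
    (hθ : IsTestFunction S θ) (w : Space d) : ∫ q, inner ℝ w (gradX θ q) = 0 := by
  have hd := hθ.smooth.differentiable (by simp)
  have hc : Continuous fun q => fderiv ℝ θ q (w, 0) :=
    (hθ.smooth.continuous_fderiv (by simp)).clm_apply continuous_const
  have hi : Integrable fun q => fderiv ℝ θ q (w, 0) :=
    hc.integrable_of_hasCompactSupport (hθ.compact.fderiv_apply ℝ (w, 0))
  have h := integral_mul_fderiv_eq_neg_fderiv_mul_of_integrable (μ := volume) (𝕜 := ℝ)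
    (f := fun _ : SpaceTime d => (1 : ℝ)) (g := θ) (v := (w, 0)) (by simp) (by simpa using hi)
    (by simpa using hθ.smooth.continuous.integrable_of_hasCompactSupport hθ.compact)
    (fun x _ => differentiableAt_const _) (fun x _ => hd x)
  simp only [one_mul, fderiv_fun_const, Pi.zero_apply, zero_apply, zero_mul,
    integral_zero, neg_zero] at h
  rw [← h]
  exact integral_congr_ae (ae_of_all _ fun q => by
    show inner ℝ w (gradX θ q) = _
    rw [real_inner_comm, inner_gradX (hd q)])

/-- The combination of the momentum equation, tested against `w`, and of the divergence equation
which occurs in the doubling of variables; `a` and `G` stand for the time derivative and the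
spatial gradient of the test function. -/
def doublingForm (a : ℝ) (G v : Space d) (p : ℝ) (w : Space d) (r : ℝ) : ℝ :=
  -2 * (inner ℝ v w * a + inner ℝ v w * inner ℝ v G + p * inner ℝ w G) +
    (‖w‖ ^ 2 - 2 * r) * inner ℝ v G - ‖w‖ ^ 2 * inner ℝ w G

lemma norm_doublingForm_le {a : ℝ} {G v : Space d} {p : ℝ} {w : Space d} {r C : ℝ}
    (hv : ‖v‖ ≤ C) (hw : ‖w‖ ≤ C) :
    ‖doublingForm a G v p w r‖ ≤
      (|a| + ‖G‖) * (4 * (1 + C) ^ 3 * ((1 + |p|) * (1 + |r|))) := by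
  have hC : 0 ≤ C := (norm_nonneg _).trans hv
  have h1 : |inner ℝ v w| ≤ C * C := (abs_real_inner_le_norm _ _).trans (by gcongr)
  have h2 : |inner ℝ v G| ≤ C * ‖G‖ := (abs_real_inner_le_norm _ _).trans (by gcongr)
  have h3 : |inner ℝ w G| ≤ C * ‖G‖ := (abs_real_inner_le_norm _ _).trans (by gcongr)
  have h4 : ‖w‖ ^ 2 ≤ C ^ 2 := by gcongr
  have e1 : |inner ℝ v w * a| ≤ C * C * |a| := by rw [abs_mul]; gcongr
  have e2 : |inner ℝ v w * inner ℝ v G| ≤ C * C * (C * ‖G‖) := by rw [abs_mul]; gcongr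
  have e3 : |p * inner ℝ w G| ≤ |p| * (C * ‖G‖) := by rw [abs_mul]; gcongr
  have e4 : |(‖w‖ ^ 2 - 2 * r) * inner ℝ v G| ≤ (C ^ 2 + 2 * |r|) * (C * ‖G‖) := by
    rw [abs_mul]
    gcongr
    refine (abs_sub _ _).trans ?_
    rw [abs_of_nonneg (by positivity : 0 ≤ ‖w‖ ^ 2), abs_mul, abs_two]
    gcongr
  have e5 : |‖w‖ ^ 2 * inner ℝ w G| ≤ C ^ 2 * (C * ‖G‖) := by
    rw [abs_mul, abs_of_nonneg (by positivity : 0 ≤ ‖w‖ ^ 2)]; gcongr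
  have ht : ‖doublingForm a G v p w r‖ ≤ 2 * (C * C * |a| + C * C * (C * ‖G‖) + |p| * (C * ‖G‖)) +
      (C ^ 2 + 2 * |r|) * (C * ‖G‖) + C ^ 2 * (C * ‖G‖) := by
    rw [Real.norm_eq_abs, doublingForm]
    rw [abs_le] at *
    constructor <;> linarith [e1.1, e1.2, e2.1, e2.2, e3.1, e3.2, e4.1, e4.2, e5.1, e5.2]
  refine ht.trans ?_
  have ha := abs_nonneg a
  have hp := abs_nonneg p
  have hr := abs_nonneg r
  have hG := norm_nonneg G
  have hs : 0 ≤ |p| * |r| := by positivity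
  have k1 : 2 * (C * C * |a|) ≤ |a| * (4 * (1 + C) ^ 3 * ((1 + |p|) * (1 + |r|))) := by
    have : C * C ≤ (1 + C) ^ 3 := by nlinarith [mul_nonneg hC hC, mul_nonneg hC (mul_nonneg hC hC)]
    have h1 : 1 ≤ (1 + |p|) * (1 + |r|) := by nlinarith
    calc 2 * (C * C * |a|) = |a| * (2 * (C * C) * 1) := by ring
      _ ≤ _ := by gcongr; norm_num
  have k2 : 4 * C ^ 3 + 2 * C * |p| + 2 * C * |r| ≤
      4 * (1 + C) ^ 3 * ((1 + |p|) * (1 + |r|)) := by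
    have c1 : C ^ 3 ≤ (1 + C) ^ 3 := by gcongr; linarith
    have c2 : C ≤ (1 + C) ^ 3 := by
      nlinarith [mul_nonneg hC hC, mul_nonneg hC (mul_nonneg hC hC)]
    have d1 : C * |p| ≤ (1 + C) ^ 3 * |p| := by gcongr
    have d2 : C * |r| ≤ (1 + C) ^ 3 * |r| := by gcongr
    have d3 : 0 ≤ (1 + C) ^ 3 * (|p| * |r|) := by positivity
    have d4 : 0 ≤ (1 + C) ^ 3 * |p| := by positivity
    have d5 : 0 ≤ (1 + C) ^ 3 * |r| := by positivity
    nlinarith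
  have k3 := mul_le_mul_of_nonneg_left k2 hG
  nlinarith

lemma integrable_doublingForm {S : Set (SpaceTime d)} {v : SpaceTime d → Space d}
    {p : SpaceTime d → ℝ} {C : ℝ} (h : LocalEulerFlow S v p C)
    {a : SpaceTime d × SpaceTime d → ℝ} {G : SpaceTime d × SpaceTime d → Space d}
    (ha : Continuous a) (hac : HasCompactSupport a) (hG : Continuous G)
    (hGc : HasCompactSupport G) :
    Integrable fun x : SpaceTime d × SpaceTime d =>
      doublingForm (a x) (G x) (v x.1) (p x.1) (v x.2) (p x.2) := by
  obtain ⟨M, hM0, hM⟩ := exists_norm_le_of_hasCompactSupport ha hac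
  obtain ⟨M', hM0', hM'⟩ := exists_norm_le_of_hasCompactSupport hG hGc
  set K := tsupport a ∪ tsupport G with hKdef
  have hK : IsCompact K := hac.union hGc
  set K₁ := Prod.fst '' K
  set K₂ := Prod.snd '' K
  have hK₁ : IsCompact K₁ := hK.image continuous_fst
  have hK₂ : IsCompact K₂ := hK.image continuous_snd
  have hg : ∀ L : Set (SpaceTime d), IsCompact L → Integrable (L.indicator fun q => 1 + |p q|) :=
    fun L hL => ((integrableOn_const (hL.measure_lt_top.ne)).add
      h.integrable_pressure.abs.integrableOn).integrable_indicator hL.measurableSet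
  have hm1 : Measurable v := h.measurable.measurable
  have hm2 : Measurable p := h.measurable_pressure.measurable
  have hmeas : Measurable fun x : SpaceTime d × SpaceTime d =>
      doublingForm (a x) (G x) (v x.1) (p x.1) (v x.2) (p x.2) := by
    have := ha.measurable
    have := hG.measurable
    unfold doublingForm
    fun_prop
  refine Integrable.mono' (((hg K₁ hK₁).mul_prod (hg K₂ hK₂)).const_mul
    ((M + M') * (4 * (1 + C) ^ 3))) hmeas.aestronglyMeasurable (ae_of_all _ fun x => ?_)
  by_cases hx : x ∈ K
  · rw [indicator_of_mem (mem_image_of_mem _ hx), indicator_of_mem (mem_image_of_mem _ hx)]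
    refine (norm_doublingForm_le (h.bounded _) (h.bounded _)).trans ?_
    have hC : 0 ≤ C := (norm_nonneg _).trans (h.bounded x.1)
    rw [← mul_assoc]
    have := hM x
    have := hM' x
    rw [Real.norm_eq_abs] at *
    gcongr
  · have h1 : a x = 0 := image_eq_zero_of_notMem_tsupport fun h => hx (Or.inl h)
    have h2 : G x = 0 := image_eq_zero_of_notMem_tsupport fun h => hx (Or.inr h)
    have hC : 0 ≤ C := (norm_nonneg _).trans (h.bounded x.1)
    rw [h1, h2]
    have : doublingForm 0 0 (v x.1) (p x.1) (v x.2) (p x.2) = 0 := by simp [doublingForm]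
    rw [this, norm_zero]
    have hn : ∀ L : Set (SpaceTime d), ∀ q, 0 ≤ L.indicator (fun q => 1 + |p q|) q := fun L q =>
      indicator_nonneg (fun q _ => by positivity) q
    have := hn K₁ x.1
    have := hn K₂ x.2
    positivity

/-- With w and r frozen every term is an equation tested against θ: the momentum equation contracted
with w, the divergence equation times a constant, and the integral of a derivative of θ. -/
lemma LocalEulerFlow.integral_doublingForm {S : Set (SpaceTime d)} {v : SpaceTime d → Space d}
    {p : SpaceTime d → ℝ} {C : ℝ} (h : LocalEulerFlow S v p C) {θ : SpaceTime d → ℝ}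
    (hθ : IsTestFunction S θ) (w : Space d) (r : ℝ) :
    ∫ q, doublingForm (derivT θ q) (gradX θ q) (v q) (p q) w r = 0 := by
  obtain ⟨M, hM0, hM⟩ := exists_norm_le_of_hasCompactSupport hθ.continuous_derivT
    hθ.hasCompactSupport_derivT
  obtain ⟨M', hM0', hM'⟩ := exists_norm_le_of_hasCompactSupport hθ.continuous_gradX
    hθ.hasCompactSupport_gradX
  have hm1 := h.measurable.measurable
  have hm2 := h.measurable_pressure.measurable
  have hm3 := hθ.continuous_derivT.measurable
  have hm4 := hθ.continuous_gradX.measurable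
  have hC0 : 0 ≤ C := (norm_nonneg _).trans (h.bounded 0)
  have hvG : ∀ q, |inner ℝ (v q) (gradX θ q)| ≤ C * M' := fun q =>
    (abs_real_inner_le_norm _ _).trans (mul_le_mul (h.bounded q) (hM' q) (norm_nonneg _) hC0)
  have hvn : Integrable fun q => ‖v q‖ := h.integrable.norm
  have i1 : Integrable fun q => inner ℝ (v q) (gradX θ q) := by
    refine (hvn.mul_const M').mono' (by fun_prop) (ae_of_all _ fun q => ?_)
    exact (norm_inner_le_norm _ _).trans (by gcongr; exact hM' q)
  have i2 : Integrable fun q => inner ℝ w (gradX θ q) :=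
    (continuous_const.inner hθ.continuous_gradX).integrable_of_hasCompactSupport
      (hθ.hasCompactSupport_gradX.mono fun q hq hq' => hq (by simp [hq']))
  have hcoord : ∀ (x : Space d) i, ‖x i‖ ≤ ‖x‖ := fun x i => PiLp.norm_apply_le x i
  have i3 : ∀ i : Fin d, Integrable fun q =>
      v q i * derivT θ q + v q i * inner ℝ (v q) (gradX θ q) + p q * gradX θ q i := by
    intro i
    have hvi : Measurable fun q => v q i := by fun_prop
    refine (((hvn.mul_const M).add (hvn.mul_const (C * M'))).add
      (h.integrable_pressure.norm.mul_const M')).mono' (by fun_prop) (ae_of_all _ fun q => ?_)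
    refine (norm_add_le _ _).trans (add_le_add ((norm_add_le _ _).trans (add_le_add ?_ ?_)) ?_)
    · rw [norm_mul]
      exact mul_le_mul (hcoord _ i) (hM q) (norm_nonneg _) (norm_nonneg _)
    · rw [norm_mul]
      exact mul_le_mul (hcoord _ i) (hvG q) (norm_nonneg _) (norm_nonneg _)
    · rw [norm_mul]
      exact mul_le_mul_of_nonneg_left ((hcoord _ i).trans (hM' q)) (norm_nonneg _)
  have e : ∀ q, doublingForm (derivT θ q) (gradX θ q) (v q) (p q) w r =
      -2 * (∑ i, w i * (v q i * derivT θ q + v q i * inner ℝ (v q) (gradX θ q) +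
        p q * gradX θ q i)) + (‖w‖ ^ 2 - 2 * r) * inner ℝ (v q) (gradX θ q) -
        ‖w‖ ^ 2 * inner ℝ w (gradX θ q) := by
    intro q
    have h1 : inner ℝ (v q) w = ∑ i, w i * v q i := by
      rw [PiLp.inner_apply]; simp
    have h2 : inner ℝ w (gradX θ q) = ∑ i, w i * gradX θ q i := by
      rw [PiLp.inner_apply]; simp [mul_comm]
    have h3 : (∑ i, w i * (v q i * derivT θ q + v q i * inner ℝ (v q) (gradX θ q) +
        p q * gradX θ q i)) = inner ℝ (v q) w * derivT θ q +
          inner ℝ (v q) w * inner ℝ (v q) (gradX θ q) + p q * inner ℝ w (gradX θ q) := by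
      rw [h1, h2, Finset.sum_mul, Finset.sum_mul, Finset.mul_sum, ← Finset.sum_add_distrib,
        ← Finset.sum_add_distrib]
      exact Finset.sum_congr rfl fun i _ => by ring
    rw [h3, doublingForm]
  simp only [e]
  have i4 := (integrable_finsetSum Finset.univ fun i _ => (i3 i).const_mul (w i)).const_mul (-2)
  have i5 := i1.const_mul (‖w‖ ^ 2 - 2 * r)
  have i6 : Integrable fun q => -2 * (∑ i, w i * (v q i * derivT θ q +
      v q i * inner ℝ (v q) (gradX θ q) + p q * gradX θ q i)) +
        (‖w‖ ^ 2 - 2 * r) * inner ℝ (v q) (gradX θ q) := i4.add i5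
  rw [integral_sub i6 (i2.const_mul _), integral_add i4 i5, integral_const_mul,
    integral_finsetSum _ fun i _ => (i3 i).const_mul (w i), integral_const_mul, integral_const_mul,
    h.divFree θ hθ, hθ.integral_inner_gradX w]
  simp [integral_const_mul, h.momentum θ hθ]

/-- The cubic increment term in the doubling of variables. -/
def pairFlux (φ : SpaceTime d → ℝ) (v : SpaceTime d → Space d) (q q' : SpaceTime d) : Space d :=
  (φ q * ‖v q' - v q‖ ^ 2) • (v q' - v q)

/-- The energy terms in the doubling of variables; `a` and `G` stand for the time derivative and
the spatial gradient of the test function. -/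
def energyForm (a : ℝ) (G v : Space d) (p : ℝ) (w : Space d) (r : ℝ) : ℝ :=
  2 * inner ℝ v w * (a + inner ℝ v G) + 2 * (p * inner ℝ w G + r * inner ℝ v G) +
    inner ℝ (w - v) G * ‖w‖ ^ 2

lemma norm_energyForm_le {a : ℝ} {G v : Space d} {p : ℝ} {w : Space d} {r C : ℝ}
    (hv : ‖v‖ ≤ C) (hw : ‖w‖ ≤ C) :
    ‖energyForm a G v p w r‖ ≤ 2 * C ^ 2 * |a| + 4 * C ^ 3 * ‖G‖ +
      2 * C * ‖G‖ * (|p| + |r|) := by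
  have hC : 0 ≤ C := (norm_nonneg _).trans hv
  have h1 : |inner ℝ v w| ≤ C * C := (abs_real_inner_le_norm _ _).trans (by gcongr)
  have h2 : |inner ℝ v G| ≤ C * ‖G‖ := (abs_real_inner_le_norm _ _).trans (by gcongr)
  have h3 : |inner ℝ w G| ≤ C * ‖G‖ := (abs_real_inner_le_norm _ _).trans (by gcongr)
  have e1 : |2 * inner ℝ v w * (a + inner ℝ v G)| ≤ 2 * (C * C) * (|a| + C * ‖G‖) := by
    rw [abs_mul, abs_mul, abs_two]
    gcongr
    exact (abs_add_le _ _).trans (by gcongr)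
  have e2 : |2 * (p * inner ℝ w G + r * inner ℝ v G)| ≤
      2 * (|p| * (C * ‖G‖) + |r| * (C * ‖G‖)) := by
    rw [abs_mul, abs_two]
    gcongr
    refine (abs_add_le _ _).trans ?_
    rw [abs_mul, abs_mul]
    gcongr
  have e3 : |inner ℝ (w - v) G * ‖w‖ ^ 2| ≤ (2 * (C * ‖G‖)) * C ^ 2 := by
    rw [abs_mul, abs_of_nonneg (by positivity : 0 ≤ ‖w‖ ^ 2), inner_sub_left]
    gcongr
    refine (abs_sub _ _).trans ?_
    linarith
  rw [Real.norm_eq_abs, energyForm]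
  refine (abs_add_le _ _).trans ((add_le_add ((abs_add_le _ _).trans (add_le_add e1 e2)) e3).trans
    (le_of_eq (by ring)))

/-- The energy terms in the doubling of variables, at a pair of points. -/
def pairEnergy (φ : SpaceTime d → ℝ) (v : SpaceTime d → Space d) (p : SpaceTime d → ℝ)
    (q q' : SpaceTime d) : ℝ :=
  energyForm (derivT φ q) (gradX φ q) (v q) (p q) (v q') (p q')

/-- The polynomial identity behind the energy balance. Here k, g and kt stand for the kernel `k (q'
- q)`, its spatial gradient and its time derivative. The cubic increment splits into the equations
at q, with test function `φ(q) k(q' - q)` in q, and at q', with the same function in q'. The two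
time derivatives of the kernel cancel, so kt is absent on the left, and what remains has its
derivatives on φ. -/
lemma pairFlux_sub_pairEnergy (φ : SpaceTime d → ℝ) (v : SpaceTime d → Space d)
    (p : SpaceTime d → ℝ) (q q' : SpaceTime d) (g : Space d) (k kt : ℝ) :
    inner ℝ g (pairFlux φ v q q') - k * pairEnergy φ v p q q' =
      doublingForm (k * derivT φ q - φ q * kt) (k • gradX φ q - φ q • g)
        (v q) (p q) (v q') (p q') +
      doublingForm (φ q * kt) (φ q • g) (v q') (p q') (v q) (p q) := by
  have hn : ‖v q' - v q‖ ^ 2 = ‖v q'‖ ^ 2 - 2 * inner ℝ (v q) (v q') + ‖v q‖ ^ 2 := by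
    rw [norm_sub_sq_real, real_inner_comm]
  simp only [pairFlux, pairEnergy, energyForm, doublingForm, inner_smul_right, inner_sub_right,
    inner_sub_left, hn, real_inner_comm (v q) (v q'), real_inner_comm (v q) g,
    real_inner_comm (v q') g]
  ring

-- Integrating the doubled equations.

section Doubling

variable {S : Set (SpaceTime d)} {v : SpaceTime d → Space d} {p φ k : SpaceTime d → ℝ} {C r : ℝ}

lemma fderiv_comp_const_sub' (hk : Differentiable ℝ k) (q q' : SpaceTime d) :
    HasFDerivAt (fun q => k (q' - q)) (-fderiv ℝ k (q' - q)) q := by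
  have h := (hk (q' - q)).hasFDerivAt.comp q ((hasFDerivAt_id q).const_sub q')
  rw [ContinuousLinearMap.comp_neg, ContinuousLinearMap.comp_id] at h
  exact h

lemma IsTestFunction.mul_reflected (hφ : IsTestFunction S φ)
    (hk : IsTestFunction (Metric.ball 0 r) k) (q' : SpaceTime d) :
    IsTestFunction S fun q => φ q * k (q' - q) :=
  ⟨hφ.smooth.mul (hk.smooth.comp (contDiff_const.sub contDiff_id)), hφ.compact.mul_right,
    (closure_mono (Function.support_mul_subset_left _ _)).trans hφ.subset⟩

lemma IsTestFunction.translate (hr : Metric.cthickening r (tsupport φ) ⊆ S)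
    (hk : IsTestFunction (Metric.ball 0 r) k) {q : SpaceTime d} (hq : q ∈ tsupport φ) :
    IsTestFunction S fun q' => k (q' - q) := by
  have hcs : HasCompactSupport fun q' => k (q' - q) :=
    hk.compact.comp_homeomorph (Homeomorph.subRight q)
  refine ⟨hk.smooth.comp (contDiff_id.sub contDiff_const), hcs, ?_⟩
  have h1 : tsupport (fun q' => k (q' - q)) ⊆ (fun q' => q' - q) ⁻¹' tsupport k :=
    closure_minimal (fun x hx => subset_tsupport k hx)
      ((isClosed_tsupport k).preimage (by fun_prop))
  refine (h1.trans fun q' hq' => hr ?_)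
  refine Metric.mem_cthickening_of_dist_le q' q r _ hq ?_
  have := hk.subset hq'
  rw [mem_ball_zero_iff] at this
  rw [dist_eq_norm]; exact this.le

lemma derivT_mul_reflected (hφ : Differentiable ℝ φ) (hk : Differentiable ℝ k)
    (q q' : SpaceTime d) : derivT (fun q => φ q * k (q' - q)) q =
      k (q' - q) * derivT φ q - φ q * derivT k (q' - q) := by
  have h := (hφ q).hasFDerivAt.fun_mul (fderiv_comp_const_sub' hk q q')
  rw [derivT_eq h.differentiableAt, derivT_eq (hφ q), derivT_eq (hk _)]
  rw [h.fderiv]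
  simp
  ring

lemma gradX_mul_reflected (hφ : Differentiable ℝ φ) (hk : Differentiable ℝ k)
    (q q' : SpaceTime d) : gradX (fun q => φ q * k (q' - q)) q =
      k (q' - q) • gradX φ q - φ q • gradX k (q' - q) := by
  have h := (hφ q).hasFDerivAt.fun_mul (fderiv_comp_const_sub' hk q q')
  refine ext_inner_right ℝ fun w => ?_
  rw [inner_gradX h.differentiableAt, inner_sub_left, inner_smul_left, inner_smul_left,
    inner_gradX (hφ q), inner_gradX (hk _)]
  rw [h.fderiv]
  simp
  ring

lemma fderiv_translate (k : SpaceTime d → ℝ) (q q' : SpaceTime d) :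
    fderiv ℝ (fun q' => k (q' - q)) q' = fderiv ℝ k (q' - q) :=
  fderiv_comp_sub q

lemma derivT_translate (hk : Differentiable ℝ k) (q q' : SpaceTime d) :
    derivT (fun q' => k (q' - q)) q' = derivT k (q' - q) := by
  rw [derivT_eq (by fun_prop), derivT_eq (hk _), fderiv_translate k]

lemma gradX_translate (hk : Differentiable ℝ k) (q q' : SpaceTime d) :
    gradX (fun q' => k (q' - q)) q' = gradX k (q' - q) := by
  refine ext_inner_right ℝ fun w => ?_
  rw [inner_gradX (by fun_prop), inner_gradX (hk _), fderiv_translate k]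

lemma hasCompactSupport_smul_sub {E F G : Type*} [NormedAddCommGroup E] [NormedAddCommGroup F]
    [NormedAddCommGroup G] {f : SpaceTime d → E} {g : SpaceTime d → F} (hf : HasCompactSupport f)
    (hg : HasCompactSupport g) {b : E → F → G} (hb₁ : ∀ y, b 0 y = 0) (hb₂ : ∀ x, b x 0 = 0) :
    HasCompactSupport fun x : SpaceTime d × SpaceTime d => b (f x.1) (g (x.2 - x.1)) := by
  refine HasCompactSupport.intro
    (IsCompact.prod hf (IsCompact.add (s := tsupport f) (t := tsupport g) hf hg)) fun x hx => ?_
  by_cases h1 : x.1 ∈ tsupport f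
  · have : x.2 - x.1 ∉ tsupport g := fun h2 => hx ⟨h1, by
      rw [← add_sub_cancel x.1 x.2]; exact add_mem_add h1 h2⟩
    rw [image_eq_zero_of_notMem_tsupport this, hb₂]
  · rw [image_eq_zero_of_notMem_tsupport h1, hb₁]

lemma LocalEulerFlow.integrable_doubling_left (h : LocalEulerFlow S v p C)
    (hφ : IsTestFunction S φ) (hk : IsTestFunction (Metric.ball 0 r) k) :
    Integrable fun x : SpaceTime d × SpaceTime d =>
      doublingForm (k (x.2 - x.1) * derivT φ x.1 - φ x.1 * derivT k (x.2 - x.1))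
        (k (x.2 - x.1) • gradX φ x.1 - φ x.1 • gradX k (x.2 - x.1))
        (v x.1) (p x.1) (v x.2) (p x.2) := by
  have c1 := hφ.smooth.continuous
  have c2 := hk.smooth.continuous
  have c3 := hφ.continuous_derivT
  have c4 := hk.continuous_derivT
  have c5 := hφ.continuous_gradX
  have c6 := hk.continuous_gradX
  refine integrable_doublingForm h (by fun_prop) ?_ (by fun_prop) ?_
  · exact (hasCompactSupport_smul_sub (b := fun x y => y * x) hφ.hasCompactSupport_derivT
      hk.compact (by simp) (by simp)).sub (hasCompactSupport_smul_sub (b := fun x y => x * y)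
        hφ.compact hk.hasCompactSupport_derivT (by simp) (by simp))
  · exact (hasCompactSupport_smul_sub (b := fun (x : Space d) (y : ℝ) => y • x)
      hφ.hasCompactSupport_gradX hk.compact (by simp) (by simp)).sub
        (hasCompactSupport_smul_sub (b := fun (x : ℝ) (y : Space d) => x • y)
        hφ.compact hk.hasCompactSupport_gradX (by simp) (by simp))

lemma LocalEulerFlow.integrable_doubling_right (h : LocalEulerFlow S v p C)
    (hφ : IsTestFunction S φ) (hk : IsTestFunction (Metric.ball 0 r) k) :
    Integrable fun x : SpaceTime d × SpaceTime d =>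
      doublingForm (φ x.1 * derivT k (x.2 - x.1)) (φ x.1 • gradX k (x.2 - x.1))
        (v x.2) (p x.2) (v x.1) (p x.1) := by
  have c1 := hφ.smooth.continuous
  have c4 := hk.continuous_derivT
  have c6 := hk.continuous_gradX
  have := integrable_doublingForm h
    (a := fun x : SpaceTime d × SpaceTime d => φ x.2 * derivT k (x.1 - x.2))
    (G := fun x : SpaceTime d × SpaceTime d => φ x.2 • gradX k (x.1 - x.2))
    (by fun_prop)
    ((hasCompactSupport_smul_sub (b := fun x y => x * y) hφ.compact hk.hasCompactSupport_derivT
      (by simp) (by simp)).comp_homeomorph (Homeomorph.prodComm _ _)) (by fun_prop)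
    ((hasCompactSupport_smul_sub (b := fun (x : ℝ) (y : Space d) => x • y) hφ.compact
      hk.hasCompactSupport_gradX (by simp) (by simp)).comp_homeomorph (Homeomorph.prodComm _ _))
  exact this.swap

lemma LocalEulerFlow.integral_doubling_left (h : LocalEulerFlow S v p C)
    (hφ : IsTestFunction S φ) (hk : IsTestFunction (Metric.ball 0 r) k) :
    ∫ x : SpaceTime d × SpaceTime d,
      doublingForm (k (x.2 - x.1) * derivT φ x.1 - φ x.1 * derivT k (x.2 - x.1))
        (k (x.2 - x.1) • gradX φ x.1 - φ x.1 • gradX k (x.2 - x.1))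
        (v x.1) (p x.1) (v x.2) (p x.2) = 0 := by
  have hdφ := hφ.smooth.differentiable (by simp)
  have hdk := hk.smooth.differentiable (by simp)
  erw [integral_prod_symm _ (h.integrable_doubling_left hφ hk)]
  refine integral_eq_zero_of_ae (ae_of_all _ fun q' => ?_)
  have := h.integral_doublingForm (hφ.mul_reflected hk q') (v q') (p q')
  simp only [derivT_mul_reflected hdφ hdk, gradX_mul_reflected hdφ hdk] at this
  exact this

lemma LocalEulerFlow.integral_doubling_right (h : LocalEulerFlow S v p C)
    (hφ : IsTestFunction S φ) (hr : Metric.cthickening r (tsupport φ) ⊆ S)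
    (hk : IsTestFunction (Metric.ball 0 r) k) :
    ∫ x : SpaceTime d × SpaceTime d,
      doublingForm (φ x.1 * derivT k (x.2 - x.1)) (φ x.1 • gradX k (x.2 - x.1))
        (v x.2) (p x.2) (v x.1) (p x.1) = 0 := by
  have hdk := hk.smooth.differentiable (by simp)
  erw [integral_prod _ (h.integrable_doubling_right hφ hk)]
  refine integral_eq_zero_of_ae (ae_of_all _ fun q => ?_)
  have e : ∀ q', doublingForm (φ q * derivT k (q' - q)) (φ q • gradX k (q' - q))
      (v q') (p q') (v q) (p q) = φ q * doublingForm (derivT k (q' - q)) (gradX k (q' - q))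
      (v q') (p q') (v q) (p q) := by
    intro q'
    simp only [doublingForm, inner_smul_right]
    ring
  simp only [e, integral_const_mul, Pi.zero_apply]
  -- Only for q in the support of φ is the translated kernel known to be a test function on S;
  -- elsewhere the factor `φ q` removes the term.
  by_cases hq : q ∈ tsupport φ
  · have := h.integral_doublingForm (hk.translate hr hq) (v q) (p q)
    simp only [derivT_translate hdk, gradX_translate hdk] at this
    rw [this, mul_zero]
  · rw [image_eq_zero_of_notMem_tsupport hq, zero_mul]

lemma LocalEulerFlow.integrable_pairFlux (h : LocalEulerFlow S v p C)
    (hφ : IsTestFunction S φ) (ζ : SpaceTime d) :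
    Integrable fun q => pairFlux φ v q (q + ζ) := by
  have hm := h.measurable.measurable
  have hc := hφ.smooth.continuous.measurable
  have hi := (hφ.smooth.continuous.integrable_of_hasCompactSupport (μ := volume) hφ.compact).norm
  refine (hi.mul_const ((2 * C) ^ 2 * (2 * C))).mono'
    (Measurable.aestronglyMeasurable (by unfold pairFlux; fun_prop)) (ae_of_all _ fun q => ?_)
  have hd : ‖v (q + ζ) - v q‖ ≤ 2 * C := by
    refine (norm_sub_le _ _).trans ?_
    linarith [h.bounded q, h.bounded (q + ζ)]
  rw [pairFlux, norm_smul, norm_mul, norm_pow, norm_norm, mul_assoc]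
  have := (norm_nonneg _).trans hd
  gcongr

lemma LocalEulerFlow.integrable_pairEnergy (h : LocalEulerFlow S v p C)
    (hφ : IsTestFunction S φ) (ζ : SpaceTime d) :
    Integrable fun q => pairEnergy φ v p q (q + ζ) := by
  have hm := h.measurable.measurable
  have hm' := h.measurable_pressure.measurable
  have hc1 := hφ.continuous_derivT.measurable
  have hc2 := hφ.continuous_gradX.measurable
  have i1 := (hφ.continuous_derivT.integrable_of_hasCompactSupport (μ := volume)
    hφ.hasCompactSupport_derivT).abs
  have i2 := (hφ.continuous_gradX.integrable_of_hasCompactSupport (μ := volume)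
    hφ.hasCompactSupport_gradX).norm
  obtain ⟨M, hM0, hM⟩ := exists_norm_le_of_hasCompactSupport hφ.continuous_gradX
    hφ.hasCompactSupport_gradX
  have i3 := h.integrable_pressure.abs
  have i4 := i3.comp_add_right ζ
  refine (((i1.const_mul (2 * C ^ 2)).add (i2.const_mul (4 * C ^ 3))).add
    ((i3.add i4).const_mul (2 * C * M))).mono'
    (Measurable.aestronglyMeasurable (by unfold pairEnergy energyForm; fun_prop)) (ae_of_all _ fun q => ?_)
  refine (norm_energyForm_le (h.bounded q) (h.bounded (q + ζ))).trans ?_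
  have hC : 0 ≤ C := (norm_nonneg _).trans (h.bounded q)
  simp only [Pi.add_apply]
  gcongr
  exact hM q

/-- Both doubled equations integrate to zero, one after freezing q' and one after freezing q. The
shear `q' = q + ζ` then isolates the displacement ζ, on which alone the kernel depends. -/
lemma LocalEulerFlow.integral_gradX_pairFlux (h : LocalEulerFlow S v p C)
    (hφ : IsTestFunction S φ) (hr : Metric.cthickening r (tsupport φ) ⊆ S)
    (hk : IsTestFunction (Metric.ball 0 r) k) :
    ∫ ζ, (inner ℝ (gradX k ζ) (∫ q, pairFlux φ v q (q + ζ)) -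
      k ζ * ∫ q, pairEnergy φ v p q (q + ζ)) = 0 := by
  set F : SpaceTime d × SpaceTime d → ℝ := fun x =>
    inner ℝ (gradX k (x.2 - x.1)) (pairFlux φ v x.1 x.2) -
      k (x.2 - x.1) * pairEnergy φ v p x.1 x.2 with hFdef
  have hF : ∀ x, F x = _ := fun x =>
    pairFlux_sub_pairEnergy φ v p x.1 x.2 (gradX k (x.2 - x.1)) (k (x.2 - x.1))
      (derivT k (x.2 - x.1))
  have hi : Integrable F := by
    rw [funext hF]
    exact (h.integrable_doubling_left hφ hk).add (h.integrable_doubling_right hφ hk)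
  have h0 : ∫ x, F x = 0 := by
    rw [funext hF, integral_add (h.integrable_doubling_left hφ hk)
      (h.integrable_doubling_right hφ hk), h.integral_doubling_left hφ hk,
      h.integral_doubling_right hφ hr hk, add_zero]
  have hmp : MeasurePreserving (fun x : SpaceTime d × SpaceTime d => (x.1, x.1 + x.2))
      (volume.prod volume) (volume.prod volume) := measurePreserving_prod_add volume volume
  have he : MeasurableEmbedding (fun x : SpaceTime d × SpaceTime d => (x.1, x.1 + x.2)) :=
    (MeasurableEquiv.shearAddRight (SpaceTime d)).measurableEmbedding
  have hi' : Integrable (fun x : SpaceTime d × SpaceTime d => F (x.1, x.1 + x.2))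
      (volume.prod volume) := (hmp.integrable_comp_emb he).2 hi
  have h1 : ∫ x : SpaceTime d × SpaceTime d, F (x.1, x.1 + x.2) ∂(volume.prod volume) = 0 := by
    rw [hmp.integral_comp he F]; exact h0
  rw [integral_prod_symm _ hi'] at h1
  rw [← h1]
  refine integral_congr_ae (ae_of_all _ fun ζ => ?_)
  simp only [hFdef, add_sub_cancel_left]
  rw [integral_sub ((h.integrable_pairFlux hφ ζ).const_inner _)
    ((h.integrable_pairEnergy hφ ζ).const_mul _), integral_const_mul,
    integral_inner (h.integrable_pairFlux hφ ζ)]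

end Doubling

-- Continuity in the displacement.

lemma continuous_toLp_translate {E : Type*} [NormedAddCommGroup E] {f : SpaceTime d → E}
    (hf : MemLp f 1 volume) : Continuous fun ζ : SpaceTime d =>
      (hf.comp_measurePreserving (measurePreserving_add_right volume ζ)).toLp _ := by
  have hg : Continuous (ContinuousMap.mk (fun a : SpaceTime d × SpaceTime d => a.2 + a.1)
    (by fun_prop)).curry := ContinuousMap.continuous _
  exact Continuous.compMeasurePreservingLp (μ := volume) (ν := volume)
    (f := fun _ : SpaceTime d => hf.toLp f) continuous_const hg
    (fun ζ => measurePreserving_add_right volume ζ) (by simp)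

/-- Translation is continuous in L¹, so along any sequence of displacements a subsequence of
translates converges almost everywhere. The sup bound on f supplies domination for an integrand that
is only continuous in its value. -/
lemma continuous_integral_comp_translate {E G : Type*} [NormedAddCommGroup E]
    [NormedAddCommGroup G] [NormedSpace ℝ G] {f : SpaceTime d → E} (hf : Integrable f) {C : ℝ}
    (hC : ∀ q, ‖f q‖ ≤ C) {Φ : SpaceTime d → E → G} (hΦ : ∀ q, Continuous (Φ q))
    {b : SpaceTime d → ℝ} (hb : Integrable b) (hΦb : ∀ q w, ‖w‖ ≤ C → ‖Φ q w‖ ≤ b q)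
    (hm : ∀ ζ, AEStronglyMeasurable (fun q => Φ q (f (q + ζ)))) :
    Continuous fun ζ => ∫ q, Φ q (f (q + ζ)) := by
  have hL : MemLp f 1 volume := memLp_one_iff_integrable.2 hf
  refine continuous_iff_seqContinuous.2 fun ζs ζ hζ => ?_
  refine tendsto_of_subseq_tendsto fun ns hns => ?_
  have h1 := tendstoInMeasure_of_tendsto_Lp
    (((continuous_toLp_translate hL).tendsto ζ).comp (hζ.comp hns))
  obtain ⟨ms, hms, hae⟩ := h1.exists_seq_tendsto_ae
  refine ⟨ms, ?_⟩
  refine tendsto_integral_of_dominated_convergence b (fun n => hm _) hb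
    (fun n => ae_of_all _ fun q => hΦb q _ (hC _)) ?_
  have h2 : ∀ᵐ q, ∀ n, (hL.comp_measurePreserving (measurePreserving_add_right volume
      (ζs (ns (ms n))))).toLp _ q = f (q + ζs (ns (ms n))) :=
    ae_all_iff.2 fun n => MemLp.coeFn_toLp _
  have h3 := MemLp.coeFn_toLp (hL.comp_measurePreserving (measurePreserving_add_right volume ζ))
  filter_upwards [hae, h2, h3] with q hq1 hq2 hq3
  refine ((hΦ q).tendsto _).comp ?_
  simp only [Function.comp_apply] at hq1 hq3
  rw [← hq3]
  exact hq1.congr hq2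

section Continuity

variable {S : Set (SpaceTime d)} {v : SpaceTime d → Space d} {p φ k : SpaceTime d → ℝ} {C r : ℝ}

lemma LocalEulerFlow.continuous_integral_pairFlux (h : LocalEulerFlow S v p C)
    (hφ : IsTestFunction S φ) : Continuous fun ζ => ∫ q, pairFlux φ v q (q + ζ) := by
  have hi := (hφ.smooth.continuous.integrable_of_hasCompactSupport (μ := volume) hφ.compact).norm
  refine continuous_integral_comp_translate h.integrable h.bounded
    (Φ := fun q w => (φ q * ‖w - v q‖ ^ 2) • (w - v q)) (fun q => by fun_prop)
    (hi.mul_const ((2 * C) ^ 2 * (2 * C))) (fun q w hw => ?_)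
    (fun ζ => (h.integrable_pairFlux hφ ζ).aestronglyMeasurable)
  have hd : ‖w - v q‖ ≤ 2 * C := by
    refine (norm_sub_le _ _).trans ?_
    linarith [h.bounded q]
  rw [norm_smul, norm_mul, norm_pow, norm_norm, mul_assoc]
  have := (norm_nonneg _).trans hd
  gcongr

/-- The pressure is unbounded, so the translation is moved onto the bounded factor `v · ∇φ`, with
the displacement changing sign. -/
lemma LocalEulerFlow.continuous_integral_pressure (h : LocalEulerFlow S v p C)
    (hφ : IsTestFunction S φ) :
    Continuous fun ζ => ∫ q, p (q + ζ) * inner ℝ (v q) (gradX φ q) := by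
  obtain ⟨M, hM0, hM⟩ := exists_norm_le_of_hasCompactSupport hφ.continuous_gradX
    hφ.hasCompactSupport_gradX
  have hm := h.measurable.measurable
  have hm' := h.measurable_pressure.measurable
  have hc := hφ.continuous_gradX.measurable
  have hC0 : 0 ≤ C := (norm_nonneg _).trans (h.bounded 0)
  have hb : ∀ q, ‖inner ℝ (v q) (gradX φ q)‖ ≤ C * M := fun q =>
    (norm_inner_le_norm _ _).trans (mul_le_mul (h.bounded q) (hM q) (norm_nonneg _) hC0)
  have hi : Integrable fun q => inner ℝ (v q) (gradX φ q) := by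
    refine (h.integrable.norm.mul_const M).mono' (by fun_prop) (ae_of_all _ fun q => ?_)
    exact (norm_inner_le_norm _ _).trans (by gcongr; exact hM q)
  have := (continuous_integral_comp_translate hi hb (Φ := fun q w => p q * w)
    (fun q => by fun_prop) (h.integrable_pressure.norm.mul_const (C * M))
    (fun q w hw => by rw [norm_mul]; gcongr) (fun ζ => by fun_prop)).comp continuous_neg
  refine this.congr fun ζ => ?_
  rw [Function.comp_apply, ← integral_add_right_eq_self _ ζ]
  simp

lemma LocalEulerFlow.continuous_integral_pairEnergy (h : LocalEulerFlow S v p C)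
    (hφ : IsTestFunction S φ) : Continuous fun ζ => ∫ q, pairEnergy φ v p q (q + ζ) := by
  have hm := h.measurable.measurable
  have hm' := h.measurable_pressure.measurable
  have hc1 := hφ.continuous_derivT.measurable
  have hc2 := hφ.continuous_gradX.measurable
  have i1 := (hφ.continuous_derivT.integrable_of_hasCompactSupport (μ := volume)
    hφ.hasCompactSupport_derivT).abs
  have i2 := (hφ.continuous_gradX.integrable_of_hasCompactSupport (μ := volume)
    hφ.hasCompactSupport_gradX).norm
  obtain ⟨M, hM0, hM⟩ := exists_norm_le_of_hasCompactSupport hφ.continuous_gradX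
    hφ.hasCompactSupport_gradX
  have hC0 : 0 ≤ C := (norm_nonneg _).trans (h.bounded 0)
  have ip : ∀ ζ, Integrable fun q => p (q + ζ) * inner ℝ (v q) (gradX φ q) := fun ζ => by
    refine ((h.integrable_pressure.comp_add_right ζ).norm.mul_const (C * M)).mono'
      (by fun_prop) (ae_of_all _ fun q => ?_)
    rw [norm_mul]
    gcongr
    exact (norm_inner_le_norm _ _).trans (mul_le_mul (h.bounded q) (hM q) (norm_nonneg _) hC0)
  have e : ∀ ζ q, pairEnergy φ v p q (q + ζ) =
      energyForm (derivT φ q) (gradX φ q) (v q) (p q) (v (q + ζ)) 0 +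
        2 * (p (q + ζ) * inner ℝ (v q) (gradX φ q)) := fun ζ q => by
    simp only [pairEnergy, energyForm]; ring
  have hΦi : ∀ ζ, Integrable fun q =>
      energyForm (derivT φ q) (gradX φ q) (v q) (p q) (v (q + ζ)) 0 := fun ζ => by
    refine ((h.integrable_pairEnergy hφ ζ).sub ((ip ζ).const_mul 2)).congr
      (ae_of_all _ fun q => ?_)
    simp only [Pi.sub_apply, e]; ring
  have hcont : Continuous fun ζ => ∫ q,
      energyForm (derivT φ q) (gradX φ q) (v q) (p q) (v (q + ζ)) 0 := by
    refine continuous_integral_comp_translate h.integrable h.bounded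
      (Φ := fun q w => energyForm (derivT φ q) (gradX φ q) (v q) (p q) w 0)
      (fun q => by unfold energyForm; fun_prop)
      (((i1.const_mul (2 * C ^ 2)).add (i2.const_mul (4 * C ^ 3))).add
      (h.integrable_pressure.abs.const_mul (2 * C * M)))
      (fun q w hw => ?_) (fun ζ => (hΦi ζ).aestronglyMeasurable)
    refine (norm_energyForm_le (h.bounded q) hw).trans ?_
    simp only [Pi.add_apply, abs_zero, add_zero]
    gcongr
    exact hM q
  refine (hcont.add ((h.continuous_integral_pressure hφ).const_mul 2)).congr fun ζ => ?_
  simp only [e]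
  rw [integral_add (hΦi ζ) ((ip ζ).const_mul 2), integral_const_mul]
  rfl

end Continuity

-- Removing the time regularization and letting the scale tend to zero.

section Scaling

variable {ρ : Space d → ℝ} {η : ℝ → ℝ} {ε r : ℝ}

lemma IsKernel.eq_zero (hρ : IsKernel ρ) {z : Space d} (hz : z ∉ Metric.closedBall 0 1) :
    ρ z = 0 :=
  hρ.test.eq_zero fun h => hz (Metric.ball_subset_closedBall h)

lemma IsKernel.gradient_eq_zero' (hρ : IsKernel ρ) {z : Space d}
    (hz : z ∉ Metric.closedBall 0 1) : gradient ρ z = 0 :=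
  hρ.gradient_eq_zero (by rw [mem_closedBall_zero_iff, not_le] at hz; exact hz.le)

lemma IsKernel.isTestFunction_tensor (hρ : IsKernel ρ) (hε : 0 < ε) (hεr : ε ≤ r)
    (hη : IsTestFunction (Metric.ball 0 r) η) :
    IsTestFunction (Metric.ball (0 : SpaceTime d) r) fun ζ => ρ (ε⁻¹ • ζ.1) * η ζ.2 := by
  have hsub : (Function.support fun ζ : SpaceTime d => ρ (ε⁻¹ • ζ.1) * η ζ.2) ⊆
      ((fun y => ε⁻¹ • y) ⁻¹' tsupport ρ) ×ˢ tsupport η := fun ζ hζ =>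
    ⟨subset_tsupport _ (left_ne_zero_of_mul hζ), subset_tsupport _ (right_ne_zero_of_mul hζ)⟩
  have hc : IsCompact (((fun y => ε⁻¹ • y) ⁻¹' tsupport ρ) ×ˢ tsupport η) :=
    ((Homeomorph.smulOfNeZero ε⁻¹ (inv_ne_zero hε.ne')).isCompact_preimage.2
      hρ.test.compact).prod hη.compact
  have hs1 : ContDiff ℝ ∞ fun ζ : SpaceTime d => ρ (ε⁻¹ • ζ.1) :=
    hρ.test.smooth.comp (contDiff_fst.const_smul _)
  have hs2 : ContDiff ℝ ∞ fun ζ : SpaceTime d => η ζ.2 := hη.smooth.comp contDiff_snd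
  refine ⟨hs1.mul hs2, HasCompactSupport.of_support_subset_isCompact hc hsub,
    (closure_minimal hsub hc.isClosed).trans fun ζ hζ => ?_⟩
  have h1 := hρ.test.subset hζ.1
  have h2 := hη.subset hζ.2
  rw [mem_ball_zero_iff] at h1 h2 ⊢
  rw [norm_smul, norm_inv, Real.norm_of_nonneg hε.le, inv_mul_lt_one₀ hε] at h1
  exact max_lt (h1.trans_le hεr) h2

lemma IsKernel.gradX_tensor (hρ : IsKernel ρ) (ζ : SpaceTime d) :
    gradX (fun ζ => ρ (ε⁻¹ • ζ.1) * η ζ.2) ζ = (η ζ.2 * ε⁻¹) • gradient ρ (ε⁻¹ • ζ.1) := by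
  have hd : Differentiable ℝ ρ := hρ.test.smooth.differentiable (by simp)
  have h1 : HasFDerivAt (fun y => ρ (ε⁻¹ • y)) (ε⁻¹ • fderiv ℝ ρ (ε⁻¹ • ζ.1)) ζ.1 := by
    have := (hd (ε⁻¹ • ζ.1)).hasFDerivAt.comp ζ.1 ((hasFDerivAt_id ζ.1).const_smul ε⁻¹)
    rw [ContinuousLinearMap.comp_smul, ContinuousLinearMap.comp_id] at this
    exact this
  refine ext_inner_right ℝ fun w => ?_
  change inner ℝ (gradient (fun y => ρ (ε⁻¹ • y) * η ζ.2) ζ.1) w = _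
  rw [inner_gradient_left, (h1.mul_const (η ζ.2)).fderiv, inner_smul_left, inner_gradient_left]
  simp
  ring

lemma continuous_integral_of_eq_zero {Y G : Type*} [TopologicalSpace Y]
    [FirstCountableTopology Y] [LocallyCompactSpace Y] [NormedAddCommGroup G] [NormedSpace ℝ G]
    {f : Y → Space d → G}
    (hf : Continuous f.uncurry) (h0 : ∀ y z, z ∉ Metric.closedBall 0 1 → f y z = 0) :
    Continuous fun y => ∫ z, f y z := by
  have := continuous_parametric_integral_of_continuous (μ := volume) hf
    (isCompact_closedBall (0 : Space d) 1)
  refine this.congr fun y => setIntegral_eq_integral_of_forall_compl_eq_zero fun z hz => h0 y z hz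

/-- The identity is known for smooth space-time kernels, while `approx` uses purely spatial
increments. Testing with `ρ(y / ε) η(s)` for all η supported near 0 shows that a continuous function
Ψ of the time displacement vanishes almost everywhere near 0, hence at 0. -/
lemma IsKernel.integral_gradient_eq (hρ : IsKernel ρ) (hε : 0 < ε) (hεr : ε ≤ r)
    {A : SpaceTime d → ℝ} {B : SpaceTime d → Space d} (hA : Continuous A) (hB : Continuous B)
    (hAB : ∀ k, IsTestFunction (Metric.ball 0 r) k →
      ∫ ζ, (inner ℝ (gradX k ζ) (B ζ) - k ζ * A ζ) = 0) :
    ε⁻¹ * ∫ z, inner ℝ (gradient ρ z) (B (ε • z, 0)) = ∫ z, ρ z * A (ε • z, 0) := by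
  have hr : 0 < r := hε.trans_le hεr
  have hg := hρ.continuous_gradient
  have hc := hρ.test.smooth.continuous
  set Ψ : ℝ → ℝ := fun s =>
    ∫ z, (ε⁻¹ * inner ℝ (gradient ρ z) (B (ε • z, s)) - ρ z * A (ε • z, s)) with hΨ
  have hΨc : Continuous Ψ := continuous_integral_of_eq_zero
    (f := fun s z => ε⁻¹ * inner ℝ (gradient ρ z) (B (ε • z, s)) - ρ z * A (ε • z, s))
    (by simp only [Function.uncurry_def]; fun_prop)
    fun s z hz => by rw [hρ.eq_zero hz, hρ.gradient_eq_zero' hz]; simp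
  have hΨη : ∀ η : ℝ → ℝ, ContDiff ℝ ∞ η → HasCompactSupport η → tsupport η ⊆ Metric.ball 0 r →
      ∫ s, η s • Ψ s = 0 := by
    intro η h1 h2 h3
    have hk := hρ.isTestFunction_tensor hε hεr ⟨h1, h2, h3⟩
    have h := hAB _ hk
    have hcη := h1.continuous
    have hi : Integrable fun ζ : SpaceTime d =>
        inner ℝ (gradX (fun ζ => ρ (ε⁻¹ • ζ.1) * η ζ.2) ζ) (B ζ) -
          ρ (ε⁻¹ • ζ.1) * η ζ.2 * A ζ := by
      have hcg := hk.continuous_gradX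
      refine Continuous.integrable_of_hasCompactSupport (by fun_prop)
        (HasCompactSupport.intro hk.compact fun ζ hζ => ?_)
      rw [IsTestFunction.gradX_eq_zero ⟨hk.smooth, hk.compact, subset_rfl⟩ hζ,
        image_eq_zero_of_notMem_tsupport (f := fun ζ : SpaceTime d => ρ (ε⁻¹ • ζ.1) * η ζ.2) hζ]
      simp
    erw [integral_prod_symm _ hi] at h
    have e : ∀ s, ∫ y : Space d, (inner ℝ (gradX (fun ζ => ρ (ε⁻¹ • ζ.1) * η ζ.2) (y, s))
        (B (y, s)) - ρ (ε⁻¹ • y) * η s * A (y, s)) = ε ^ d * (η s • Ψ s) := by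
      intro s
      -- The substitution `y = ε z` produces `ε ^ d`, which factors out and is harmless because it
      -- is positive.
      have hs := Measure.integral_comp_inv_smul_of_nonneg (μ := (volume : Measure (Space d)))
        (fun z => ε⁻¹ * inner ℝ (gradient ρ z) (B (ε • z, s)) - ρ z * A (ε • z, s)) hε.le
      rw [finrank_euclideanSpace_fin, smul_eq_mul] at hs
      rw [smul_eq_mul, mul_left_comm, hΨ, ← hs, ← integral_const_mul]
      refine integral_congr_ae (ae_of_all _ fun y => ?_)
      simp only [hρ.gradX_tensor, inner_smul_left, smul_smul, mul_inv_cancel₀ hε.ne', one_smul]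
      simp
      ring
    simp only [e] at h
    rw [integral_const_mul] at h
    exact (mul_eq_zero.1 h).resolve_left (pow_pos hε d).ne'
  have hae := Metric.isOpen_ball.ae_eq_zero_of_integral_contDiff_smul_eq_zero (μ := volume)
    (hΨc.locallyIntegrable.locallyIntegrableOn _) hΨη
  have h0 : Ψ 0 = 0 :=
    Measure.eqOn_open_of_ae_eq (f := Ψ) (g := fun _ => 0) (μ := volume)
      ((ae_restrict_iff' Metric.isOpen_ball.measurableSet).2 hae) Metric.isOpen_ball
      hΨc.continuousOn continuousOn_const (Metric.mem_ball_self hr)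
  have i1 : Integrable fun z => inner ℝ (gradient ρ z) (B (ε • z, 0)) :=
    Continuous.integrable_of_hasCompactSupport (by fun_prop)
      (HasCompactSupport.intro (isCompact_closedBall 0 1) fun z hz => by
        rw [hρ.gradient_eq_zero' hz, inner_zero_left])
  have i2 : Integrable fun z => ρ z * A (ε • z, 0) :=
    Continuous.integrable_of_hasCompactSupport (by fun_prop)
      (HasCompactSupport.intro (isCompact_closedBall 0 1) fun z hz => by
        rw [hρ.eq_zero hz, zero_mul])
  rw [hΨ] at h0
  simp only at h0
  rw [integral_sub (i1.const_mul _) i2, integral_const_mul, sub_eq_zero] at h0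
  exact h0

lemma IsKernel.tendsto_integral_mul (hρ : IsKernel ρ) {A : SpaceTime d → ℝ} (hA : Continuous A) :
    Tendsto (fun ε : ℝ => ∫ z, ρ z * A (ε • z, 0)) (𝓝 0) (𝓝 (A 0)) := by
  have hc := hρ.test.smooth.continuous
  have h := (continuous_integral_of_eq_zero (f := fun (ε : ℝ) z => ρ z * A (ε • z, 0))
    (by simp only [Function.uncurry_def]; fun_prop)
    fun s z hz => by rw [hρ.eq_zero hz, zero_mul]).tendsto 0
  have e : ∫ z, ρ z * A ((0 : ℝ) • z, 0) = A 0 := by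
    simp only [zero_smul]
    rw [integral_mul_const, hρ.integral_eq_one, one_mul]; rfl
  rwa [e] at h

end Scaling

-- The energy balance as a limit of the approximations.

section Energy

variable {S : Set (SpaceTime d)} {v : SpaceTime d → Space d} {p φ : SpaceTime d → ℝ} {C : ℝ}

/-- The energy balance of `(v, p)` tested against `φ`. -/
def energyBalance (v : SpaceTime d → Space d) (p φ : SpaceTime d → ℝ) : ℝ :=
  ∫ q, (‖v q‖ ^ 2 / 2 * derivT φ q + (‖v q‖ ^ 2 / 2 + p q) * inner ℝ (v q) (gradX φ q))

/-- On the diagonal the increment term drops out and four times the energy density remains; this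
factor matches the prefactor `1 / (4 ε)` of `approx`. -/
lemma pairEnergy_self (φ : SpaceTime d → ℝ) (v : SpaceTime d → Space d) (p : SpaceTime d → ℝ)
    (q : SpaceTime d) : pairEnergy φ v p q q = 4 * (‖v q‖ ^ 2 / 2 * derivT φ q +
      (‖v q‖ ^ 2 / 2 + p q) * inner ℝ (v q) (gradX φ q)) := by
  simp only [pairEnergy, energyForm, real_inner_self_eq_norm_sq, sub_self, inner_zero_left]
  ring

lemma integral_pairEnergy_self (φ : SpaceTime d → ℝ) (v : SpaceTime d → Space d)
    (p : SpaceTime d → ℝ) : ∫ q, pairEnergy φ v p q (q + 0) = 4 * energyBalance v p φ := by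
  simp only [add_zero, pairEnergy_self]
  rw [integral_const_mul, energyBalance]

lemma LocalEulerFlow.integrable_energyBalance (h : LocalEulerFlow S v p C)
    (hφ : IsTestFunction S φ) : Integrable fun q => ‖v q‖ ^ 2 / 2 * derivT φ q +
      (‖v q‖ ^ 2 / 2 + p q) * inner ℝ (v q) (gradX φ q) := by
  refine ((h.integrable_pairEnergy hφ 0).const_mul (1 / 4)).congr (ae_of_all _ fun q => ?_)
  simp only [add_zero, pairEnergy_self]
  ring

lemma LocalEulerFlow.energyBalance_sum (h : LocalEulerFlow S v p C) {ι : Type} [Fintype ι]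
    {φ : ι → SpaceTime d → ℝ} (hφ : ∀ i, IsTestFunction S (φ i)) :
    energyBalance v p (fun q => ∑ i, φ i q) = ∑ i, energyBalance v p (φ i) := by
  have hd : ∀ i q, DifferentiableAt ℝ (φ i) q := fun i q => (hφ i).smooth.differentiable (by simp) q
  have hf : ∀ q, fderiv ℝ (fun q => ∑ i, φ i q) q = ∑ i, fderiv ℝ (φ i) q := fun q =>
    fderiv_fun_sum fun i _ => hd i q
  have hds : ∀ q, DifferentiableAt ℝ (fun q => ∑ i, φ i q) q := fun q =>
    DifferentiableAt.fun_sum fun i _ => hd i q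
  have h1 : ∀ q, derivT (fun q => ∑ i, φ i q) q = ∑ i, derivT (φ i) q := fun q => by
    rw [derivT_eq (hds q), hf, sum_apply]
    exact Finset.sum_congr rfl fun i _ => (derivT_eq (hd i q)).symm
  have h2 : ∀ q w, inner ℝ w (gradX (fun q => ∑ i, φ i q) q) =
      ∑ i, inner ℝ w (gradX (φ i) q) := fun q w => by
    rw [real_inner_comm, inner_gradX (hds q), hf, sum_apply]
    exact Finset.sum_congr rfl fun i _ => by rw [real_inner_comm, inner_gradX (hd i q)]
  unfold energyBalance
  rw [← integral_finsetSum _ fun i _ => h.integrable_energyBalance (hφ i)]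
  refine integral_congr_ae (ae_of_all _ fun q => ?_)
  simp only [h1, h2, Finset.mul_sum, Finset.sum_add_distrib]

lemma LocalEulerFlow.integral_pairFlux_eq_mixedFlux (h : LocalEulerFlow S v p C)
    (hφ : IsTestFunction S φ) {ρ : Space d → ℝ} (hρ : IsKernel ρ) (ε : ℝ) :
    ∫ z, inner ℝ (gradient ρ z) (∫ q, pairFlux φ v q (q + (ε • z, 0))) =
      mixedFlux ρ ε φ v v := by
  have hpf : ∀ q z, pairFlux φ v q (q + (ε • z, 0)) =
      (φ q * ‖increment v (ε • z) q‖ ^ 2) • increment v (ε • z) q := fun q z => by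
    simp [pairFlux, increment, Prod.add_def]
  have hi : Integrable fun x : Space d × SpaceTime d => φ x.2 *
      (inner ℝ (gradient ρ x.1) (increment v (ε • x.1) x.2) * ‖increment v (ε • x.1) x.2‖ ^ 2) := by
    have hφi : Integrable φ :=
      hφ.smooth.continuous.integrable_of_hasCompactSupport hφ.compact
    have hb := (hρ.integrable_gradient.norm.mul_const (8 * C ^ 3)).mul_prod hφi.norm
    refine hb.mono' ?_ (ae_of_all _ fun x => ?_)
    · exact ((hφ.smooth.continuous.comp continuous_snd).stronglyMeasurable.mul
        ((stronglyMeasurable_mixedFlux_integrand hρ h.measurable h.measurable ε).comp_measurable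
          measurable_swap)).aestronglyMeasurable
    · rw [norm_mul, mul_comm]
      exact mul_le_mul_of_nonneg_right (norm_mixedFlux_integrand_le h.bounded h.bounded ρ ε x.2 x.1)
        (norm_nonneg _)
  rw [mixedFlux]
  simp only [← integral_const_mul]
  rw [← integral_integral_swap hi]
  refine integral_congr_ae (ae_of_all _ fun z => ?_)
  simp only
  rw [← integral_inner (h.integrable_pairFlux hφ _)]
  refine integral_congr_ae (ae_of_all _ fun q => ?_)
  simp only [hpf, inner_smul_right]
  ring

/-- At small fixed scale the tested approximation is a quarter of the ρ-average of the pair energy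
over displacements `ε z`. Continuity at zero displacement gives the limit, whatever the kernel and
the sequence. -/
lemma LocalEulerFlow.tendsto_integral_approx (h : LocalEulerFlow S v p C)
    (hφ : IsTestFunction S φ) {ρ : Space d → ℝ} (hρ : IsKernel ρ) {ε : ℕ → ℝ}
    (hε0 : ∀ n, 0 < ε n) (hε : Tendsto ε atTop (𝓝 0)) :
    Tendsto (fun n => ∫ q, approx ρ v (ε n) q * φ q) atTop (𝓝 (energyBalance v p φ)) := by
  obtain ⟨r, hr, hrS⟩ := IsCompact.exists_cthickening_subset_open hφ.compact h.isOpen hφ.subset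
  have hlim := ((hρ.tendsto_integral_mul (h.continuous_integral_pairEnergy hφ)).comp hε).const_mul
    (1 / 4)
  rw [integral_pairEnergy_self, ← mul_assoc, show (1 / 4 * 4 : ℝ) = 1 by norm_num, one_mul] at hlim
  refine hlim.congr' ?_
  filter_upwards [hε.eventually (gt_mem_nhds hr)] with n hn
  have := hρ.integral_gradient_eq (hε0 n) hn.le (h.continuous_integral_pairEnergy hφ)
    (h.continuous_integral_pairFlux hφ) fun k hk => h.integral_gradX_pairFlux hφ hrS hk
  rw [Function.comp_apply, ← this, integral_approx_mul, h.integral_pairFlux_eq_mixedFlux hφ hρ]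
  have := (hε0 n).ne'
  field_simp

/-- The energy balance need not be known to be a measure: `functional_eq_zero` only asks for finite
additivity and convergence on smooth test functions. -/
lemma LocalEulerFlow.energyBalance_eq_zero (h : LocalEulerFlow S v p C) {V : ℝ}
    (hV : VariationBound S v V) (hφ : IsTestFunction S φ) : energyBalance v p φ = 0 := by
  refine functional_eq_zero h.measurable h.integrable h.bounded h.isOpen h.divFree hV
    (energyBalance v p) (fun ι _ φ hφ => h.energyBalance_sum hφ) (fun ρ hρ => ?_) hφ
  exact ⟨fun n => 1 / ((n : ℝ) + 1), fun n => by positivity,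
    tendsto_one_div_add_atTop_nhds_zero_nat, fun φ hφ => h.tendsto_integral_approx hφ hρ
      (fun n => by positivity) tendsto_one_div_add_atTop_nhds_zero_nat⟩

end Energy

/-- The pressure is localized like the velocity: it is integrable on S, so a measurable
representative extended by zero makes an Euler flow on S without changing any integral against test
functions supported there. -/
theorem conservesEnergyLocally_of_isWeakEulerMomentum {Ω : Set (Space d)} (hΩ : IsOpen Ω)
    {J : Set ℝ} (hJ : IsOpen J) {u : SpaceTime d → Space d}
    (hdiv : IsDivergenceFree (Ω ×ˢ J) u)
    (hu : ∀ (O : Set (Space d)) (I : Set ℝ), IsOpen O → IsOpen I → CompactlyIn O Ω →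
      CompactlyIn I J → MemLOneBV O I u ∧ MemLp u ⊤ (volume.restrict (O ×ˢ I)))
    {p : SpaceTime d → ℝ} (hp : LocallyIntegrableOn p (Ω ×ˢ J))
    (hmom : IsWeakEulerMomentum (Ω ×ˢ J) u p) : ConservesEnergyLocally (Ω ×ˢ J) u p := by
  intro φ hφ
  obtain ⟨S, v, h, hKS, L, hL, hSL, hLU⟩ := exists_localField hΩ hJ hdiv hu hφ.compact hφ.subset
  obtain ⟨C, hC⟩ := h.bounded
  obtain ⟨V, hV⟩ := h.variation
  have hU : MeasurableSet (Ω ×ˢ J) := (hΩ.prod hJ).measurableSet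
  have hpS : IntegrableOn p S := (hp.integrableOn_compact_subset hLU hL).mono_set hSL
  set w : SpaceTime d → ℝ := S.indicator (hpS.aestronglyMeasurable.mk p) with hw
  have hwm : StronglyMeasurable w :=
    hpS.aestronglyMeasurable.stronglyMeasurable_mk.indicator h.isOpen.measurableSet
  have hwp : ∀ᵐ q ∂volume.restrict S, w q = p q := by
    filter_upwards [hpS.aestronglyMeasurable.ae_eq_mk, ae_restrict_mem h.isOpen.measurableSet]
      with q h1 h2
    rw [hw, indicator_of_mem h2, ← h1]
  have hwi : Integrable w := by
    rw [hw, integrable_indicator_iff h.isOpen.measurableSet]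
    exact hpS.congr hpS.aestronglyMeasurable.ae_eq_mk
  have hflow : LocalEulerFlow S v w C := by
    refine ⟨h.isOpen, h.measurable, h.integrable, hC, hwm, hwi, h.divFree, fun θ hθ i => ?_⟩
    rw [← hmom θ (hθ.mono h.subset) i]
    refine (setIntegral_eq_integral_of_ae_eq hU h.subset ?_
      (fun q hq => by rw [hθ.gradX_eq_zero hq, hθ.derivT_eq_zero hq]; simp)
      (fun q hq => by rw [hθ.gradX_eq_zero hq, hθ.derivT_eq_zero hq]; simp)).symm
    filter_upwards [h.ae_eq, hwp] with q h1 h2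
    rw [h1, h2]
  have hφS : IsTestFunction S φ := ⟨hφ.smooth, hφ.compact, hKS⟩
  rw [← hflow.energyBalance_eq_zero hV hφS]
  refine setIntegral_eq_integral_of_ae_eq hU h.subset ?_
    (fun q hq => by rw [hφS.gradX_eq_zero hq, hφS.derivT_eq_zero hq]; simp)
    (fun q hq => by rw [hφS.gradX_eq_zero hq, hφS.derivT_eq_zero hq]; simp)
  filter_upwards [h.ae_eq, hwp] with q h1 h2
  rw [h1, h2]

end DuchonRobert

end

theorem theorem1p2 {d : ℕ} (Ω : Set (DuchonRobert.Space d)) (hΩ : IsOpen Ω) (T : ℝ)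
    (u : DuchonRobert.Space d × ℝ → DuchonRobert.Space d)
    (hdiv : DuchonRobert.IsDivergenceFree (Ω ×ˢ Set.Ioo 0 T) u)
    (hu : ∀ (O : Set (DuchonRobert.Space d)) (I : Set ℝ), IsOpen O → IsOpen I →
      DuchonRobert.CompactlyIn O Ω → DuchonRobert.CompactlyIn I (Set.Ioo 0 T) →
      DuchonRobert.MemLOneBV O I u ∧
        MeasureTheory.MemLp u ⊤ (MeasureTheory.volume.restrict (O ×ˢ I))) :
    (∀ D : DuchonRobert.SignedRadonMeasure (Ω ×ˢ Set.Ioo 0 T),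
      (∀ ρ : DuchonRobert.Space d → ℝ, DuchonRobert.IsKernel ρ →
        DuchonRobert.IsWeakLimit (Ω ×ˢ Set.Ioo 0 T) ρ u D) →
      ∀ K : Set (DuchonRobert.Space d × ℝ), IsCompact K → K ⊆ Ω ×ˢ Set.Ioo 0 T →
        D.variation K = 0) ∧
    (∀ p : DuchonRobert.Space d × ℝ → ℝ,
      MeasureTheory.LocallyIntegrableOn p (Ω ×ˢ Set.Ioo 0 T) →
      DuchonRobert.IsWeakEulerMomentum (Ω ×ˢ Set.Ioo 0 T) u p →
        DuchonRobert.ConservesEnergyLocally (Ω ×ˢ Set.Ioo 0 T) u p) :=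
  ⟨fun D hD _ hK hKU =>
    DuchonRobert.variation_eq_zero_of_isWeakLimit hΩ isOpen_Ioo hdiv hu D hD hK hKU,
  fun _ hp hmom =>
    DuchonRobert.conservesEnergyLocally_of_isWeakEulerMomentum hΩ isOpen_Ioo hdiv hu hp hmom⟩
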